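/- **Setting.** Let $\ell,n,R$ be positive integers. A *multi-view mixture model* with parameters $M^{(1)},\dots,M^{(\ell)}\in\mathbb R^{n\times R}$, $w\in\mathbb R^R$ and $c_{\max}$ consists of a latent random variable $h\in[R]$ with $\Pr[h=r]=w_r$ and of random vectors (views) $x^{(1)},\dots,x^{(\ell)}\in\mathbb R^n$ that are conditionally independent given $h$, satisfy $\|x^{(j)}\|_\infty\le c_{\max}$ almost surely, and have $\mathbb E[x^{(j)}\mid h=r]$ equal to the $r$-th column of $M^{(j)}$. A sample is one draw of $(x^{(1)},\dots,x^{(\ell)})$; $h$ is not observed. For $\tau>0$, the $\tau$-robust Kruskal rank $\mathrm{K\text{-}rank}_\tau(A)$ of an $n\times R$ matrix $A$ is the largest $k\le R$ such that every $n\times k$ submatrix $A_{|S}$ formed by $k$ columns of $A$ has $k$-th largest singular value $\sigma_k(A_{|S})\ge 1/\tau$. Algorithms are programs of a deterministic real random access machine: arithmetic $+,-,\times,\div$ and comparisons on real numbers, and addition, subtraction, comparison and (indirect) indexing on natural numbers, at unit cost. **Theorem (polynomial identifiability of multi-view mixture models).** There is an absolute constant $C$ such that the following holds for all constant integers $\ell\ge1$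 and $a\ge 0$. There are an algorithm, a polynomial $\vartheta$ in six variables and a univariate polynomial $q$ (all depending only on $\ell$ and $a$) such that, for all $n,R$, all $\eta>0$, $\tau\ge1$, $\gamma>0$, $c_{\max}$, and every multi-view mixture model as above that satisfies (a) $w_r>\gamma$ for each $r\in[R]$, (b) $\mathrm{K\text{-}rank}_\tau(M^{(j)})\ge k\ge \frac{2R}{\ell}+1$ for each $j\in[\ell]$, for some integer $k$, the algorithm, given $n,R,\eta,\tau,\gamma,c_{\max}$ and $N=\lceil\vartheta(1/\eta,R,n,\tau,1/\gamma,c_{\max})\rceil$ independent samples of the model, outputs with probability at least $1-n^{-a}$ matrices $\tilde M^{(1)},\dots,\tilde M^{(\ell)}$ and weights $\tilde w_1,\dots,\tilde w_R$ such that, after one common renaming of the components $1,\dots,R$, $$\|M^{(j)}-\tilde M^{(j)}\|_F\le\eta\quad\text{for all } j\in[\ell],\qquad |w_r-\tilde w_r|<\eta\quad\text{for all } r\in[R].$$ Moreover, on every input of $N$ samples the algorithm halts within $$\exp\Bigl(C\,R^2\ell^2\Bigl[2^{2\ell}\log\frac{R\ell}{\min(\eta,1)}+\ell\log\Bigl(n\cdot\frac{\tau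 c_{\max}}{\gamma}\Bigr)\Bigr]\Bigr)\cdot q(n)$$ steps. -/

import Mathlib

open MeasureTheory ProbabilityTheory

noncomputable section

/-! ### Matrices -/

/-- The `τ`-robust Kruskal rank of an `n × R` matrix `A`: the largest `k ≤ R` such that every
`n × k` submatrix formed by `k` columns of `A` has `σ_k ≥ 1 / τ` (and `0` if there is no such
`k ≥ 1`).  Mathlib's singular values are listed in decreasing order and indexed from `0`, so `σ_k`
is entry `k - 1`; it is `0` if `n < k`. -/
def robustKruskalRank {n R : ℕ} (τ : ℝ) (A : Matrix (Fin n) (Fin R) ℝ) : ℕ :=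
  sSup {k : ℕ | 1 ≤ k ∧ k ≤ R ∧ ∀ S : Finset (Fin R), S.card = k →
    1 / τ ≤ (Matrix.toEuclideanLin
      (A.submatrix id (fun s : S => (s : Fin R)))).singularValues (k - 1)}

/-- The Frobenius norm. -/
def frobeniusNorm {n R : ℕ} (A : Matrix (Fin n) (Fin R) ℝ) : ℝ :=
  letI := Matrix.frobeniusNormedAddCommGroup (m := Fin n) (n := Fin R) (α := ℝ)
  ‖A‖

/-! ### Multi-view mixture models -/

/-- A multi-view mixture model with `ℓ` views in `ℝⁿ` and `R` mixture components: a latent variable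
`h` with `P(h = r) = w r`, and views `x 0, …, x (ℓ - 1)` that are conditionally independent given
`h`, have conditional means `E[x j | h = r]` equal to the `r`-th column of `M j`, and have entries
bounded by `cmax`.  Conditioning on `h = r` is required only when that event has positive
probability. -/
structure IsMultiViewMixture {Ω : Type*} [MeasurableSpace Ω] (P : Measure Ω) {ℓ n R : ℕ}
    (h : Ω → Fin R) (x : Fin ℓ → Ω → (Fin n → ℝ)) (w : Fin R → ℝ)
    (M : Fin ℓ → Matrix (Fin n) (Fin R) ℝ) (cmax : ℝ) : Prop where
  isProbabilityMeasure : IsProbabilityMeasure P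
  measurable_latent : Measurable h
  measurable_view : ∀ j, Measurable (x j)
  weight : ∀ r, P.real (h ⁻¹' {r}) = w r
  condIndep : ∀ r, P (h ⁻¹' {r}) ≠ 0 → iIndepFun x (P[|h ⁻¹' {r}])
  mean : ∀ r, P (h ⁻¹' {r}) ≠ 0 → ∀ j i, ∫ ω, x j ω i ∂(P[|h ⁻¹' {r}]) = M j i r
  bounded : ∀ j, ∀ᵐ ω ∂P, ∀ i, |x j ω i| ≤ cmax

/-- The law of `N` independent samples of the views `(x 0, …, x (ℓ - 1))`. -/
def sampleLaw {Ω : Type*} [MeasurableSpace Ω] (P : Measure Ω) {ℓ n : ℕ}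
    (x : Fin ℓ → Ω → (Fin n → ℝ)) (N : ℕ) : Measure (Fin N → Fin ℓ → Fin n → ℝ) :=
  Measure.pi fun _ => P.map fun ω j => x j ω

/-! ### The machine model: a real random access machine

Programs are structured programs over two memories, one holding natural numbers and one holding real
numbers.  Cells are addressed by finite tuples of natural numbers (multi-dimensional arrays, with
computed indices).  Available at unit cost are addition and truncated subtraction of naturals,
field operations on reals, the inclusion of the naturals in the reals, rational constants, and
comparisons.  There is no rounding, no root extraction, no multiplication of naturals and no
randomness.  Division of reals by `0` returns `0`. -/

namespace RealRAM

/-- A memory state. -/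
structure State where
  nat : List ℕ → ℕ
  real : List ℕ → ℝ

/-- Expressions with values in `ℕ`; `load k idx` reads the cell with the `k`-tuple address `idx`. -/
inductive NExp where
  | const (c : ℕ)
  | load (k : ℕ) (idx : Fin k → NExp)
  | add (a b : NExp)
  | sub (a b : NExp)

/-- The value of an expression. -/
def NExp.eval (σ : State) : NExp → ℕ
  | .const c => c
  | .load _ idx => σ.nat (List.ofFn fun i => (idx i).eval σ)
  | .add a b => a.eval σ + b.eval σ
  | .sub a b => a.eval σ - b.eval σ

/-- The number of elementary operations needed to evaluate an expression. -/
def NExp.cost : NExp → ℕ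
  | .const _ => 1
  | .load _ idx => 1 + ∑ i, (idx i).cost
  | .add a b => 1 + a.cost + b.cost
  | .sub a b => 1 + a.cost + b.cost

/-- Expressions with values in `ℝ`. -/
inductive RExp where
  | const (c : ℚ)
  | ofNat (a : NExp)
  | load (k : ℕ) (idx : Fin k → NExp)
  | add (a b : RExp)
  | sub (a b : RExp)
  | mul (a b : RExp)
  | div (a b : RExp)

/-- The value of an expression. -/
def RExp.eval (σ : State) : RExp → ℝ
  | .const c => c
  | .ofNat a => a.eval σ
  | .load _ idx => σ.real (List.ofFn fun i => (idx i).eval σ)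
  | .add a b => a.eval σ + b.eval σ
  | .sub a b => a.eval σ - b.eval σ
  | .mul a b => a.eval σ * b.eval σ
  | .div a b => a.eval σ / b.eval σ

/-- The number of elementary operations needed to evaluate an expression. -/
def RExp.cost : RExp → ℕ
  | .const _ => 1
  | .ofNat a => 1 + a.cost
  | .load _ idx => 1 + ∑ i, (idx i).cost
  | .add a b => 1 + a.cost + b.cost
  | .sub a b => 1 + a.cost + b.cost
  | .mul a b => 1 + a.cost + b.cost
  | .div a b => 1 + a.cost + b.cost

/-- Tests. -/
inductive Test where
  | leN (a b : NExp)
  | leR (a b : RExp)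
  | neg (b : Test)
  | conj (b c : Test)

/-- The truth value of a test. -/
def Test.Holds (σ : State) : Test → Prop
  | .leN a b => a.eval σ ≤ b.eval σ
  | .leR a b => a.eval σ ≤ b.eval σ
  | .neg b => ¬ b.Holds σ
  | .conj b c => b.Holds σ ∧ c.Holds σ

/-- The number of elementary operations needed to evaluate a test. -/
def Test.cost : Test → ℕ
  | .leN a b => 1 + a.cost + b.cost
  | .leR a b => 1 + a.cost + b.cost
  | .neg b => 1 + b.cost
  | .conj b c => 1 + b.cost + c.cost

/-- Programs. -/
inductive Program where
  | skip
  | setN (k : ℕ) (idx : Fin k → NExp) (e : NExp)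
  | setR (k : ℕ) (idx : Fin k → NExp) (e : RExp)
  | seq (p q : Program)
  | ite (b : Test) (p q : Program)
  | while (b : Test) (p : Program)

/-- `Exec p σ σ' t`: the program `p`, started in the state `σ`, halts in the state `σ'` after exactly
`t` elementary steps. -/
inductive Exec : Program → State → State → ℕ → Prop
  | skip (σ : State) : Exec .skip σ σ 1
  | setN (σ : State) (k : ℕ) (idx : Fin k → NExp) (e : NExp) :
      Exec (.setN k idx e) σ
        { σ with nat := Function.update σ.nat (List.ofFn fun i => (idx i).eval σ) (e.eval σ) }
        (1 + ∑ i, (idx i).cost + e.cost)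
  | setR (σ : State) (k : ℕ) (idx : Fin k → NExp) (e : RExp) :
      Exec (.setR k idx e) σ
        { σ with real := Function.update σ.real (List.ofFn fun i => (idx i).eval σ) (e.eval σ) }
        (1 + ∑ i, (idx i).cost + e.cost)
  | seq {p q : Program} {σ σ₁ σ₂ : State} {s t : ℕ} :
      Exec p σ σ₁ s → Exec q σ₁ σ₂ t → Exec (.seq p q) σ σ₂ (s + t)
  | ite_true {b : Test} {p q : Program} {σ σ' : State} {t : ℕ} :
      b.Holds σ → Exec p σ σ' t → Exec (.ite b p q) σ σ' (1 + b.cost + t)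
  | ite_false {b : Test} {p q : Program} {σ σ' : State} {t : ℕ} :
      ¬ b.Holds σ → Exec q σ σ' t → Exec (.ite b p q) σ σ' (1 + b.cost + t)
  | while_false {b : Test} {p : Program} {σ : State} :
      ¬ b.Holds σ → Exec (.while b p) σ σ (1 + b.cost)
  | while_true {b : Test} {p : Program} {σ σ₁ σ₂ : State} {s t : ℕ} :
      b.Holds σ → Exec p σ σ₁ s → Exec (.while b p) σ₁ σ₂ t →
        Exec (.while b p) σ σ₂ (1 + b.cost + s + t)

/-- Programs are deterministic: the final state and the running time are determined by the initial
state. -/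
theorem Exec.deterministic {p : Program} {σ σ₁ σ₂ : State} {t₁ t₂ : ℕ}
    (h₁ : Exec p σ σ₁ t₁) (h₂ : Exec p σ σ₂ t₂) : σ₁ = σ₂ ∧ t₁ = t₂ := by
  induction h₁ generalizing σ₂ t₂ with
  | skip => cases h₂; exact ⟨rfl, rfl⟩
  | setN => cases h₂; exact ⟨rfl, rfl⟩
  | setR => cases h₂; exact ⟨rfl, rfl⟩
  | seq _ _ ih₁ ih₂ =>
    cases h₂ with
    | seq a b =>
      obtain ⟨rfl, rfl⟩ := ih₁ a
      obtain ⟨rfl, rfl⟩ := ih₂ b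
      exact ⟨rfl, rfl⟩
  | ite_true hb _ ih =>
    cases h₂ with
    | ite_true _ a => obtain ⟨rfl, rfl⟩ := ih a; exact ⟨rfl, rfl⟩
    | ite_false hb' _ => exact absurd hb hb'
  | ite_false hb _ ih =>
    cases h₂ with
    | ite_true hb' _ => exact absurd hb' hb
    | ite_false _ a => obtain ⟨rfl, rfl⟩ := ih a; exact ⟨rfl, rfl⟩
  | while_false hb =>
    cases h₂ with
    | while_false _ => exact ⟨rfl, rfl⟩
    | while_true hb' _ _ => exact absurd hb' hb
  | while_true hb _ _ ih₁ ih₂ =>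
    cases h₂ with
    | while_false hb' => exact absurd hb hb'
    | while_true _ a b =>
      obtain ⟨rfl, rfl⟩ := ih₁ a
      obtain ⟨rfl, rfl⟩ := ih₂ b
      exact ⟨rfl, rfl⟩

end RealRAM

/-! ### The learning problem -/

/-- The initial state of a learning program: the dimension `n`, the number `R` of components and the
number `N` of samples are in the natural cells `(0)`, `(1)`, `(2)`; the accuracy `η` and the
parameters `τ`, `γ`, `cmax` are in the real cells `(0)`, `(1)`, `(2)`, `(3)`; coordinate `i` of view
`j` of sample `t` is in the real cell `(4, t, j, i)`; all other cells are `0`. -/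
def inputState {ℓ n N : ℕ} (R : ℕ) (η τ γ cmax : ℝ) (s : Fin N → Fin ℓ → Fin n → ℝ) :
    RealRAM.State where
  nat
    | [0] => n
    | [1] => R
    | [2] => N
    | _ => 0
  real
    | [0] => η
    | [1] => τ
    | [2] => γ
    | [3] => cmax
    | [4, t, j, i] =>
      if h : t < N ∧ j < ℓ ∧ i < n then s ⟨t, h.1⟩ ⟨j, h.2.1⟩ ⟨i, h.2.2⟩ else 0
    | _ => 0

/-- The estimate of the mean matrix of view `j` in a final state: its entry `(i, r)` is in the real
cell `(5, j, i, r)`. -/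
def outputMean (n R : ℕ) (σ : RealRAM.State) (j : ℕ) : Matrix (Fin n) (Fin R) ℝ :=
  Matrix.of fun i r => σ.real [5, j, i, r]

/-- The estimate of the weight of component `r` in a final state, in the real cell `(6, r)`. -/
def outputWeight (σ : RealRAM.State) (r : ℕ) : ℝ :=
  σ.real [6, r]

/-- The output in the state `σ` agrees with the parameters `M`, `w` up to `η`, after one renaming `π`
of the mixture components that is common to all the views and the weights. -/
def Recovers {ℓ n R : ℕ} (M : Fin ℓ → Matrix (Fin n) (Fin R) ℝ) (w : Fin R → ℝ) (η : ℝ)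
    (σ : RealRAM.State) : Prop :=
  ∃ π : Equiv.Perm (Fin R),
    (∀ j : Fin ℓ, frobeniusNorm (M j - (outputMean n R σ j).submatrix id π) ≤ η) ∧
    ∀ r : Fin R, |w r - outputWeight σ (π r)| < η

/-- The number of samples `⌈ϑ(1/η, R, n, τ, 1/γ, cmax)⌉` given by a polynomial `ϑ`. -/
def sampleSize (ϑ : MvPolynomial (Fin 6) ℝ) (η : ℝ) (R n : ℕ) (τ γ cmax : ℝ) : ℕ :=
  ⌈MvPolynomial.eval ![1 / η, (R : ℝ), (n : ℝ), τ, 1 / γ, cmax] ϑ⌉₊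

/-- The exponent `R² ℓ² [2^{2ℓ} log(R ℓ / η) + ℓ log(n τ cmax / γ)]` of the running time, where an
accuracy `η > 1` is replaced by `1`. -/
def timeExponent (ℓ : ℕ) (η : ℝ) (R n : ℕ) (τ γ cmax : ℝ) : ℝ :=
  (R : ℝ) ^ 2 * (ℓ : ℝ) ^ 2 *
    ((2 : ℝ) ^ (2 * ℓ) * Real.log ((R : ℝ) * ℓ / min η 1) +
      ℓ * Real.log ((n : ℝ) * (τ * cmax / γ)))

end

/-! Divide every view by $c_{\max}$ and prepend a coordinate equal to 1. By conditional independence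
the expected tensor product of the new views is $T=\sum_r w_r\bigotimes_j a^{(j)}_r$, where
$a^{(j)}_r=(1,M^{(j)}_r/c_{\max})$. The coordinate 1 removes the scaling ambiguity of rank-one
terms, so determining the terms of $T$ determines the means and the weights. All parameters are
dominated by one number $G$ (`modelGauge`), and every threshold is a power of $G$ with exponent
linear in $\ell$.

Robust uniqueness (`TensorClose.exists_perm`) is a quantitative Kruskal theorem: if $\sum_s
v_s\bigotimes_j b^{(j)}_s$ is close to $T$ and its factors have the same normalisation, then it
agrees with $T$ term by term up to one permutation. Its core is `TensorClose.orthogonalityTransfer`: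
in any mode, a vector nearly orthogonal to $k-1$ or $k$ of the $b_s$ is nearly orthogonal to at
least as many of the $a_r$. Together with Bang's lemma this says that the span of $k-1$ of the $b_s$
has at least $k-1$ of the $a_r$ near it. Robust independence of the $a_r$ allows no more, and forces
the $b_s$ to be robustly independent too. Counting near spans of $k-1$ and then $k-2$ vectors shows
that each $b_s$ is nearly parallel to some $a_r$; the normalisation makes the factor of
proportionality nearly 1. Hall's theorem supplies product functionals that isolate one component of
both decompositions (`exists_isolating_functional`), so the matchings of the single modes coincide
and the weights are close.

It remains to find a decomposition. A grid on the factors themselves would cost time exponential in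
$n$. But each factor is a combination, with coefficients at most $G^{2\ell+1}$, of $R$ mode-$j$
columns of $T$ (`exists_column_representation`). A candidate is therefore coded by
$(\ell+\ell^2+1)R^2$ digits below $L=\lceil G^{12\ell+50}\rceil$: coefficients, column indices and
weights. The program runs through all codes and stops at the first whose tensor matches the
empirical tensor to within $G^{-(9\ell+41)}$. If the empirical tensor is accurate to
$G^{-(12\ell+50)}$, some code passes (`exists_codePasses`), and every passing code is close to the
truth (`exists_perm_of_codePasses`). Chebyshev's inequality and a union bound over the entries give
that accuracy from $G^{25\ell+100}n^a$ samples.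

The running time is about $R^2N L^{(\ell+\ell^2+1)R^2}$ times a power of $n$, and $\log G\le
4\log(R\ell/\min(\eta,1))+2\log(n\tau c_{\max}/\gamma)$. Since $C$ must not depend on $\ell$, the
analysis of the program records the exponents of $R$ and $N$ exactly, whereas the exponent of $n$ is
left unspecified and goes into $q$. -/

noncomputable section

/-! ### Robust linear independence and approximate membership in a span -/

section RobustIndependence

variable {E ι : Type*} [NormedAddCommGroup E] [InnerProductSpace ℝ E] [Fintype ι]

/-- Every linear combination of at most `k` of the vectors `a i` controls its coefficients with
constant `τ`. -/
def RobustIndep (k : ℕ) (τ : ℝ) (a : ι → E) : Prop :=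
  ∀ (S : Finset ι) (α : ι → ℝ), S.card ≤ k → (∀ r ∉ S, α r = 0) →
    ∀ r, |α r| ≤ τ * ‖∑ i, α i • a i‖

/-- The vector `v` is within distance `θ` of the span of the vectors `b s`, `s ∈ S`. -/
def NearSpan (θ : ℝ) (v : E) (b : ι → E) (S : Finset ι) : Prop :=
  ∃ c : ι → ℝ, (∀ s ∉ S, c s = 0) ∧ ‖v - ∑ s, c s • b s‖ ≤ θ

theorem NearSpan.mono {θ θ' : ℝ} {v : E} {b : ι → E} {S S' : Finset ι}
    (h : NearSpan θ v b S) (hθ : θ ≤ θ') (hS : S ⊆ S') : NearSpan θ' v b S' := by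
  obtain ⟨c, hc, hv⟩ := h
  exact ⟨c, fun s hs => hc s fun h' => hs (hS h'), hv.trans hθ⟩

open scoped RealInnerProductSpace

theorem exists_orthogonal_residual (b : ι → E) (S : Finset ι) (v : E) :
    ∃ c : ι → ℝ, (∀ s ∉ S, c s = 0) ∧ ∀ s ∈ S, ⟪v - ∑ i, c i • b i, b s⟫ = 0 := by
  classical
  set W := Submodule.span ℝ (b '' (S : Set ι)) with hW
  have : FiniteDimensional ℝ W :=
    FiniteDimensional.span_of_finite ℝ (S.finite_toSet.image b)
  have hmem : W.starProjection v ∈ W := Submodule.starProjection_apply_mem _ _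
  obtain ⟨c, hc⟩ := (Submodule.mem_span_image_finset_iff_exists_fun ℝ).1 hmem
  refine ⟨fun i => if hi : i ∈ S then c ⟨i, hi⟩ else 0, fun s hs => by simp [hs], fun s hs => ?_⟩
  have hsum : ∑ i, (if hi : i ∈ S then c ⟨i, hi⟩ else 0) • b i = W.starProjection v := by
    rw [← hc, ← Finset.sum_subset (Finset.subset_univ S) (fun r _ hr => by simp [hr]),
      ← Finset.sum_coe_sort]
    exact Finset.sum_congr rfl fun r _ => by simp
  rw [hsum]
  have := Submodule.sub_starProjection_mem_orthogonal (K := W) v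
  exact (Submodule.mem_orthogonal' _ _).1 this _
    (Submodule.subset_span ⟨s, hs, rfl⟩)

/-- Dual functionals for robustly independent vectors. -/
theorem RobustIndep.exists_dual [DecidableEq ι] {k : ℕ} {τ : ℝ} {a : ι → E} (h : RobustIndep k τ a)
    {W : Finset ι} (hW : W.card + 1 ≤ k) {r : ι} (hr : r ∉ W) :
    ∃ x : E, ‖x‖ ≤ τ ∧ ⟪x, a r⟫ = 1 ∧ ∀ s ∈ W, ⟪x, a s⟫ = 0 := by
  obtain ⟨c, hc, horth⟩ := exists_orthogonal_residual a W (a r)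
  -- `p` is a combination in which `a r` has coefficient 1, so robust independence gives `1 ≤ τ *
  -- ‖p‖`. The dual vector is `p / ‖p‖ ^ 2`.
  set p := a r - ∑ i, c i • a i with hp
  have hpsum : p = ∑ i, ((Pi.single r 1 : ι → ℝ) i - c i) • a i := by
    simp [sub_smul, hp, Pi.single_apply, ite_smul]
  have h1 : 1 ≤ τ * ‖p‖ := by
    have := h (insert r W) (fun i => (Pi.single r 1 : ι → ℝ) i - c i)
      (by rw [Finset.card_insert_of_notMem hr]; exact hW)
      (fun i hi => by
        simp only [Finset.mem_insert, not_or] at hi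
        simp [hi.1, hc i hi.2]) r
    simpa [hpsum, hc r hr] using this
  have hpos : 0 < ‖p‖ := by
    by_contra hn
    have : ‖p‖ = 0 := le_antisymm (not_lt.1 hn) (norm_nonneg _)
    rw [this] at h1; norm_num at h1
  have hpc : ⟪p, ∑ i, c i • a i⟫ = 0 := by
    rw [inner_sum]
    refine Finset.sum_eq_zero fun i _ => ?_
    rw [inner_smul_right]
    by_cases hi : i ∈ W
    · rw [horth i hi, mul_zero]
    · rw [hc i hi, zero_mul]
  have hpa : ⟪p, a r⟫ = ‖p‖ ^ 2 := by
    have : a r = p + ∑ i, c i • a i := by rw [hp]; abel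
    rw [this, inner_add_right, hpc, add_zero, real_inner_self_eq_norm_sq]
  refine ⟨(‖p‖ ^ 2)⁻¹ • p, ?_, ?_, fun s hs => ?_⟩
  · rw [norm_smul, Real.norm_of_nonneg (by positivity)]
    rw [sq, mul_inv, mul_assoc, inv_mul_cancel₀ hpos.ne', mul_one]
    rw [inv_le_iff_one_le_mul₀ hpos]; exact h1
  · rw [inner_smul_left, hpa]; simp; field_simp
  · rw [inner_smul_left, horth s hs, mul_zero]

end RobustIndependence

/-- A matrix with more rows than columns has a nonzero left kernel vector, normalised in the
supremum norm. -/
theorem exists_normalized_kernel {ι κ : Type*} [Fintype ι] (T : Finset ι) (S : Finset κ)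
    (h : S.card < T.card) (m : ι → κ → ℝ) :
    ∃ z : ι → ℝ, (∀ r ∉ T, z r = 0) ∧ (∀ s ∈ S, ∑ r, z r * m r s = 0) ∧
      (∃ r₀ ∈ T, z r₀ = 1) ∧ ∀ r, |z r| ≤ 1 := by
  classical
  let f : (T → ℝ) →ₗ[ℝ] (S → ℝ) :=
    Matrix.mulVecLin (Matrix.of fun (s : S) (r : T) => m r s)
  obtain ⟨y, hy, hy0⟩ : ∃ y ∈ LinearMap.ker f, y ≠ 0 := by
    apply Submodule.exists_mem_ne_zero_of_ne_bot
    apply LinearMap.ker_ne_bot_of_finrank_lt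
    simpa using h
  have hne : (Finset.univ : Finset T).Nonempty := by
    obtain ⟨r, -⟩ := Function.ne_iff.1 hy0
    exact ⟨r, Finset.mem_univ _⟩
  -- Dividing by the entry of largest modulus gives an entry 1 and all others at most 1 in modulus.
  obtain ⟨r₀, -, hmax⟩ := Finset.exists_max_image Finset.univ (fun r : T => |y r|) hne
  have hr0 : y r₀ ≠ 0 := by
    intro h0
    apply hy0
    funext r
    have := hmax r (Finset.mem_univ _)
    rw [h0, abs_zero] at this
    simpa using this
  refine ⟨fun r => if hr : r ∈ T then y ⟨r, hr⟩ / y r₀ else 0, fun r hr => by simp [hr],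
    fun s hs => ?_, ⟨r₀, r₀.2, by simp [hr0]⟩, fun r => ?_⟩
  · have h1 : ∑ r : T, m r s * y r = 0 := by
      have := congrFun (LinearMap.mem_ker.1 hy) ⟨s, hs⟩
      simpa [f, Matrix.mulVec, dotProduct] using this
    have h2 : ∑ r, (if hr : r ∈ T then y ⟨r, hr⟩ / y r₀ else 0) * m r s
        = ∑ r : T, (y r / y r₀) * m r s := by
      rw [← Finset.sum_subset (Finset.subset_univ T) (fun r _ hr => by simp [hr]),
        ← Finset.sum_coe_sort]
      exact Finset.sum_congr rfl fun r _ => by simp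
    rw [h2]
    have : ∑ r : T, (y r / y r₀) * m r s = (∑ r : T, m r s * y r) / y r₀ := by
      rw [Finset.sum_div]; exact Finset.sum_congr rfl fun r _ => by ring
    rw [this, h1, zero_div]
  · by_cases hr : r ∈ T
    · simp only [hr, dite_true, abs_div]
      exact div_le_one_of_le₀ (hmax ⟨r, hr⟩ (Finset.mem_univ _)) (abs_nonneg _)
    · simp [hr]

/-! ### Matching two families of vectors in one mode -/

section Matching

variable {E ι : Type*} [NormedAddCommGroup E] [InnerProductSpace ℝ E] [Fintype ι]

open scoped RealInnerProductSpace

/-- Robustly independent vectors near the span of `S` are at most `S.card` many. -/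
theorem RobustIndep.card_le_of_nearSpan {k : ℕ} {τ θ : ℝ} {a b : ι → E}
    (h : RobustIndep k τ a) (hτ : 0 ≤ τ) {S T : Finset ι} (hS : S.card + 1 ≤ k)
    (hnear : ∀ r ∈ T, NearSpan θ (a r) b S) (hθ : τ * (Fintype.card ι * θ) < 1) :
    T.card ≤ S.card := by
  classical
  by_contra hlt
  push Not at hlt
  obtain ⟨T', hT', hcard⟩ := Finset.exists_subset_card_eq (show S.card + 1 ≤ T.card from hlt)
  have hc : ∀ r, ∃ c : ι → ℝ, r ∈ T' → (∀ s ∉ S, c s = 0) ∧ ‖a r - ∑ s, c s • b s‖ ≤ θ := by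
    intro r
    by_cases hr : r ∈ T'
    · obtain ⟨c, hc⟩ := hnear r (hT' hr)
      exact ⟨c, fun _ => hc⟩
    · exact ⟨0, fun h => absurd h hr⟩
  choose c hc using hc
  -- A kernel vector of the coefficient matrix cancels the `b` parts. What is left is a combination
  -- of the `a r` of norm at most `R * θ` with a coefficient 1, too small for robust independence.
  obtain ⟨z, hz, hker, ⟨r₀, hr₀, hzr₀⟩, hz1⟩ :=
    exists_normalized_kernel T' S (by omega) c
  have hθ0 : 0 ≤ θ := (norm_nonneg _).trans (hc r₀ hr₀).2
  have hsum : ∑ r, z r • a r = ∑ r, z r • (a r - ∑ s, c r s • b s) := by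
    have : ∑ r, z r • ∑ s, c r s • b s = 0 := by
      simp_rw [Finset.smul_sum, smul_smul]
      rw [Finset.sum_comm]
      refine Finset.sum_eq_zero fun s _ => ?_
      rw [← Finset.sum_smul]
      by_cases hs : s ∈ S
      · rw [hker s hs, zero_smul]
      · rw [Finset.sum_eq_zero, zero_smul]
        intro r _
        by_cases hr : r ∈ T'
        · rw [(hc r hr).1 s hs, mul_zero]
        · rw [hz r hr, zero_mul]
    simp_rw [smul_sub]
    rw [Finset.sum_sub_distrib, this, sub_zero]
  have hnorm : ‖∑ r, z r • a r‖ ≤ Fintype.card ι * θ := by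
    rw [hsum]
    refine (norm_sum_le _ _).trans ?_
    have : ∀ r ∈ Finset.univ, ‖z r • (a r - ∑ s, c r s • b s)‖ ≤ θ := by
      intro r _
      by_cases hr : r ∈ T'
      · rw [norm_smul, Real.norm_eq_abs]
        calc |z r| * ‖a r - ∑ s, c r s • b s‖ ≤ 1 * θ :=
              mul_le_mul (hz1 r) (hc r hr).2 (norm_nonneg _) zero_le_one
          _ = θ := one_mul _
      · simp [hz r hr, hθ0]
    refine (Finset.sum_le_sum this).trans ?_
    simp
  have := h T' z (by omega) hz r₀
  rw [hzr₀, abs_one] at this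
  have h2 := mul_le_mul_of_nonneg_left hnorm hτ
  linarith

/-- Bang's lemma: a vector of norm at most one that has large inner products with all of finitely
many given vectors. -/
theorem exists_large_inner (Q : Finset ι) (u : ι → E) (hu : ∀ r ∈ Q, u r ≠ 0) :
    ∃ β : ι → ℝ, ‖∑ r ∈ Q, β r • u r‖ ≤ 1 ∧
      ∀ r ∈ Q, ‖u r‖ ≤ Q.card * |⟪∑ r ∈ Q, β r • u r, u r⟫| := by
  classical
  rcases Q.eq_empty_or_nonempty with rfl | hQ
  · exact ⟨0, by simp⟩
  have hQ0 : (0 : ℝ) < Q.card := by exact_mod_cast hQ.card_pos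
  let e : ι → E := fun r => ‖u r‖⁻¹ • u r
  have he : ∀ r ∈ Q, ‖e r‖ = 1 := fun r hr => by
    have := norm_pos_iff.2 (hu r hr)
    simp [e, norm_smul, this.ne']
  let sg : Bool → ℝ := fun b => if b then 1 else -1
  have hsg : ∀ b, sg b * sg b = 1 := by intro b; cases b <;> simp [sg]
  have hsga : ∀ b, |sg b| = 1 := by intro b; cases b <;> simp [sg]
  let F : (ι → Bool) → E := fun f => ∑ r ∈ Q, sg (f r) • e r
  -- Signs that maximise the norm of the signed sum of unit vectors: flipping the sign at `r` does
  -- not increase the norm, which says that the sign times `⟪F f, e r⟫` is at least 1.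
  obtain ⟨f, hf⟩ := Finite.exists_max fun f => ‖F f‖ ^ 2
  have hlarge : ∀ r ∈ Q, 1 ≤ |⟪F f, e r⟫| := by
    intro r hr
    have hflip : F (Function.update f r (!f r)) = F f - (2 * sg (f r)) • e r := by
      simp only [F]
      rw [← Finset.add_sum_erase _ _ hr, ← Finset.add_sum_erase _ (fun r => sg (f r) • e r) hr]
      have : ∑ x ∈ Q.erase r, sg (Function.update f r (!f r) x) • e x
          = ∑ x ∈ Q.erase r, sg (f x) • e x := by
        refine Finset.sum_congr rfl fun x hx => ?_
        rw [Function.update_of_ne (Finset.ne_of_mem_erase hx)]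
      rw [this, Function.update_self]
      have h2 : sg (!f r) = - sg (f r) := by cases f r <;> simp [sg]
      rw [h2]
      module
    have h1 := hf (Function.update f r (!f r))
    rw [hflip, norm_sub_sq_real, norm_smul, he r hr, inner_smul_right, Real.norm_eq_abs,
      mul_one, sq_abs, mul_pow, sq (sg (f r)), hsg] at h1
    have h3 : 1 ≤ sg (f r) * ⟪F f, e r⟫ := by linarith
    calc 1 ≤ sg (f r) * ⟪F f, e r⟫ := h3
      _ ≤ |sg (f r) * ⟪F f, e r⟫| := le_abs_self _
      _ = |⟪F f, e r⟫| := by rw [abs_mul, hsga, one_mul]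
  refine ⟨fun r => (Q.card : ℝ)⁻¹ * (sg (f r) * ‖u r‖⁻¹), ?_, ?_⟩
  all_goals
    have hx : ∑ r ∈ Q, ((Q.card : ℝ)⁻¹ * (sg (f r) * ‖u r‖⁻¹)) • u r = (Q.card : ℝ)⁻¹ • F f := by
      simp [F, e, Finset.smul_sum, smul_smul]
  · rw [hx, norm_smul, Real.norm_of_nonneg (by positivity), inv_mul_le_iff₀ hQ0, mul_one]
    refine (norm_sum_le _ _).trans ?_
    rw [Finset.sum_congr rfl fun r hr => by
      rw [norm_smul, he r hr, Real.norm_eq_abs, hsga, one_mul]]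
    simp
  · intro r hr
    have hpos := norm_pos_iff.2 (hu r hr)
    rw [hx, inner_smul_left, abs_mul]
    have h1 := hlarge r hr
    simp only [e, inner_smul_right, abs_mul, abs_inv, abs_norm] at h1
    rw [le_inv_mul_iff₀ hpos, mul_one] at h1
    simp only [RCLike.conj_to_real, abs_inv, Nat.abs_cast]
    rw [← mul_assoc, mul_inv_cancel₀ hQ0.ne', one_mul]
    exact h1

/-- The hypothesis on a pair of families that drives the matching: a vector almost orthogonal to
`k - 1` or `k` of the `b s` is almost orthogonal to at least as many of the `a r`. -/
def OrthogonalityTransfer (k : ℕ) (K ε : ℝ) (a b : ι → E) : Prop :=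
  ∀ (x : E) (Y Q : Finset ι) (ρ : ℝ), ‖x‖ ≤ 1 → 0 ≤ ρ → k ≤ Y.card + 1 → Y.card ≤ k →
    (∀ s ∈ Y, |⟪x, b s⟫| ≤ ρ) → (∀ r ∈ Q, K * (ε + ρ) < |⟪x, a r⟫|) →
    Q.card + Y.card ≤ Fintype.card ι

/-- Bang's lemma, applied to the residuals of the `a r`, `r ∈ Q`, orthogonal to the span of `S`,
produces a single `x` that is orthogonal to that span and has a large inner product with every far
`a r`. The transfer hypothesis for this `x` bounds the number of far vectors. -/
theorem OrthogonalityTransfer.card_far_add_le {k : ℕ} {K ε ρ : ℝ} {a b : ι → E}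
    (h : OrthogonalityTransfer k K ε a b) (hK : 0 ≤ K) (hε : 0 ≤ ε) (hρ : 0 ≤ ρ)
    {S Y Q : Finset ι} (hY : k ≤ Y.card + 1) (hY' : Y.card ≤ k)
    (hnear : ∀ s ∈ Y, NearSpan ρ (b s) b S)
    (hfar : ∀ r ∈ Q, ¬ NearSpan (Fintype.card ι * (K * (ε + ρ))) (a r) b S) :
    Q.card + Y.card ≤ Fintype.card ι := by
  classical
  choose c hc horth using fun r => exists_orthogonal_residual b S (a r)
  set u : ι → E := fun r => a r - ∑ i, c r i • b i with hu
  have hθ : 0 ≤ K * (ε + ρ) := by positivity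
  have hlt : ∀ r ∈ Q, Fintype.card ι * (K * (ε + ρ)) < ‖u r‖ := fun r hr => by
    by_contra hn
    exact hfar r hr ⟨c r, hc r, not_lt.1 hn⟩
  have hu0 : ∀ r ∈ Q, u r ≠ 0 := fun r hr => by
    rw [← norm_pos_iff]
    exact lt_of_le_of_lt (by positivity) (hlt r hr)
  obtain ⟨β, hβ, hlarge⟩ := exists_large_inner Q u hu0
  set x := ∑ r ∈ Q, β r • u r with hx
  have hxb : ∀ s ∈ S, ⟪x, b s⟫ = 0 := fun s hs => by
    rw [hx, sum_inner]
    exact Finset.sum_eq_zero fun r _ => by rw [inner_smul_left, horth r s hs, mul_zero]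
  have hxsum : ∀ c' : ι → ℝ, (∀ s ∉ S, c' s = 0) → ⟪x, ∑ s, c' s • b s⟫ = 0 := by
    intro c' hc'
    rw [inner_sum]
    refine Finset.sum_eq_zero fun s _ => ?_
    rw [inner_smul_right]
    by_cases hs : s ∈ S
    · rw [hxb s hs, mul_zero]
    · rw [hc' s hs, zero_mul]
  refine h x Y Q ρ hβ hρ hY hY' (fun s hs => ?_) fun r hr => ?_
  · obtain ⟨c', hc', hn⟩ := hnear s hs
    have : ⟪x, b s⟫ = ⟪x, b s - ∑ i, c' i • b i⟫ := by
      rw [inner_sub_right, hxsum c' hc', sub_zero]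
    rw [this]
    calc _ ≤ ‖x‖ * ‖b s - ∑ i, c' i • b i‖ := abs_real_inner_le_norm _ _
      _ ≤ 1 * ρ := mul_le_mul hβ hn (norm_nonneg _) zero_le_one
      _ = ρ := one_mul _
  · have hux : ⟪x, a r⟫ = ⟪x, u r⟫ := by
      simp only [hu]
      rw [inner_sub_right, hxsum _ (hc r), sub_zero]
    rw [hux]
    have h1 := hlt r hr
    have h2 := hlarge r hr
    have hQ : (0 : ℝ) < Q.card := by exact_mod_cast Finset.card_pos.2 ⟨r, hr⟩
    have hle : (Q.card : ℝ) ≤ Fintype.card ι := by exact_mod_cast Finset.card_le_univ Q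
    have h3 : (Q.card : ℝ) * (K * (ε + ρ)) < Q.card * |⟪x, u r⟫| :=
      lt_of_le_of_lt (mul_le_mul_of_nonneg_right hle hθ) (h1.trans_le h2)
    exact lt_of_mul_lt_mul_left h3 hQ.le

end Matching

section Matching

variable {E ι : Type*} [NormedAddCommGroup E] [InnerProductSpace ℝ E] [Fintype ι]

open scoped RealInnerProductSpace

theorem nearSpan_self [DecidableEq ι] {θ : ℝ} (hθ : 0 ≤ θ) (b : ι → E) {S : Finset ι} {s : ι} (hs : s ∈ S) :
    NearSpan θ (b s) b S := by
  refine ⟨Pi.single s 1, fun i hi => ?_, ?_⟩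
  · rw [Pi.single_eq_of_ne]
    rintro rfl
    exact hi hs
  · simpa [Pi.single_apply, ite_smul] using hθ

open Classical in
/-- The indices of the vectors `a r` near the span of `b s`, `s ∈ S`. -/
def nearIndices (θ : ℝ) (a b : ι → E) (S : Finset ι) : Finset ι :=
  Finset.univ.filter fun r => NearSpan θ (a r) b S

theorem mem_nearIndices {θ : ℝ} {a b : ι → E} {S : Finset ι} {r : ι} :
    r ∈ nearIndices θ a b S ↔ NearSpan θ (a r) b S := by
  simp [nearIndices]

variable [DecidableEq ι]

theorem OrthogonalityTransfer.card_le_nearIndices {k : ℕ} {K ε ρ : ℝ} {a b : ι → E}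
    (h : OrthogonalityTransfer k K ε a b) (hK : 0 ≤ K) (hε : 0 ≤ ε) (hρ : 0 ≤ ρ)
    {S Y : Finset ι} (hY : k ≤ Y.card + 1) (hY' : Y.card ≤ k)
    (hnear : ∀ s ∈ Y, NearSpan ρ (b s) b S) :
    Y.card ≤ (nearIndices (Fintype.card ι * (K * (ε + ρ))) a b S).card := by
  have := h.card_far_add_le hK hε hρ hY hY' hnear
    (Q := (nearIndices (Fintype.card ι * (K * (ε + ρ))) a b S)ᶜ) (fun r hr => by
      rwa [Finset.mem_compl, mem_nearIndices] at hr)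
  rw [Finset.card_compl] at this
  have h2 := Finset.card_le_univ (nearIndices (Fintype.card ι * (K * (ε + ρ))) a b S)
  omega

/-- If `b c` were near the span of `k - 1` others, then `k` of the `b s` and hence `k` of the `a r`
would lie near that span, which robust independence of `a` forbids. Thus nothing about the
independence of `b` has to be assumed. -/
theorem OrthogonalityTransfer.robustIndep {k : ℕ} {K ε τ ρ : ℝ} {a b : ι → E}
    (h : OrthogonalityTransfer k K ε a b) (ha : RobustIndep k τ a) (hτ : 0 ≤ τ)
    (hK : 0 ≤ K) (hε : 0 ≤ ε) (hρ : 0 < ρ) (hkR : k ≤ Fintype.card ι)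
    (hsmall : τ * (Fintype.card ι * (Fintype.card ι * (K * (ε + ρ)))) < 1) :
    RobustIndep k ρ⁻¹ b := by
  have hfar : ∀ (S : Finset ι) (c : ι), S.card + 1 = k → c ∉ S → ¬ NearSpan ρ (b c) b S := by
    intro S c hS hc hn
    have hcard : (insert c S).card = k := by rw [Finset.card_insert_of_notMem hc, hS]
    have h1 := h.card_le_nearIndices hK hε hρ.le (S := S) (Y := insert c S) (by omega) hcard.le
      (fun s hs => by
        rcases Finset.mem_insert.1 hs with rfl | hs
        · exact hn
        · exact nearSpan_self hρ.le b hs)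
    have h2 := ha.card_le_of_nearSpan hτ hS.le (b := b)
      (T := nearIndices (Fintype.card ι * (K * (ε + ρ))) a b S)
      (fun r hr => mem_nearIndices.1 hr) hsmall
    omega
  intro V β hV hβ c
  by_contra hlt
  push Not at hlt
  have hβc : β c ≠ 0 := by
    intro h0
    rw [h0, abs_zero] at hlt
    exact absurd hlt (not_lt.2 (by positivity))
  have hcV : c ∈ V := by
    by_contra hc
    exact hβc (hβ c hc)
  obtain ⟨S, hVS, hSc, hScard⟩ := Finset.exists_subsuperset_card_eq
    (s := V.erase c) (t := Finset.univ.erase c) (n := k - 1)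
    (Finset.erase_subset_erase _ (Finset.subset_univ _))
    (by rw [Finset.card_erase_of_mem hcV]; omega)
    (by rw [Finset.card_erase_of_mem (Finset.mem_univ _), Finset.card_univ]; omega)
  have hVpos : 0 < V.card := Finset.card_pos.2 ⟨c, hcV⟩
  refine hfar S c (by omega) (fun hcS => by simpa using hSc hcS) ?_
  -- The violating combination solved for `b c`.
  refine ⟨fun i => if i = c then 0 else -(β i / β c), fun s hs => ?_, ?_⟩
  · by_cases hsc : s = c
    · simp [hsc]
    · have : β s = 0 := hβ s fun hsV => hs (hVS (Finset.mem_erase.2 ⟨hsc, hsV⟩))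
      simp [hsc, this]
  · have : b c - ∑ s, (if s = c then 0 else -(β s / β c)) • b s = (β c)⁻¹ • ∑ s, β s • b s := by
      rw [Finset.smul_sum, ← Finset.add_sum_erase _ _ (Finset.mem_univ c),
        ← Finset.add_sum_erase _ (fun i => (β c)⁻¹ • β i • b i) (Finset.mem_univ c)]
      rw [smul_smul, inv_mul_cancel₀ hβc]
      simp only [if_true, zero_smul, zero_add, one_smul, sub_eq_add_neg]
      rw [← Finset.sum_neg_distrib]
      congr 1
      refine Finset.sum_congr rfl fun s hs => ?_
      rw [if_neg (Finset.ne_of_mem_erase hs), neg_smul, neg_neg, smul_smul, div_eq_inv_mul]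
    rw [this, norm_smul, norm_inv, Real.norm_eq_abs, inv_mul_le_iff₀ (abs_pos.2 hβc)]
    rw [inv_mul_lt_iff₀ hρ] at hlt
    linarith

/-- The difference of the two approximations of `v` is a short combination of at most `k` of the `b
s`, and its coefficient at `c` is `α c` because the second approximation does not involve `c`. -/
theorem RobustIndep.abs_coeff_le {k : ℕ} {σ θ : ℝ} {b : ι → E} (hb : RobustIndep k σ b)
    (hσ : 0 ≤ σ) {v : E} {V W : Finset ι} (hVW : (V ∪ W).card ≤ k) {α : ι → ℝ}
    (hα : ∀ s ∉ V, α s = 0) (hv : ‖v - ∑ s, α s • b s‖ ≤ θ) (hW : NearSpan θ v b W)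
    {c : ι} (hc : c ∉ W) : |α c| ≤ σ * (2 * θ) := by
  obtain ⟨β, hβ, hvβ⟩ := hW
  have := hb (V ∪ W) (fun i => α i - β i) hVW (fun i hi => by
    rw [Finset.mem_union, not_or] at hi
    rw [hα i hi.1, hβ i hi.2, sub_zero]) c
  simp only [hβ c hc, sub_zero] at this
  refine this.trans (mul_le_mul_of_nonneg_left ?_ hσ)
  have h1 : ∑ i, (α i - β i) • b i = (v - ∑ s, β s • b s) - (v - ∑ s, α s • b s) := by
    simp_rw [sub_smul]
    rw [Finset.sum_sub_distrib]; abel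
  rw [h1]
  refine (norm_sub_le _ _).trans ?_
  linarith

/-- An approximate form of "the intersection of two coordinate spans is the span of the
intersection": the term at `c` has a small coefficient and can be dropped, at the price of a factor
`1 + 2 * σ * B` in the distance. -/
theorem RobustIndep.nearSpan_erase {k : ℕ} {σ θ B : ℝ} {b : ι → E} (hb : RobustIndep k σ b)
    (hσ : 0 ≤ σ) (hB : ∀ s, ‖b s‖ ≤ B) {v : E} {V W : Finset ι} (hVW : (V ∪ W).card ≤ k)
    (hV : NearSpan θ v b V) (hW : NearSpan θ v b W) {c : ι} (hc : c ∉ W) :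
    NearSpan (θ + σ * (2 * θ) * B) v b (V.erase c) := by
  obtain ⟨α, hα, hv⟩ := hV
  have h1 := hb.abs_coeff_le hσ hVW hα hv hW hc
  have hθ : 0 ≤ θ := (norm_nonneg _).trans hv
  refine ⟨fun i => if i = c then 0 else α i, fun s hs => ?_, ?_⟩
  · by_cases hsc : s = c
    · simp [hsc]
    · simp only [hsc, if_false]
      exact hα s fun h => hs (Finset.mem_erase.2 ⟨hsc, h⟩)
  · have : v - ∑ s, (if s = c then 0 else α s) • b s = (v - ∑ s, α s • b s) + α c • b c := by
      rw [← Finset.add_sum_erase _ _ (Finset.mem_univ c),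
        ← Finset.add_sum_erase _ (fun i => α i • b i) (Finset.mem_univ c)]
      rw [Finset.sum_congr rfl fun s hs => by rw [if_neg (Finset.ne_of_mem_erase hs)]]
      simp only [if_true, zero_smul, zero_add]
      abel
    rw [this]
    refine (norm_add_le _ _).trans (add_le_add hv ?_)
    rw [norm_smul, Real.norm_eq_abs]
    exact mul_le_mul h1 (hB c) (norm_nonneg _) (by positivity)

/-- The transfer gives at least this many near vectors, robust independence of `a` at most. -/
theorem OrthogonalityTransfer.card_nearIndices_eq {k : ℕ} {K ε τ θ : ℝ} {a b : ι → E}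
    (h : OrthogonalityTransfer k K ε a b) (ha : RobustIndep k τ a) (hτ : 0 ≤ τ)
    (hK : 0 ≤ K) (hε : 0 ≤ ε) (hθ : Fintype.card ι * (K * ε) ≤ θ)
    (hsmall : τ * (Fintype.card ι * θ) < 1) {S : Finset ι} (hS : S.card + 1 = k) :
    (nearIndices θ a b S).card = S.card := by
  refine le_antisymm (ha.card_le_of_nearSpan hτ hS.le (fun r hr => mem_nearIndices.1 hr) hsmall) ?_
  have h1 := h.card_le_nearIndices hK hε le_rfl (S := S) (Y := S) hS.ge (by omega)
    (fun s hs => nearSpan_self le_rfl b hs)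
  rw [add_zero] at h1
  refine h1.trans (Finset.card_le_card fun r hr => ?_)
  rw [mem_nearIndices] at hr ⊢
  exact hr.mono hθ le_rfl

/-- The span of `k - 2` of the `b s` contains, approximately, `k - 2` of the `a r`. -/
theorem OrthogonalityTransfer.card_nearIndices_eq' {k : ℕ} {K ε τ θ σ B : ℝ} {a b : ι → E}
    (h : OrthogonalityTransfer k K ε a b) (ha : RobustIndep k τ a) (hτ : 0 ≤ τ)
    (hb : RobustIndep k σ b) (hσ : 0 ≤ σ) (hB : ∀ s, ‖b s‖ ≤ B) (hB0 : 0 ≤ B)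
    (hK : 0 ≤ K) (hε : 0 ≤ ε) (hkR : k ≤ Fintype.card ι) (hθ : Fintype.card ι * (K * ε) = θ)
    (hsmall : τ * (Fintype.card ι * (θ + σ * (2 * θ) * B)) < 1) {U : Finset ι}
    (hU : U.card + 2 = k) :
    (nearIndices (θ + σ * (2 * θ) * B) a b U).card = U.card := by
  set Z := nearIndices (θ + σ * (2 * θ) * B) a b U with hZ
  have hθ0 : 0 ≤ θ := by rw [← hθ]; positivity
  have hextra : 0 ≤ σ * (2 * θ) * B := by positivity
  have hle : Z.card ≤ U.card :=
    ha.card_le_of_nearSpan hτ (by omega) (fun r hr => mem_nearIndices.1 hr) hsmall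
  have hsmall' : τ * (Fintype.card ι * θ) < 1 := by
    refine lt_of_le_of_lt (mul_le_mul_of_nonneg_left (mul_le_mul_of_nonneg_left ?_ ?_) hτ) hsmall
    · linarith
    · positivity
  set T : ι → Finset ι := fun c => nearIndices θ a b (insert c U) with hT
  have hTcard : ∀ c ∈ Uᶜ, (T c).card = U.card + 1 := fun c hc => by
    have hcU := Finset.mem_compl.1 hc
    have h1 : (insert c U).card = U.card + 1 := Finset.card_insert_of_notMem hcU
    rw [hT, ← h1]
    exact h.card_nearIndices_eq ha hτ hK hε hθ.le hsmall' (by omega)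
  -- A vector near the spans of two different extensions of `U` by one index is near the span of `U`
  -- itself, hence already belongs to `Z`.
  have hdisj : (↑(Uᶜ) : Set ι).PairwiseDisjoint fun c => T c \ Z := by
    intro c hc c' hc' hne
    rw [Finset.mem_coe, Finset.mem_compl] at hc hc'
    rw [Function.onFun, Finset.disjoint_left]
    intro r hr hr'
    rw [Finset.mem_sdiff] at hr hr'
    refine hr.2 (mem_nearIndices.2 ?_)
    have := hb.nearSpan_erase hσ hB (V := insert c U) (W := insert c' U) ?_
      (mem_nearIndices.1 hr.1) (mem_nearIndices.1 hr'.1) (c := c) ?_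
    · rwa [Finset.erase_insert hc] at this
    · have : insert c U ∪ insert c' U = insert c (insert c' U) := by
        ext i; simp only [Finset.mem_union, Finset.mem_insert]; tauto
      rw [this, Finset.card_insert_of_notMem (by simp [hne, hc]),
        Finset.card_insert_of_notMem hc']
      omega
    · simp [hne, hc]
  have hunion : (Uᶜ.biUnion fun c => T c \ Z) ⊆ Zᶜ := by
    intro r hr
    obtain ⟨c, -, hc⟩ := Finset.mem_biUnion.1 hr
    exact Finset.mem_compl.2 (Finset.mem_sdiff.1 hc).2
  have hcount := Finset.card_le_card hunion
  rw [Finset.card_biUnion hdisj, Finset.card_compl] at hcount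
  have hlow : ∀ c ∈ Uᶜ, U.card + 1 - Z.card ≤ (T c \ Z).card := fun c hc => by
    have := Finset.le_card_sdiff Z (T c)
    rwa [hTcard c hc] at this
  have hsum := Finset.sum_le_sum hlow
  rw [Finset.sum_const, Finset.card_compl, smul_eq_mul] at hsum
  obtain ⟨y, hy⟩ := Nat.exists_eq_add_of_le hle
  obtain ⟨m, hm⟩ := Nat.exists_eq_add_of_le hkR
  have e1 : Fintype.card ι - U.card = m + 2 := by omega
  have e2 : U.card + 1 - Z.card = y + 1 := by omega
  have e3 : Fintype.card ι - Z.card = m + 2 + y := by omega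
  rw [e1, e2] at hsum
  rw [e3] at hcount
  -- Here `m = R - k` and `y = U.card - Z.card`. The complement of `Z`, of size `m + 2 + y`,
  -- contains `m + 2` disjoint sets of size at least `y + 1`, so `y = 0`.
  have : (m + 2) * (y + 1) ≤ m + 2 + y := hsum.trans hcount
  have hy0 : y = 0 := by nlinarith
  omega

/-- Every `b s` is, up to a scalar, close to some `a r`. -/
theorem OrthogonalityTransfer.exists_parallel {k : ℕ} {K ε τ θ θ' σ B : ℝ} {a b : ι → E}
    (h : OrthogonalityTransfer k K ε a b) (ha : RobustIndep k τ a) (hτ : 0 ≤ τ)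
    (hb : RobustIndep k σ b) (hσ : 0 ≤ σ) (hB : ∀ s, ‖b s‖ ≤ B) (hB0 : 0 ≤ B)
    (hK : 0 ≤ K) (hε : 0 ≤ ε) (hk : 2 ≤ k) (hkR : k ≤ Fintype.card ι)
    (hθ : Fintype.card ι * (K * ε) = θ) (hθ' : θ + σ * (2 * θ) * B = θ')
    (hsmall : τ * (Fintype.card ι * (θ' + σ * (2 * θ') * B)) < 1) (s : ι) :
    ∃ (r : ι) (α : ℝ), ‖a r - α • b s‖ ≤ θ' + Fintype.card ι * (σ * (2 * θ') * B) := by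
  have hθ0 : 0 ≤ θ := by rw [← hθ]; positivity
  have hextra : 0 ≤ σ * (2 * θ) * B := by positivity
  have hθ'0 : 0 ≤ θ' := by rw [← hθ']; positivity
  have hextra' : 0 ≤ σ * (2 * θ') * B := by positivity
  have hsmall' : τ * (Fintype.card ι * θ') < 1 := by
    refine lt_of_le_of_lt (mul_le_mul_of_nonneg_left (mul_le_mul_of_nonneg_left ?_ ?_) hτ) hsmall
    · linarith
    · positivity
  obtain ⟨S, hsS, -, hScard⟩ := Finset.exists_subsuperset_card_eq
    (s := {s}) (t := Finset.univ) (n := k - 1) (Finset.subset_univ _)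
    (by rw [Finset.card_singleton]; omega) (by rw [Finset.card_univ]; omega)
  rw [Finset.singleton_subset_iff] at hsS
  set T := nearIndices θ' a b S with hT
  have hTcard : T.card = S.card :=
    h.card_nearIndices_eq ha hτ hK hε (by rw [hθ]; linarith) hsmall' (by omega)
  set Z : ι → Finset ι := fun c => nearIndices θ' a b (S.erase c) with hZ
  have hZcard : ∀ c ∈ S, (Z c).card + 1 = S.card := fun c hc => by
    have h1 : (S.erase c).card + 1 = S.card := Finset.card_erase_add_one hc
    rw [← h1, hZ]
    congr 1
    rw [← hθ']
    exact h.card_nearIndices_eq' ha hτ hb hσ hB hB0 hK hε hkR hθ (by rw [hθ']; exact hsmall')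
      (by omega)
  have hZT : ∀ c, Z c ⊆ T := fun c r hr =>
    mem_nearIndices.2 ((mem_nearIndices.1 hr).mono le_rfl (Finset.erase_subset _ _))
  -- Deleting `c` from `S` loses exactly one of the near vectors; `φ c` is the one that is lost.
  have hex : ∀ c, ∃ r, c ∈ S → T \ Z c = {r} := fun c => by
    by_cases hc : c ∈ S
    · have : (T \ Z c).card = 1 := by
        rw [Finset.card_sdiff_of_subset (hZT c), hTcard]
        have := hZcard c hc
        omega
      obtain ⟨r, hr⟩ := Finset.card_eq_one.1 this
      exact ⟨r, fun _ => hr⟩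
    · exact ⟨c, fun h => absurd h hc⟩
  choose φ hφ using hex
  -- If `φ c = φ c'`, then `Z c = Z c'`, and all `k - 2` vectors of this set lie near the span of
  -- the `k - 3` vectors that remain when both `c` and `c'` are deleted.
  have hinj : ∀ c ∈ S, ∀ c' ∈ S, c ≠ c' → φ c ≠ φ c' := by
    intro c hc c' hc' hne heq
    have hZZ : Z c = Z c' := by
      have h1 := hφ c hc
      rw [heq, ← hφ c' hc'] at h1
      have h2 : ∀ c, Z c = T \ (T \ Z c) := fun c => by
        rw [Finset.sdiff_sdiff_eq_self (hZT c)]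
      rw [h2 c, h1, ← h2 c']
    have hnear : ∀ r ∈ Z c, NearSpan (θ' + σ * (2 * θ') * B) (a r) b ((S.erase c).erase c') := by
      intro r hr
      refine hb.nearSpan_erase hσ hB (W := S.erase c') ?_ (mem_nearIndices.1 hr)
        (mem_nearIndices.1 (show r ∈ Z c' from hZZ ▸ hr)) (Finset.notMem_erase _ _)
      have : S.erase c ∪ S.erase c' ⊆ S :=
        Finset.union_subset (Finset.erase_subset _ _) (Finset.erase_subset _ _)
      have := Finset.card_le_card this
      omega
    have hc'' : c' ∈ S.erase c := Finset.mem_erase.2 ⟨hne.symm, hc'⟩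
    have e1 := Finset.card_erase_add_one hc
    have e2 := Finset.card_erase_add_one hc''
    have h1 := ha.card_le_of_nearSpan hτ (by omega) hnear hsmall
    have h2 := hZcard c hc
    omega
  have hr0T : φ s ∈ T := by
    have : φ s ∈ T \ Z s := by rw [hφ s hsS]; exact Finset.mem_singleton_self _
    exact (Finset.mem_sdiff.1 this).1
  obtain ⟨α, hα, hv⟩ := mem_nearIndices.1 hr0T
  -- For `c ≠ s` the vector `a (φ s)` survives the deletion of `c`, so its coefficient at `c` is
  -- small and only the one at `s` remains.
  have hcoef : ∀ c ∈ S, c ≠ s → |α c| ≤ σ * (2 * θ') := by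
    intro c hc hcs
    have hmem : φ s ∈ Z c := by
      by_contra hn
      have : φ s ∈ T \ Z c := Finset.mem_sdiff.2 ⟨hr0T, hn⟩
      rw [hφ c hc, Finset.mem_singleton] at this
      exact hinj c hc s hsS hcs this.symm
    refine hb.abs_coeff_le hσ (V := S) (W := S.erase c) ?_ hα hv (mem_nearIndices.1 hmem)
      (Finset.notMem_erase _ _)
    rw [Finset.union_eq_left.2 (Finset.erase_subset _ _)]
    omega
  refine ⟨φ s, α s, ?_⟩
  have hdecomp : a (φ s) - α s • b s
      = (a (φ s) - ∑ i, α i • b i) + ∑ i ∈ Finset.univ.erase s, α i • b i := by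
    rw [← Finset.add_sum_erase _ (fun i => α i • b i) (Finset.mem_univ s)]
    abel
  rw [hdecomp]
  refine (norm_add_le _ _).trans (add_le_add hv ?_)
  refine (norm_sum_le _ _).trans ?_
  have hterm : ∀ i ∈ Finset.univ.erase s, ‖α i • b i‖ ≤ σ * (2 * θ') * B := by
    intro i hi
    rw [norm_smul, Real.norm_eq_abs]
    by_cases hiS : i ∈ S
    · exact mul_le_mul (hcoef i hiS (Finset.ne_of_mem_erase hi)) (hB i) (norm_nonneg _)
        (by positivity)
    · rw [hα i hiS, abs_zero, zero_mul]; exact hextra'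
  refine (Finset.sum_le_sum hterm).trans ?_
  rw [Finset.sum_const, nsmul_eq_mul]
  refine mul_le_mul_of_nonneg_right ?_ hextra'
  exact_mod_cast Finset.card_le_univ _

end Matching

/-! ### Robust uniqueness of tensor decompositions -/

theorem abs_prod_sub_prod_le {μ : Type*} (s : Finset μ) (y z : μ → ℝ) {M ζ : ℝ} (hM : 1 ≤ M)
    (hζ : 0 ≤ ζ) (hy : ∀ j ∈ s, |y j| ≤ M) (hz : ∀ j ∈ s, |z j| ≤ M)
    (hyz : ∀ j ∈ s, |y j - z j| ≤ ζ) :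
    |∏ j ∈ s, y j - ∏ j ∈ s, z j| ≤ s.card * ζ * M ^ s.card := by
  classical
  induction s using Finset.induction_on with
  | empty => simp
  | insert i s hi ih =>
    have ih' := ih (fun j hj => hy j (Finset.mem_insert_of_mem hj))
      (fun j hj => hz j (Finset.mem_insert_of_mem hj))
      (fun j hj => hyz j (Finset.mem_insert_of_mem hj))
    rw [Finset.prod_insert hi, Finset.prod_insert hi, Finset.card_insert_of_notMem hi]
    have e : y i * ∏ j ∈ s, y j - z i * ∏ j ∈ s, z j
        = y i * (∏ j ∈ s, y j - ∏ j ∈ s, z j) + (y i - z i) * ∏ j ∈ s, z j := by ring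
    have hzp : |∏ j ∈ s, z j| ≤ M ^ s.card := by
      rw [Finset.abs_prod]
      refine (Finset.prod_le_prod (fun _ _ => abs_nonneg _)
        fun j hj => hz j (Finset.mem_insert_of_mem hj)).trans ?_
      simp
    rw [e]
    refine (abs_add_le _ _).trans ?_
    rw [abs_mul, abs_mul]
    have h1 : |y i| * |∏ j ∈ s, y j - ∏ j ∈ s, z j| ≤ M * (s.card * ζ * M ^ s.card) :=
      mul_le_mul (hy i (Finset.mem_insert_self _ _)) ih' (abs_nonneg _) (by linarith)
    have h2 : |y i - z i| * |∏ j ∈ s, z j| ≤ ζ * (M ^ s.card * M) :=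
      mul_le_mul (hyz i (Finset.mem_insert_self _ _))
        (hzp.trans (le_mul_of_one_le_right (by positivity) hM)) (abs_nonneg _) hζ
    push_cast
    rw [pow_succ]
    linarith

/-! ### Contracting two close tensors: transfer of orthogonality and a common permutation -/

section Kruskal

variable {E ι μ : Type*} [NormedAddCommGroup E] [InnerProductSpace ℝ E]
  [Fintype ι] [DecidableEq ι]

open scoped RealInnerProductSpace

/-- The tensors `∑ w r ⊗ⱼ a j r` and `∑ v s ⊗ⱼ b j s` are `ε`-close as multilinear forms. -/
def TensorClose [Fintype μ] (ε : ℝ) (w v : ι → ℝ) (a b : μ → ι → E) : Prop :=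
  ∀ x : μ → E, |∑ r, w r * ∏ j, ⟪x j, a j r⟫ - ∑ s, v s * ∏ j, ⟪x j, b j s⟫| ≤ ε * ∏ j, ‖x j‖

/-- In one mode a dual vector for `r` can annihilate `k - 1` other factors. The elements of `W` are
distributed over the modes of `J` by an injection into `J × Fin (k - 1)`, and each is annihilated in
the mode assigned to it. -/
theorem exists_dual_product [DecidableEq μ] {k : ℕ} {τ : ℝ} {a : μ → ι → E} (ha : ∀ j, RobustIndep k τ (a j))
    (hk : 1 ≤ k) (J : Finset μ) {W : Finset ι} (hW : W.card ≤ J.card * (k - 1)) {r : ι}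
    (hr : r ∉ W) :
    ∃ x : μ → E, (∀ j ∈ J, ‖x j‖ ≤ τ) ∧ ∏ j ∈ J, ⟪x j, a j r⟫ = 1 ∧
      ∀ q ∈ W, ∏ j ∈ J, ⟪x j, a j q⟫ = 0 := by
  obtain ⟨e⟩ : Nonempty (W ↪ J × Fin (k - 1)) :=
    Function.Embedding.nonempty_of_card_le (by simpa using hW)
  let V : μ → Finset ι := fun j => (W.attach.filter fun q => ((e q).1 : μ) = j).image Subtype.val
  have hVW : ∀ j, V j ⊆ W := fun j q hq => by
    simp only [V, Finset.mem_image, Finset.mem_filter] at hq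
    obtain ⟨q', -, rfl⟩ := hq
    exact q'.2
  have hVcard : ∀ j, (V j).card ≤ k - 1 := fun j => by
    refine Finset.card_image_le.trans ?_
    have := Finset.card_le_card_of_injOn (s := W.attach.filter fun q => ((e q).1 : μ) = j)
      (t := (Finset.univ : Finset (Fin (k - 1)))) (fun q => (e q).2)
      (fun _ _ => Finset.mem_coe.2 (Finset.mem_univ _))
      (fun q hq q' hq' h => by
        simp only [Finset.coe_filter, Set.mem_ofPred_eq] at hq hq'
        apply e.injective
        exact Prod.ext (Subtype.ext (hq.2.trans hq'.2.symm)) h)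
    simpa using this
  have hx : ∀ j, ∃ x : E, ‖x‖ ≤ τ ∧ ⟪x, a j r⟫ = 1 ∧ ∀ s ∈ V j, ⟪x, a j s⟫ = 0 := fun j =>
    (ha j).exists_dual (by have := hVcard j; omega) fun h => hr (hVW j h)
  choose x hx1 hx2 hx3 using hx
  refine ⟨x, fun j _ => hx1 j, Finset.prod_eq_one fun j _ => hx2 j, fun q hq => ?_⟩
  refine Finset.prod_eq_zero (e ⟨q, hq⟩).1.2 (hx3 _ q ?_)
  simp only [V, Finset.mem_image, Finset.mem_filter, Finset.mem_attach, true_and]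
  exact ⟨⟨q, hq⟩, rfl, rfl⟩

theorem abs_prod_inner_le {τ B : ℝ} (J : Finset μ) {x c : μ → E}
    (hx : ∀ j ∈ J, ‖x j‖ ≤ τ) (hc : ∀ j ∈ J, ‖c j‖ ≤ B) (hτ : 0 ≤ τ) :
    |∏ j ∈ J, ⟪x j, c j⟫| ≤ (τ * B) ^ J.card := by
  rw [Finset.abs_prod]
  refine (Finset.prod_le_prod (fun _ _ => abs_nonneg _) fun j hj =>
    (abs_real_inner_le_norm _ _).trans
      (mul_le_mul (hx j hj) (hc j hj) (norm_nonneg _) hτ)).trans ?_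
  simp

variable [Fintype μ] [DecidableEq μ]

/-- Suppose too many `a j₀ r`, `r ∈ Q`, have a large inner product with `x₀`. Put `x₀` in mode `j₀`,
dual product functionals on the other modes, and combine them linearly. On the first tensor the
result is `w r₀ * ⟪x₀, a j₀ r₀⟫` for one `r₀ ∈ Q`. On the second tensor the linear combination kills
the terms outside `Y`, and those in `Y` carry a factor at most `ρ`. Closeness of the tensors makes
`⟪x₀, a j₀ r₀⟫` small, a contradiction. -/
theorem TensorClose.orthogonalityTransfer {k : ℕ} {τ γ B ε : ℝ} {w v : ι → ℝ} {a b : μ → ι → E}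
    (h : TensorClose ε w v a b) (ha : ∀ j, RobustIndep k τ (a j)) (hk : 2 ≤ k)
    (hkR : k ≤ Fintype.card ι) (hkl : 2 * Fintype.card ι ≤ Fintype.card μ * (k - 1))
    (hτ : 1 ≤ τ) (hB1 : 1 ≤ B) (hγ : 0 < γ) (hε : 0 ≤ ε) (hw : ∀ r, γ ≤ w r)
    (hv : ∀ s, |v s| ≤ 1) (hB : ∀ j s, ‖b j s‖ ≤ B) (j₀ : μ) :
    OrthogonalityTransfer k ((Fintype.card ι : ℝ) ^ 2 * (τ * B) ^ Fintype.card μ / γ) ε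
      (a j₀) (b j₀) := by
  intro x₀ Y Q₀ ρ hx₀ hρ hY hY' hYb hQa
  by_contra hcon
  push Not at hcon
  set R := Fintype.card ι with hR
  set ℓ := Fintype.card μ with hℓ
  set D := τ * B with hD
  have hD1 : 1 ≤ D := one_le_mul_of_one_le_of_one_le hτ hB1
  have hτ0 : 0 ≤ τ := by linarith
  have hYR : Y.card ≤ R := Finset.card_le_univ _
  -- Just one more element than the complement of `Y`: enough for a kernel vector, and few enough
  -- for the dual functionals on either half of the modes.
  obtain ⟨Q, hQQ, hQcard⟩ := Finset.exists_subset_card_eq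
    (show R - Y.card + 1 ≤ Q₀.card by omega)
  have hQR : Q.card ≤ R := Finset.card_le_univ _
  -- the modes other than `j₀` are split into two halves
  have hℓ0 : 0 < ℓ := Fintype.card_pos_iff.2 ⟨j₀⟩
  have herase : (Finset.univ.erase j₀ : Finset μ).card = ℓ - 1 := by
    rw [Finset.card_erase_of_mem (Finset.mem_univ _), Finset.card_univ]
  obtain ⟨J, hJsub, hJcard⟩ := Finset.exists_subset_card_eq
    (show (ℓ - 1) / 2 ≤ (Finset.univ.erase j₀ : Finset μ).card by rw [herase]; omega)
  set J' := (Finset.univ.erase j₀) \ J with hJ'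
  have hJ'card : J'.card = ℓ - 1 - (ℓ - 1) / 2 := by
    rw [hJ', Finset.card_sdiff_of_subset hJsub, herase, hJcard]
  have hprod : ∀ f : μ → ℝ, ∏ j, f j = f j₀ * ((∏ j ∈ J, f j) * ∏ j ∈ J', f j) := by
    intro f
    rw [← Finset.mul_prod_erase _ _ (Finset.mem_univ j₀), ← Finset.prod_sdiff hJsub]
    ring
  obtain ⟨m, hm⟩ : ∃ m, k = m + 1 := ⟨k - 1, by omega⟩
  obtain ⟨p, p', hp, hp', hpl⟩ :
      ∃ p p', J.card = p ∧ J'.card = p' ∧ ℓ = p + p' + 1 ∧ p ≤ p' ∧ p' ≤ p + 1 :=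
    ⟨_, _, hJcard, hJ'card, by omega, by omega, by omega⟩
  obtain ⟨hpl, hpp, hpp'⟩ := hpl
  have hm1 : k - 1 = m := by omega
  have hlm : ℓ * m = p * m + p' * m + m := by rw [hpl]; ring
  have hpm : p * m ≤ p' * m := Nat.mul_le_mul_right _ hpp
  have hpm' : p' * m ≤ p * m + m := by
    calc p' * m ≤ (p + 1) * m := Nat.mul_le_mul_right _ hpp'
      _ = p * m + m := by ring
  rw [hm1] at hkl
  -- The indices outside `Q` are shared between the halves: `U` fills the capacity `p * m + 1` of
  -- `J`, and the rest `V` fits into `J'`. If the capacity is reached, `Q` and `V` have together `R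
  -- + Q.card - p * m - 1` elements, and `Q.card ≤ R - m + 1` and `2 * R ≤ ℓ * m` bound this by `p'
  -- * m`.
  obtain ⟨U, hUsub, hUcard⟩ := Finset.exists_subset_card_eq
    (show min (R - Q.card) (p * m + 1 - Q.card) ≤ (Qᶜ).card by
      rw [Finset.card_compl]; exact min_le_left _ _)
  set V := Qᶜ \ U with hV
  have hVcard : V.card = R - Q.card - U.card := by
    rw [hV, Finset.card_sdiff_of_subset hUsub, Finset.card_compl]
  have hQU : (Q ∪ U).card ≤ p * m + 1 := by
    refine (Finset.card_union_le _ _).trans ?_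
    rw [hUcard]
    have := min_le_right (R - Q.card) (p * m + 1 - Q.card)
    omega
  have hQV : (Q ∪ V).card ≤ p' * m + 1 := by
    refine (Finset.card_union_le _ _).trans ?_
    rcases min_choice (R - Q.card) (p * m + 1 - Q.card) with hmin | hmin
    · rw [hmin] at hUcard; omega
    · rw [hmin] at hUcard; omega
  have hX : ∀ r, ∃ x : μ → E, r ∈ Q → (∀ j ∈ J, ‖x j‖ ≤ τ) ∧ ∏ j ∈ J, ⟪x j, a j r⟫ = 1 ∧
      ∀ q ∈ (Q ∪ U).erase r, ∏ j ∈ J, ⟪x j, a j q⟫ = 0 := fun r => by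
    by_cases hr : r ∈ Q
    · obtain ⟨x, hx⟩ := exists_dual_product ha (by omega) J (W := (Q ∪ U).erase r) (r := r)
        (by rw [Finset.card_erase_of_mem (Finset.mem_union_left _ hr), hp, hm1]; omega)
        (Finset.notMem_erase _ _)
      exact ⟨x, fun _ => hx⟩
    · exact ⟨0, fun h => absurd h hr⟩
  have hX' : ∀ r, ∃ x : μ → E, r ∈ Q → (∀ j ∈ J', ‖x j‖ ≤ τ) ∧ ∏ j ∈ J', ⟪x j, a j r⟫ = 1 ∧
      ∀ q ∈ (Q ∪ V).erase r, ∏ j ∈ J', ⟪x j, a j q⟫ = 0 := fun r => by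
    by_cases hr : r ∈ Q
    · obtain ⟨x, hx⟩ := exists_dual_product ha (by omega) J' (W := (Q ∪ V).erase r) (r := r)
        (by rw [Finset.card_erase_of_mem (Finset.mem_union_left _ hr), hp', hm1]; omega)
        (Finset.notMem_erase _ _)
      exact ⟨x, fun _ => hx⟩
    · exact ⟨0, fun h => absurd h hr⟩
  choose X hX using hX
  choose X' hX' using hX'
  -- `z` combines the functionals on `J` so that every component of the second tensor outside `Y`
  -- vanishes. The functional on `J'` is the fixed one for `r₀`, the index with coefficient 1.
  obtain ⟨z, hz, hker, ⟨r₀, hr₀, hzr₀⟩, hz1⟩ := exists_normalized_kernel Q Yᶜ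
    (by rw [Finset.card_compl]; omega) fun r s => ∏ j ∈ J, ⟪X r j, b j s⟫
  obtain ⟨hX'n, hX'1, hX'0⟩ := hX' r₀ hr₀
  let x : ι → μ → E := fun r j => if j = j₀ then x₀ else if j ∈ J then X r j else X' r₀ j
  have hj₀J : j₀ ∉ J := fun h => by simpa using hJsub h
  have hxprod : ∀ r (c : μ → E), ∏ j, ⟪x r j, c j⟫
      = ⟪x₀, c j₀⟫ * ((∏ j ∈ J, ⟪X r j, c j⟫) * ∏ j ∈ J', ⟪X' r₀ j, c j⟫) := by
    intro r c
    rw [hprod]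
    congr 1
    · simp [x]
    · congr 1
      · refine Finset.prod_congr rfl fun j hj => ?_
        have : j ≠ j₀ := fun h => hj₀J (h ▸ hj)
        simp [x, this, hj]
      · refine Finset.prod_congr rfl fun j hj => ?_
        rw [hJ', Finset.mem_sdiff, Finset.mem_erase] at hj
        simp [x, hj.1.1, hj.2]
  have hxnorm : ∀ r ∈ Q, ∏ j, ‖x r j‖ ≤ D ^ ℓ := by
    intro r hr
    have : ∀ j ∈ Finset.univ, ‖x r j‖ ≤ D := by
      intro j _
      have hτD : τ ≤ D := le_mul_of_one_le_right hτ0 hB1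
      by_cases h0 : j = j₀
      · simp only [x, h0, if_true]; linarith
      · by_cases hj : j ∈ J
        · simp only [x, h0, hj, if_true, if_false]
          exact ((hX r hr).1 j hj).trans hτD
        · simp only [x, h0, hj, if_false]
          exact (hX'n j (by simp [hJ', h0, hj])).trans hτD
    refine (Finset.prod_le_prod (fun _ _ => norm_nonneg _) this).trans ?_
    simp [hℓ]
  have htruth : ∀ r ∈ Q, ∑ q, w q * ∏ j, ⟪x r j, a j q⟫
      = if r = r₀ then w r₀ * ⟪x₀, a j₀ r₀⟫ else 0 := by
    intro r hr
    obtain ⟨-, hX1, hX0⟩ := hX r hr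
    -- A term survives both halves only if `q` is isolated by both, that is `q = r` and `q = r₀`:
    -- every index lies in `Q`, `U` or `V`.
    have hzero : ∀ q, q ≠ r₀ ∨ r ≠ r₀ → w q * ∏ j, ⟪x r j, a j q⟫ = 0 := by
      intro q hq
      rw [hxprod r fun j => a j q]
      by_cases hqr : q ∈ (Q ∪ U).erase r
      · rw [hX0 q hqr]; ring
      by_cases hqr' : q ∈ (Q ∪ V).erase r₀
      · rw [hX'0 q hqr']; ring
      exfalso
      simp only [hV, Finset.mem_erase, Finset.mem_union, Finset.mem_sdiff, Finset.mem_compl,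
        not_and, not_or] at hqr hqr'
      by_cases h1 : q = r
      · by_cases h2 : q = r₀
        · subst h1; subst h2; simp at hq
        · exact (hqr' h2).1 (h1 ▸ hr)
      · have := hqr h1
        by_cases h2 : q = r₀
        · exact this.1 (h2 ▸ hr₀)
        · exact (hqr' h2).2 this.1 this.2
    by_cases hrr : r = r₀
    · rw [if_pos hrr, Finset.sum_eq_single r₀ (fun q _ hq => hzero q (Or.inl hq)) (by simp)]
      rw [hxprod r fun j => a j r₀, hX'1]
      subst hrr
      rw [hX1]; ring
    · rw [if_neg hrr]
      exact Finset.sum_eq_zero fun q _ => hzero q (Or.inr hrr)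
  have hA : ∑ r, z r * ∑ q, w q * ∏ j, ⟪x r j, a j q⟫ = w r₀ * ⟪x₀, a j₀ r₀⟫ := by
    rw [Finset.sum_eq_single r₀]
    · rw [htruth r₀ hr₀, if_pos rfl, hzr₀, one_mul]
    · intro r _ hr
      by_cases hrQ : r ∈ Q
      · rw [htruth r hrQ, if_neg hr, mul_zero]
      · rw [hz r hrQ, zero_mul]
    · simp
  have hBsum : |∑ r, z r * ∑ s, v s * ∏ j, ⟪x r j, b j s⟫| ≤ (R : ℝ) ^ 2 * D ^ ℓ * ρ := by
    have hexp : ∑ r, z r * ∑ s, v s * ∏ j, ⟪x r j, b j s⟫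
        = ∑ s, v s * (⟪x₀, b j₀ s⟫ * ((∏ j ∈ J', ⟪X' r₀ j, b j s⟫) *
            ∑ r, z r * ∏ j ∈ J, ⟪X r j, b j s⟫)) := by
      simp_rw [Finset.mul_sum]
      rw [Finset.sum_comm]
      refine Finset.sum_congr rfl fun s _ => Finset.sum_congr rfl fun r _ => ?_
      rw [hxprod r fun j => b j s]; ring
    rw [hexp]
    refine (Finset.abs_sum_le_sum_abs _ _).trans ?_
    have hterm : ∀ s ∈ Finset.univ, |v s * (⟪x₀, b j₀ s⟫ * ((∏ j ∈ J', ⟪X' r₀ j, b j s⟫) *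
            ∑ r, z r * ∏ j ∈ J, ⟪X r j, b j s⟫))| ≤ ρ * (D ^ ℓ * R) := by
      intro s _
      by_cases hs : s ∈ Y
      · have h1 : |∏ j ∈ J', ⟪X' r₀ j, b j s⟫| ≤ D ^ J'.card :=
          abs_prod_inner_le J' hX'n (fun j _ => hB j s) hτ0
        have h2 : |∑ r, z r * ∏ j ∈ J, ⟪X r j, b j s⟫| ≤ R * D ^ J.card := by
          refine (Finset.abs_sum_le_sum_abs _ _).trans ?_
          have : ∀ r ∈ Finset.univ, |z r * ∏ j ∈ J, ⟪X r j, b j s⟫| ≤ D ^ J.card := by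
            intro r _
            by_cases hr : r ∈ Q
            · rw [abs_mul]
              calc _ ≤ 1 * D ^ J.card := mul_le_mul (hz1 r)
                    (abs_prod_inner_le J (hX r hr).1 (fun j _ => hB j s) hτ0)
                    (abs_nonneg _) zero_le_one
                _ = _ := one_mul _
            · rw [hz r hr, zero_mul, abs_zero]; positivity
          refine (Finset.sum_le_sum this).trans ?_
          simp [hR]
        have h3 : D ^ J'.card * (R * D ^ J.card) ≤ D ^ ℓ * R := by
          have : D ^ J'.card * (R * D ^ J.card) = D ^ (J'.card + J.card) * R := by
            rw [pow_add]; ring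
          rw [this]
          refine mul_le_mul_of_nonneg_right (pow_le_pow_right₀ hD1 ?_) (by positivity)
          omega
        rw [abs_mul, abs_mul, abs_mul]
        calc _ ≤ 1 * (ρ * (D ^ J'.card * (R * D ^ J.card))) := by
              gcongr
              · exact hv s
              · exact hYb s hs
          _ ≤ ρ * (D ^ ℓ * R) := by
              rw [one_mul]; exact mul_le_mul_of_nonneg_left h3 hρ
      · rw [hker s (Finset.mem_compl.2 hs), mul_zero, mul_zero, mul_zero, abs_zero]
        positivity
    refine (Finset.sum_le_sum hterm).trans (le_of_eq ?_)
    rw [Finset.sum_const, Finset.card_univ, ← hR, nsmul_eq_mul]; ring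
  have hclose : |∑ r, z r * ∑ q, w q * ∏ j, ⟪x r j, a j q⟫
      - ∑ r, z r * ∑ s, v s * ∏ j, ⟪x r j, b j s⟫| ≤ R * (ε * D ^ ℓ) := by
    rw [← Finset.sum_sub_distrib]
    refine (Finset.abs_sum_le_sum_abs _ _).trans ?_
    have : ∀ r ∈ Finset.univ, |z r * ∑ q, w q * ∏ j, ⟪x r j, a j q⟫
        - z r * ∑ s, v s * ∏ j, ⟪x r j, b j s⟫| ≤ ε * D ^ ℓ := by
      intro r _
      rw [← mul_sub, abs_mul]
      by_cases hr : r ∈ Q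
      · calc _ ≤ 1 * (ε * ∏ j, ‖x r j‖) :=
              mul_le_mul (hz1 r) (h (x r)) (abs_nonneg _) zero_le_one
          _ ≤ _ := by rw [one_mul]; exact mul_le_mul_of_nonneg_left (hxnorm r hr) hε
      · rw [hz r hr, abs_zero, zero_mul]; positivity
    refine (Finset.sum_le_sum this).trans (le_of_eq ?_)
    rw [Finset.sum_const, Finset.card_univ, ← hR, nsmul_eq_mul]
  rw [hA] at hclose
  have hR1 : (1 : ℝ) ≤ R := by exact_mod_cast (show 1 ≤ R by omega)
  have hfinal : γ * |⟪x₀, a j₀ r₀⟫| ≤ (R : ℝ) ^ 2 * D ^ ℓ * (ε + ρ) := by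
    have h1 : γ * |⟪x₀, a j₀ r₀⟫| ≤ |w r₀ * ⟪x₀, a j₀ r₀⟫| := by
      rw [abs_mul]
      exact mul_le_mul_of_nonneg_right ((hw r₀).trans (le_abs_self _)) (abs_nonneg _)
    have h2 : |w r₀ * ⟪x₀, a j₀ r₀⟫| ≤ R * (ε * D ^ ℓ) + (R : ℝ) ^ 2 * D ^ ℓ * ρ := by
      have := abs_sub_abs_le_abs_sub (w r₀ * ⟪x₀, a j₀ r₀⟫)
        (∑ r, z r * ∑ s, v s * ∏ j, ⟪x r j, b j s⟫)
      linarith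
    have h3 : R * (ε * D ^ ℓ) ≤ (R : ℝ) ^ 2 * D ^ ℓ * ε := by
      have : (R : ℝ) ≤ (R : ℝ) ^ 2 := by nlinarith
      have := mul_le_mul_of_nonneg_right this (show 0 ≤ ε * D ^ ℓ by positivity)
      linarith
    rw [mul_add]; linarith
  have hlt := hQa r₀ (hQQ hr₀)
  rw [div_mul_eq_mul_div, div_lt_iff₀ hγ] at hlt
  linarith

/-- Product functionals that isolate the component `r` of the first decomposition and annihilate
all other components of both decompositions, when the components of the second one are matched to
those of the first one by the permutations `ψ j`. -/
theorem exists_isolating_functional {k : ℕ} {τ : ℝ} {a : μ → ι → E}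
    (ha : ∀ j, RobustIndep k τ (a j)) (hk : 2 ≤ k)
    (hkl : 2 * Fintype.card ι ≤ Fintype.card μ * (k - 1)) (ψ : μ → ι → ι)
    (hψ : ∀ j, Function.Injective (ψ j)) (r : ι) :
    ∃ x : μ → E, (∀ j, ‖x j‖ ≤ τ) ∧ (∀ j, ⟪x j, a j r⟫ = 1) ∧
      (∀ q, q ≠ r → ∃ j, ⟪x j, a j q⟫ = 0) ∧
      ∀ s, (∃ j, ψ j s ≠ r) → ∃ j, ⟪x j, a j (ψ j s)⟫ = 0 := by
  classical
  let t : ι ⊕ ι → Finset (μ × Fin (k - 1)) := Sum.elim (fun _ => Finset.univ) fun s =>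
    if ∀ j, ψ j s = r then Finset.univ else Finset.univ.filter fun p => ψ p.1 s ≠ r
  have htinl : ∀ q, t (Sum.inl q) = Finset.univ := fun q => rfl
  have htinr : ∀ s p, ψ p.1 s ≠ r → p ∈ t (Sum.inr s) := by
    intro s p hp
    simp only [t, Sum.elim_inr]
    split_ifs with hall
    · exact Finset.mem_univ _
    · simpa using hp
  have hcard : (Finset.univ : Finset (μ × Fin (k - 1))).card = Fintype.card μ * (k - 1) := by
    simp
  have hne : ∀ d, (t d).Nonempty := by
    have hk0 : 0 < k - 1 := by omega
    rintro (q | s)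
    · rw [htinl]
      have : 0 < Fintype.card ι := Fintype.card_pos_iff.2 ⟨q⟩
      rw [← Finset.card_pos, hcard]; omega
    · by_cases hall : ∀ j, ψ j s = r
      · have : t (Sum.inr s) = Finset.univ := by simp [t, hall]
        rw [this]
        have : 0 < Fintype.card ι := Fintype.card_pos_iff.2 ⟨s⟩
        rw [← Finset.card_pos, hcard]; omega
      · push Not at hall
        obtain ⟨j, hj⟩ := hall
        exact ⟨(j, ⟨0, hk0⟩), htinr _ _ hj⟩
  obtain ⟨f, hfinj, hft⟩ := (Finset.all_card_le_biUnion_card_iff_exists_injective t).1 (by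
    intro A
    rcases Nat.lt_or_ge 1 A.card with hA | hA
    · obtain ⟨d, hd, d', hd', hdd⟩ := Finset.one_lt_card.1 hA
      have huniv : (Finset.univ : Finset (μ × Fin (k - 1))) ⊆ A.biUnion t := by
        intro p _
        rw [Finset.mem_biUnion]
        rcases d with q | s
        · exact ⟨_, hd, by rw [htinl]; exact Finset.mem_univ _⟩
        rcases d' with q | s'
        · exact ⟨_, hd', by rw [htinl]; exact Finset.mem_univ _⟩
        by_cases h1 : ψ p.1 s = r
        · refine ⟨_, hd', htinr _ _ fun h2 => hdd ?_⟩
          rw [hψ p.1 (h1.trans h2.symm)]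
        · exact ⟨_, hd, htinr _ _ h1⟩
      refine le_trans ?_ (Finset.card_le_card huniv)
      rw [hcard]
      refine le_trans (Finset.card_le_univ A) ?_
      rw [Fintype.card_sum]; omega
    · rcases A.eq_empty_or_nonempty with rfl | ⟨d, hd⟩
      · simp
      · refine hA.trans (Finset.card_pos.2 ?_)
        obtain ⟨p, hp⟩ := hne d
        exact ⟨p, Finset.mem_biUnion.2 ⟨d, hd, hp⟩⟩)
  let g : μ → ι ⊕ ι → ι := fun j => Sum.elim id (ψ j)
  let W : μ → Finset ι := fun j =>
    ((Finset.univ.filter fun d => (f d).1 = j).image (g j)).erase r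
  have hWcard : ∀ j, (W j).card + 1 ≤ k := fun j => by
    have h1 : (W j).card ≤ (Finset.univ.filter fun d => (f d).1 = j).card :=
      (Finset.card_erase_le).trans Finset.card_image_le
    have h2 : (Finset.univ.filter fun d => (f d).1 = j).card ≤ k - 1 := by
      have := Finset.card_le_card_of_injOn (s := Finset.univ.filter fun d => (f d).1 = j)
        (t := (Finset.univ : Finset (Fin (k - 1)))) (fun d => (f d).2)
        (fun _ _ => Finset.mem_coe.2 (Finset.mem_univ _))
        (fun d hd d' hd' h => by
          simp only [Finset.coe_filter, Set.mem_ofPred_eq, Finset.mem_univ, true_and] at hd hd'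
          exact hfinj (Prod.ext (hd.trans hd'.symm) h))
      simpa using this
    omega
  choose x hx1 hx2 hx3 using fun j =>
    (ha j).exists_dual (hWcard j) (Finset.notMem_erase r _)
  refine ⟨x, hx1, hx2, fun q hq => ⟨(f (Sum.inl q)).1, hx3 _ q ?_⟩, fun s hs =>
    ⟨(f (Sum.inr s)).1, hx3 _ _ ?_⟩⟩
  · refine Finset.mem_erase.2 ⟨hq, Finset.mem_image.2 ⟨Sum.inl q, by simp, rfl⟩⟩
  · have hmem := hft (Sum.inr s)
    have hall : ¬ ∀ j, ψ j s = r := by push Not; exact hs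
    simp only [t, Sum.elim_inr, if_neg hall, Finset.mem_filter, Finset.mem_univ, true_and] at hmem
    exact Finset.mem_erase.2 ⟨hmem, Finset.mem_image.2 ⟨Sum.inr s, by simp, rfl⟩⟩

/-- Once the components are matched in each mode separately, the matchings agree and the weights
are close. -/
theorem TensorClose.exists_common_perm {k : ℕ} {τ γ B ε δ : ℝ} {w v : ι → ℝ} {a b : μ → ι → E}
    (h : TensorClose ε w v a b) (ha : ∀ j, RobustIndep k τ (a j)) (hk : 2 ≤ k)
    (hkl : 2 * Fintype.card ι ≤ Fintype.card μ * (k - 1))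
    (hτ : 1 ≤ τ) (hB1 : 1 ≤ B) (hε : 0 ≤ ε) (hδ : 0 ≤ δ) (hw : ∀ r, γ ≤ w r)
    (hv : ∀ s, |v s| ≤ 1) (hB : ∀ j s, ‖b j s‖ ≤ B)
    (ψ : μ → ι → ι) (hψ : ∀ j, Function.Injective (ψ j))
    (hψδ : ∀ j s, ‖a j (ψ j s) - b j s‖ ≤ δ)
    (hsmall : (ε + Fintype.card ι * δ) * (τ * B) ^ Fintype.card μ < γ) :
    ∃ π : Equiv.Perm ι, ∀ r, (∀ j, ‖a j r - b j (π r)‖ ≤ δ) ∧ |w r - v (π r)| ≤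
      (ε + (Fintype.card ι + Fintype.card μ * τ) * δ) * (τ * B) ^ Fintype.card μ := by
  set R := Fintype.card ι with hR
  set ℓ := Fintype.card μ with hℓ
  set D := τ * B with hD
  have hτ0 : 0 ≤ τ := by linarith
  have hD1 : 1 ≤ D := one_le_mul_of_one_le_of_one_le hτ hB1
  have hτD : τ ≤ D := le_mul_of_one_le_right hτ0 hB1
  have key : ∀ r, ∃ s, (∀ j, ψ j s = r) ∧
      |w r - v s| ≤ (ε + (R + ℓ * τ) * δ) * D ^ ℓ := by
    intro r
    obtain ⟨x, hxn, hx1, hx0, hxs⟩ := exists_isolating_functional ha hk hkl ψ hψ r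
    have hxb : ∀ j s, |⟪x j, b j s⟫| ≤ D := fun j s => (abs_real_inner_le_norm _ _).trans
      (mul_le_mul (hxn j) (hB j s) (norm_nonneg _) hτ0)
    have hxdiff : ∀ j s, |⟪x j, b j s⟫ - ⟪x j, a j (ψ j s)⟫| ≤ τ * δ := fun j s => by
      rw [← inner_sub_right]
      refine (abs_real_inner_le_norm _ _).trans ?_
      rw [norm_sub_rev]
      exact mul_le_mul (hxn j) (hψδ j s) (norm_nonneg _) hτ0
    have htruth : ∑ q, w q * ∏ j, ⟪x j, a j q⟫ = w r := by
      rw [Finset.sum_eq_single r]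
      · simp [hx1]
      · intro q _ hq
        obtain ⟨j, hj⟩ := hx0 q hq
        rw [Finset.prod_eq_zero (Finset.mem_univ j) hj, mul_zero]
      · simp
    -- Some mode annihilates the partner of `b j s`, so the corresponding factor is at most `τ * δ`.
    have hpart : ∀ s, (∃ j, ψ j s ≠ r) → |v s * ∏ j, ⟪x j, b j s⟫| ≤ δ * D ^ ℓ := by
      intro s hs
      obtain ⟨j, hj⟩ := hxs s hs
      have h1 := hxdiff j s
      rw [hj, sub_zero] at h1
      rw [abs_mul, Finset.abs_prod, ← Finset.mul_prod_erase _ _ (Finset.mem_univ j)]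
      have h2 : ∏ i ∈ Finset.univ.erase j, |⟪x i, b i s⟫| ≤ D ^ (ℓ - 1) := by
        refine (Finset.prod_le_prod (fun _ _ => abs_nonneg _) fun i _ => hxb i s).trans ?_
        rw [Finset.prod_const, Finset.card_erase_of_mem (Finset.mem_univ _), Finset.card_univ]
      have hℓ1 : ℓ = ℓ - 1 + 1 := by
        have : 0 < ℓ := Fintype.card_pos_iff.2 ⟨j⟩
        omega
      calc _ ≤ 1 * (τ * δ * D ^ (ℓ - 1)) := by
            gcongr
            exact hv s
        _ ≤ δ * (D ^ (ℓ - 1) * D) := by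
            have := mul_le_mul_of_nonneg_left hτD (show 0 ≤ δ * D ^ (ℓ - 1) by positivity)
            linarith
        _ = δ * D ^ ℓ := by rw [← pow_succ, ← hℓ1]
    have hx := h x
    have hxprod : ∏ j, ‖x j‖ ≤ D ^ ℓ := by
      refine (Finset.prod_le_prod (fun _ _ => norm_nonneg _)
        fun j _ => (hxn j).trans hτD).trans ?_
      simp [hℓ]
    have hx' := hx.trans (mul_le_mul_of_nonneg_left hxprod hε)
    rw [htruth] at hx'
    -- Otherwise every term of the second tensor would be small under the isolating functional,
    -- while the first tensor gives `w r ≥ γ`.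
    have hex : ∃ s, ∀ j, ψ j s = r := by
      by_contra hn
      push Not at hn
      have hsum : |∑ s, v s * ∏ j, ⟪x j, b j s⟫| ≤ R * (δ * D ^ ℓ) := by
        refine (Finset.abs_sum_le_sum_abs _ _).trans ?_
        refine (Finset.sum_le_sum fun s _ => hpart s (hn s)).trans (le_of_eq ?_)
        rw [Finset.sum_const, Finset.card_univ, ← hR, nsmul_eq_mul]
      have h1 := abs_sub_abs_le_abs_sub (w r) (∑ s, v s * ∏ j, ⟪x j, b j s⟫)
      have h2 := le_abs_self (w r)
      have h3 := hw r
      rw [add_mul] at hsmall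
      linarith
    obtain ⟨s, hs⟩ := hex
    refine ⟨s, hs, ?_⟩
    rw [← Finset.add_sum_erase _ _ (Finset.mem_univ s)] at hx'
    have hne : Nonempty μ := by
      rw [← Fintype.card_pos_iff]
      have : 0 < Fintype.card ι := Fintype.card_pos_iff.2 ⟨r⟩
      by_contra h0
      have : Fintype.card μ = 0 := by omega
      rw [hℓ, this] at hkl
      omega
    have hrest : |∑ s' ∈ Finset.univ.erase s, v s' * ∏ j, ⟪x j, b j s'⟫| ≤ R * (δ * D ^ ℓ) := by
      refine (Finset.abs_sum_le_sum_abs _ _).trans ?_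
      refine (Finset.sum_le_sum fun s' hs' => hpart s' ?_).trans ?_
      · obtain ⟨j⟩ := hne
        refine ⟨j, fun h' => Finset.ne_of_mem_erase hs' ?_⟩
        exact hψ j (h'.trans (hs j).symm)
      · rw [Finset.sum_const, nsmul_eq_mul]
        refine mul_le_mul_of_nonneg_right ?_ (by positivity)
        exact_mod_cast Finset.card_le_univ _
    have hprod1 : |∏ j, ⟪x j, b j s⟫ - 1| ≤ ℓ * (τ * δ) * D ^ ℓ := by
      have := abs_prod_sub_prod_le Finset.univ (fun j => ⟪x j, b j s⟫) (fun _ => 1) hD1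
        (show 0 ≤ τ * δ by positivity) (fun j _ => hxb j s) (fun _ _ => by simpa using hD1)
        (fun j _ => by
          have := hxdiff j s
          rwa [hs j, hx1 j] at this)
      simpa [hℓ] using this
    have hvs : |v s * (∏ j, ⟪x j, b j s⟫ - 1)| ≤ ℓ * (τ * δ) * D ^ ℓ := by
      rw [abs_mul]
      calc _ ≤ 1 * (ℓ * (τ * δ) * D ^ ℓ) :=
            mul_le_mul (hv s) hprod1 (abs_nonneg _) zero_le_one
        _ = _ := one_mul _
    have e : w r - v s = (w r - (v s * ∏ j, ⟪x j, b j s⟫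
        + ∑ s' ∈ Finset.univ.erase s, v s' * ∏ j, ⟪x j, b j s'⟫))
        + v s * (∏ j, ⟪x j, b j s⟫ - 1)
        + ∑ s' ∈ Finset.univ.erase s, v s' * ∏ j, ⟪x j, b j s'⟫ := by ring
    rw [e]
    refine (abs_add_three _ _ _).trans ?_
    calc _ ≤ ε * D ^ ℓ + ℓ * (τ * δ) * D ^ ℓ + R * (δ * D ^ ℓ) := by gcongr
      _ = _ := by ring
  choose π hπ hπw using key
  rcases isEmpty_or_nonempty μ with hμ | ⟨⟨j₀⟩⟩
  · have : IsEmpty ι := by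
      rw [← Fintype.card_eq_zero_iff]
      have : Fintype.card μ = 0 := Fintype.card_eq_zero
      rw [hℓ, this] at hkl
      omega
    exact ⟨Equiv.refl _, fun r => this.elim r⟩
  have hinj : Function.Injective π := fun r r' hrr => by
    rw [← hπ r j₀, hrr, hπ r' j₀]
  refine ⟨Equiv.ofBijective π (Finite.injective_iff_bijective.1 hinj), fun r => ⟨fun j => ?_, ?_⟩⟩
  · have := hψδ j (π r)
    rwa [hπ r j] at this
  · exact hπw r

end Kruskal

/-! ### Robust uniqueness with explicit constants -/

section Kruskal

variable {E ι μ : Type*} [NormedAddCommGroup E] [InnerProductSpace ℝ E]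

open scoped RealInnerProductSpace

/-- Testing `u - α • v` against `e` gives `1 - α`, so near parallelism with equal normalisation is
nearness. -/
theorem norm_sub_le_of_normalized {θ α B : ℝ} {u v e : E} (huv : ‖u - α • v‖ ≤ θ) (he : ‖e‖ ≤ 1)
    (hu : ⟪e, u⟫ = 1) (hv : ⟪e, v⟫ = 1) (hB : ‖v‖ ≤ B) : ‖u - v‖ ≤ θ * (1 + B) := by
  have hθ : 0 ≤ θ := (norm_nonneg _).trans huv
  have h1 : |1 - α| ≤ θ := by
    have : 1 - α = ⟪e, u - α • v⟫ := by rw [inner_sub_right, inner_smul_right, hu, hv, mul_one]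
    rw [this]
    refine (abs_real_inner_le_norm _ _).trans ?_
    calc ‖e‖ * ‖u - α • v‖ ≤ 1 * θ := mul_le_mul he huv (norm_nonneg _) zero_le_one
      _ = θ := one_mul _
  have e1 : u - v = (u - α • v) - (1 - α) • v := by module
  rw [e1]
  refine (norm_sub_le _ _).trans ?_
  rw [norm_smul, Real.norm_eq_abs]
  have := mul_le_mul h1 hB (norm_nonneg _) hθ
  linarith

variable [Fintype ι] [DecidableEq ι] [Fintype μ] [DecidableEq μ]

set_option maxHeartbeats 1000000 in
/-- Robust uniqueness of tensor decompositions: if the factors of the first decomposition are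
robustly independent in groups of `k` with `2 R ≤ ℓ (k - 1)`, then any decomposition of a nearby
tensor with the same number of terms is close to the first one, after one permutation of the
terms.  All factors are normalised by the value `1` of the functional `e`, and all parameters are
bounded by `G`. -/
theorem TensorClose.exists_perm {k : ℕ} {τ γ B ε G : ℝ} {w v : ι → ℝ} {a b : μ → ι → E}
    (h : TensorClose ε w v a b) (ha : ∀ j, RobustIndep k τ (a j)) (hk : 2 ≤ k)
    (hkR : k ≤ Fintype.card ι) (hkl : 2 * Fintype.card ι ≤ Fintype.card μ * (k - 1))
    (hτ : 1 ≤ τ) (hB1 : 1 ≤ B) (hγ : 0 < γ) (hε : 0 ≤ ε) (hw : ∀ r, γ ≤ w r)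
    (hv : ∀ s, |v s| ≤ 1) (hB : ∀ j s, ‖b j s‖ ≤ B)
    {e : E} (he : ‖e‖ ≤ 1) (hea : ∀ j r, ⟪e, a j r⟫ = 1) (heb : ∀ j r, ⟪e, b j r⟫ = 1)
    (hG : 4 ≤ G) (hτG : τ ≤ G) (hBG : B ≤ G) (hγG : 1 / γ ≤ G)
    (hRG : (Fintype.card ι : ℝ) ≤ G) (hℓG : (Fintype.card μ : ℝ) ≤ G)
    (hεG : G ^ (8 * Fintype.card μ + 37) * ε ≤ 1) :
    ∃ π : Equiv.Perm ι, ∀ r, (∀ j, ‖a j r - b j (π r)‖ ≤ G ^ (8 * Fintype.card μ + 30) * ε) ∧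
      |w r - v (π r)| ≤ G ^ (8 * Fintype.card μ + 30) * ε := by
  set R := Fintype.card ι with hR
  set ℓ := Fintype.card μ with hℓ
  have hG0 : 0 < G := by linarith
  have hG1 : 1 ≤ G := by linarith
  have hτ0 : 0 ≤ τ := by linarith
  have hB0 : 0 ≤ B := by linarith
  have hR0 : (0 : ℝ) ≤ R := by positivity
  have hpow : ∀ p q : ℕ, p ≤ q → G ^ p * ε ≤ G ^ q * ε := fun p q hpq =>
    mul_le_mul_of_nonneg_right (pow_le_pow_right₀ hG1 hpq) hε
  have hlt : ∀ p : ℕ, p ≤ 8 * ℓ + 36 → G ^ p * ε < 1 := by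
    intro p hp
    have h1 : G * (G ^ p * ε) ≤ 1 := by
      have : G * (G ^ p * ε) = G ^ (p + 1) * ε := by rw [pow_succ]; ring
      rw [this]
      exact (hpow _ _ (by omega)).trans hεG
    have h2 : 0 ≤ G ^ p * ε := by positivity
    nlinarith
  have hDG : (τ * B) ^ ℓ ≤ G ^ (2 * ℓ) := by
    rw [pow_mul]
    exact pow_le_pow_left₀ (by positivity) (by rw [sq]; exact mul_le_mul hτG hBG hB0 hG0.le) _
  set K := (R : ℝ) ^ 2 * (τ * B) ^ ℓ / γ with hKdef
  have hK0 : 0 ≤ K := by positivity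
  have hKG : K ≤ G ^ (2 * ℓ + 3) := by
    calc K = (R : ℝ) ^ 2 * (τ * B) ^ ℓ * (1 / γ) := by rw [hKdef]; ring
      _ ≤ G ^ 2 * G ^ (2 * ℓ) * G := by gcongr
      _ = _ := by ring
  -- Small enough that `τ * R ^ 2 * K * (ε + ρ) < 1`; the inverse of `ρ` then serves as the
  -- independence constant `σ` of the `b j`.
  set ρ := (G ^ (2 * ℓ + 8))⁻¹ with hρdef
  have hρ : 0 < ρ := by positivity
  have hερ : ε ≤ ρ := by
    rw [hρdef, ← one_div, le_div_iff₀ (by positivity), mul_comm]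
    exact (hlt _ (by omega)).le
  have hGρ : G ^ (2 * ℓ + 8) * ρ = 1 := mul_inv_cancel₀ (by positivity)
  have ht := h.orthogonalityTransfer ha hk hkR hkl hτ hB1 hγ hε hw hv hB
  have hsmall : τ * (R * (R * (K * (ε + ρ)))) < 1 := by
    have h1 : τ * (R * (R * (K * (ε + ρ)))) ≤ G * (G * (G * (G ^ (2 * ℓ + 3) * (ρ + ρ)))) := by
      gcongr
    have h2 : G * (G * (G * (G ^ (2 * ℓ + 3) * (ρ + ρ)))) * G ^ 2
        = 2 * (G ^ (2 * ℓ + 8) * ρ) := by ring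
    rw [hGρ] at h2
    have h3 : (16 : ℝ) ≤ G ^ 2 := by nlinarith
    have h4 : 0 ≤ G * (G * (G * (G ^ (2 * ℓ + 3) * (ρ + ρ)))) := by positivity
    nlinarith
  have hb : ∀ j, RobustIndep k (G ^ (2 * ℓ + 8)) (b j) := fun j => by
    have := (ht j).robustIndep (ha j) hτ0 hK0 hε hρ hkR hsmall
    rwa [hρdef, inv_inv] at this
  set σ := G ^ (2 * ℓ + 8) with hσ
  have hσ1 : 1 ≤ σ := one_le_pow₀ hG1
  have hσ0 : 0 ≤ σ := by linarith
  set θ := R * (K * ε) with hθ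
  have hθ0 : 0 ≤ θ := by positivity
  have hθG : θ ≤ G ^ (2 * ℓ + 4) * ε := by
    calc θ ≤ G * (G ^ (2 * ℓ + 3) * ε) := by rw [hθ]; gcongr
      _ = _ := by ring
  -- Each use of the approximate intersection of spans costs a factor `G ^ (2 * ℓ + 10)`. It is used
  -- once for the spans of `k - 2` vectors and once more for those of `k - 3`.
  have hstep : ∀ t p, 0 ≤ t → t ≤ G ^ p * ε → t + σ * (2 * t) * B ≤ G ^ (p + (2 * ℓ + 10)) * ε := by
    intro t p ht0 htG
    have h1 : 1 ≤ σ * B := one_le_mul_of_one_le_of_one_le hσ1 hB1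
    calc t + σ * (2 * t) * B ≤ (3 * (σ * B)) * t := by nlinarith
      _ ≤ (G * (σ * G)) * (G ^ p * ε) := by gcongr; linarith
      _ = _ := by rw [hσ]; ring
  set θ' := θ + σ * (2 * θ) * B with hθ'
  have hθ'0 : 0 ≤ θ' := by positivity
  have hθ'G : θ' ≤ G ^ (4 * ℓ + 14) * ε := by
    refine (hstep θ _ hθ0 hθG).trans (hpow _ _ (by omega))
  have hsmall' : τ * (R * (θ' + σ * (2 * θ') * B)) < 1 := by
    calc τ * (R * (θ' + σ * (2 * θ') * B))
        ≤ G * (G * (G ^ (4 * ℓ + 14 + (2 * ℓ + 10)) * ε)) := by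
          gcongr; exact hstep θ' _ hθ'0 hθ'G
      _ = G ^ (6 * ℓ + 26) * ε := by ring
      _ < 1 := hlt _ (by omega)
  set δ := G ^ (6 * ℓ + 27) * ε with hδ
  have hδ0 : 0 ≤ δ := by positivity
  have hθ3 : (θ' + R * (σ * (2 * θ') * B)) * (1 + B) ≤ δ := by
    have h1 : θ' + R * (σ * (2 * θ') * B) ≤ G ^ (6 * ℓ + 25) * ε := by
      have h2 : 1 ≤ R * (σ * B) := one_le_mul_of_one_le_of_one_le
        (by exact_mod_cast (show 1 ≤ R by omega)) (one_le_mul_of_one_le_of_one_le hσ1 hB1)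
      calc θ' + R * (σ * (2 * θ') * B) ≤ (3 * (R * (σ * B))) * θ' := by nlinarith
        _ ≤ (G * (G * (σ * G))) * (G ^ (4 * ℓ + 14) * ε) := by gcongr; linarith
        _ = _ := by rw [hσ]; ring
    calc _ ≤ (G ^ (6 * ℓ + 25) * ε) * (G ^ 2) := by
          gcongr
          nlinarith
      _ = δ := by rw [hδ]; ring
  have hex : ∀ j s, ∃ r, ‖a j r - b j s‖ ≤ δ := fun j s => by
    obtain ⟨r, α, hr⟩ := (ht j).exists_parallel (ha j) hτ0 (hb j) hσ0 (hB j) hB0 hK0 hε hk hkR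
      rfl rfl hsmall' s
    exact ⟨r, (norm_sub_le_of_normalized hr he (hea j r) (heb j s) (hB j s)).trans hθ3⟩
  choose ψ hψ using hex
  -- Two `b j s` matched with the same `a j r` are within `2 * δ` of each other, which contradicts
  -- the robust independence of pairs; this needs `2 ≤ k`.
  have hinj : ∀ j, Function.Injective (ψ j) := by
    intro j s s' hss
    by_contra hne
    have h1 := hb j {s, s'} (Pi.single s 1 - Pi.single s' 1)
      ((Finset.card_le_two).trans hk) (fun i hi => by
        simp only [Finset.mem_insert, Finset.mem_singleton, not_or] at hi
        simp [hi.1, hi.2]) s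
    have h2 : ∑ i, (Pi.single s 1 - Pi.single s' 1 : ι → ℝ) i • b j i = b j s - b j s' := by
      simp [sub_smul, Pi.single_apply, ite_smul]
    rw [h2] at h1
    have h3 : ‖b j s - b j s'‖ ≤ δ + δ := by
      have e1 : b j s - b j s' = (a j (ψ j s') - b j s') - (a j (ψ j s) - b j s) := by
        rw [hss]; abel
      rw [e1]
      exact (norm_sub_le _ _).trans (add_le_add (hψ j s') (hψ j s))
    have h4 : |(Pi.single s 1 - Pi.single s' 1 : ι → ℝ) s| = 1 := by
      simp [hne]
    rw [h4] at h1
    have h5 := mul_le_mul_of_nonneg_left h3 hσ0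
    have h6 : σ * (δ + δ) ≤ G ^ (8 * ℓ + 36) * ε := by
      have : G ^ (8 * ℓ + 36) * ε = G * (σ * δ) := by rw [hσ, hδ]; ring
      rw [this]
      have : 0 ≤ σ * δ := by positivity
      nlinarith
    have h7 := hlt (8 * ℓ + 36) le_rfl
    linarith
  have hfin : ∀ c : ℝ, 0 ≤ c → c ≤ 2 * G ^ 2 →
      (ε + c * δ) * (τ * B) ^ ℓ ≤ G ^ (8 * ℓ + 30) * ε := by
    intro c hc0 hc
    have hεδ : ε ≤ δ := by
      have := hpow 0 (6 * ℓ + 27) (by omega)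
      simpa using this
    calc (ε + c * δ) * (τ * B) ^ ℓ ≤ (δ + (2 * G ^ 2) * δ) * G ^ (2 * ℓ) := by gcongr
      _ ≤ (G ^ 3 * δ) * G ^ (2 * ℓ) := by
          gcongr
          have : 1 + 2 * G ^ 2 ≤ G ^ 3 := by nlinarith
          nlinarith
      _ = _ := by rw [hδ]; ring
  have hcard1 : (R : ℝ) ≤ 2 * G ^ 2 := by nlinarith
  have hcard2 : (R : ℝ) + ℓ * τ ≤ 2 * G ^ 2 := by
    have : (ℓ : ℝ) * τ ≤ G * G := by gcongr
    nlinarith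
  obtain ⟨π, hπ⟩ := h.exists_common_perm ha hk hkl hτ hB1 hε hδ0 hw hv hB ψ hinj hψ (by
    refine lt_of_le_of_lt (hfin R hR0 hcard1) ?_
    have h1 := hlt (8 * ℓ + 31) (by omega)
    have h2 : G ^ (8 * ℓ + 31) * ε = G * (G ^ (8 * ℓ + 30) * ε) := by ring
    rw [div_le_iff₀ hγ] at hγG
    have h3 : G * (G ^ (8 * ℓ + 30) * ε) < G * γ := by linarith
    exact lt_of_mul_lt_mul_left h3 hG0.le)
  refine ⟨π, fun r => ⟨fun j => ((hπ r).1 j).trans (hpow _ _ (by omega)), ?_⟩⟩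
  exact ((hπ r).2).trans (hfin _ (by positivity) hcard2)

end Kruskal

/-! ### Singular values and the robust Kruskal rank -/

section SingularValues

open scoped RealInnerProductSpace

/-- The smallest singular value bounds a linear map from below. -/
theorem LinearMap.singularValues_mul_norm_le {E F : Type*} [NormedAddCommGroup E]
    [InnerProductSpace ℝ E] [FiniteDimensional ℝ E] [NormedAddCommGroup F] [InnerProductSpace ℝ F]
    [FiniteDimensional ℝ F] (T : E →ₗ[ℝ] F) {m : ℕ} (hm : Module.finrank ℝ E = m) (x : E) :
    T.singularValues (m - 1) * ‖x‖ ≤ ‖T x‖ := by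
  have hT := T.isSymmetric_adjoint_comp_self
  set b := hT.eigenvectorBasis hm with hb
  -- The form `⟪x, T* T x⟫` in an eigenbasis of `T* T`, whose eigenvalues are the squared singular
  -- values.
  have h1 : ‖T x‖ ^ 2 = ∑ i, hT.eigenvalues hm i * (b.repr x i) ^ 2 := by
    have e1 : ‖T x‖ ^ 2 = ⟪x, (LinearMap.adjoint T ∘ₗ T) x⟫ := by
      rw [LinearMap.comp_apply, LinearMap.adjoint_inner_right, real_inner_self_eq_norm_sq]
    rw [e1, ← b.sum_inner_mul_inner]
    refine Finset.sum_congr rfl fun i _ => ?_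
    have h2 := hT.eigenvectorBasis_apply_self_apply hm x i
    rw [← hb] at h2
    rw [← b.repr_apply_apply, h2, b.repr_apply_apply, real_inner_comm]
    simp
    ring
  have h2 : ‖x‖ ^ 2 = ∑ i, (b.repr x i) ^ 2 := by
    rw [← b.repr.norm_map x, EuclideanSpace.norm_sq_eq]
    simp
  have h3 : (T.singularValues (m - 1) * ‖x‖) ^ 2 ≤ ‖T x‖ ^ 2 := by
    rw [mul_pow, h1, h2, Finset.mul_sum]
    refine Finset.sum_le_sum fun i _ => mul_le_mul_of_nonneg_right ?_ (sq_nonneg _)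
    rw [← T.sq_singularValues_fin hm i]
    exact pow_le_pow_left₀ (T.singularValues_nonneg _)
      (T.singularValues_antitone (by omega)) 2
  exact le_of_sq_le_sq h3 (norm_nonneg _)

/-- The supremum in the definition of the rank is attained, possibly at a value above `k`. A set of
at most `k` columns is enlarged to that size, where the singular value bound applies, and the
coefficients are extended by 0. -/
theorem robustIndep_of_le_robustKruskalRank {n R k : ℕ} {τ : ℝ} (hτ : 0 < τ)
    {A : Matrix (Fin n) (Fin R) ℝ} (hk : 1 ≤ k) (hkA : k ≤ robustKruskalRank τ A) :
    k ≤ R ∧ RobustIndep k τ fun r => (WithLp.toLp 2 fun i => A i r : EuclideanSpace ℝ (Fin n)) := by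
  set K : Set ℕ := {k : ℕ | 1 ≤ k ∧ k ≤ R ∧ ∀ S : Finset (Fin R), S.card = k →
    1 / τ ≤ (Matrix.toEuclideanLin
      (A.submatrix id (fun s : S => (s : Fin R)))).singularValues (k - 1)} with hK
  have hbdd : BddAbove K := ⟨R, fun m hm => hm.2.1⟩
  have hne : K.Nonempty := by
    by_contra h
    rw [Set.not_nonempty_iff_eq_empty] at h
    have : robustKruskalRank τ A = 0 := by
      rw [robustKruskalRank, ← hK, h, Nat.sSup_def ⟨0, by simp⟩]; simp
    omega
  obtain ⟨h1, h2, h3⟩ := Nat.sSup_mem hne hbdd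
  change k ≤ sSup K at hkA
  refine ⟨hkA.trans h2, fun S α hS hα r => ?_⟩
  obtain ⟨S', hSS', -, hcard⟩ := Finset.exists_subsuperset_card_eq (n := sSup K)
    (Finset.subset_univ S) (hS.trans hkA) (by simpa using h2)
  let x : EuclideanSpace ℝ S' := WithLp.toLp 2 fun s => α s
  have h4 := (Matrix.toEuclideanLin
      (A.submatrix id (fun s : S' => (s : Fin R)))).singularValues_mul_norm_le
      (m := sSup K) (by simp [hcard]) x
  have h5 : Matrix.toEuclideanLin (A.submatrix id (fun s : S' => (s : Fin R))) x
      = ∑ i, α i • (WithLp.toLp 2 fun j => A j i : EuclideanSpace ℝ (Fin n)) := by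
    ext j
    have : ∑ i, α i * A j i = ∑ i ∈ S', α i * A j i := by
      symm
      refine Finset.sum_subset (Finset.subset_univ _) fun i _ hi => ?_
      rw [hα i fun h => hi (hSS' h), zero_mul]
    simp [x, Matrix.toLpLin_apply, Matrix.mulVec, dotProduct, this]
    rw [← Finset.sum_coe_sort S', Finset.univ_eq_attach]
    exact Finset.sum_congr rfl fun i _ => mul_comm _ _
  rw [h5] at h4
  have h6 : |α r| ≤ ‖x‖ := by
    by_cases hr : r ∈ S'
    · have := PiLp.norm_apply_le x ⟨r, hr⟩
      simpa [x] using this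
    · rw [hα r fun h => hr (hSS' h), abs_zero]; exact norm_nonneg _
  have h7 := mul_le_mul_of_nonneg_right (h3 S' hcard) (norm_nonneg x)
  have h8 := h7.trans h4
  rw [div_mul_eq_mul_div, one_mul, div_le_iff₀ hτ] at h8
  linarith

end SingularValues

/-! ### Passing to coordinates and to augmented vectors -/

section Coordinates

theorem RobustIndep.mono {E ι : Type*} [NormedAddCommGroup E] [InnerProductSpace ℝ E] [Fintype ι]
    {k : ℕ} {τ τ' : ℝ} {a : ι → E} (h : RobustIndep k τ a) (hτ : τ ≤ τ') : RobustIndep k τ' a :=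
  fun S α hS hα r => (h S α hS hα r).trans (mul_le_mul_of_nonneg_right hτ (norm_nonneg _))

/-- The vector `(1, u / c)`. -/
def augment {n : ℕ} (c : ℝ) (u : Fin n → ℝ) : Fin (n + 1) → ℝ :=
  Fin.cons 1 fun i => u i / c

@[simp] theorem augment_zero {n : ℕ} (c : ℝ) (u : Fin n → ℝ) : augment c u 0 = 1 := rfl

@[simp] theorem augment_succ {n : ℕ} (c : ℝ) (u : Fin n → ℝ) (i : Fin n) :
    augment c u i.succ = u i / c := rfl

/-- The last `n` coordinates of a combination of augmented vectors are those of the original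
combination divided by `c`; the additional coordinate only increases the norm. -/
theorem RobustIndep.augment {n k : ℕ} {ι : Type*} [Fintype ι] {τ c : ℝ} (hc : 0 < c) (hτ : 0 ≤ τ)
    {A : ι → Fin n → ℝ}
    (h : RobustIndep k τ fun r => (WithLp.toLp 2 (A r) : EuclideanSpace ℝ (Fin n))) :
    RobustIndep k (τ * c)
      fun r => (WithLp.toLp 2 (_root_.augment c (A r)) : EuclideanSpace ℝ (Fin (n + 1))) := by
  intro S α hS hα r
  refine (h S α hS hα r).trans ?_
  rw [mul_assoc]
  refine mul_le_mul_of_nonneg_left ?_ hτ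
  refine le_of_sq_le_sq ?_ (by positivity)
  rw [mul_pow, EuclideanSpace.norm_sq_eq, EuclideanSpace.norm_sq_eq, Fin.sum_univ_succ, mul_add,
    Finset.mul_sum]
  refine le_add_of_nonneg_of_le (by positivity) (le_of_eq ?_)
  refine Finset.sum_congr rfl fun i _ => ?_
  simp only [WithLp.ofLp_sum, WithLp.ofLp_smul, Finset.sum_apply, Pi.smul_apply, smul_eq_mul,
    augment_succ, Real.norm_eq_abs, sq_abs]
  rw [← mul_pow, Finset.mul_sum]
  congr 1
  refine Finset.sum_congr rfl fun r _ => ?_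
  field_simp

open scoped RealInnerProductSpace

theorem prod_inner_eq_sum {d : ℕ} {μ : Type*} [Fintype μ] [DecidableEq μ]
    (x c : μ → EuclideanSpace ℝ (Fin d)) :
    ∏ j, ⟪x j, c j⟫ = ∑ I : μ → Fin d, (∏ j, x j (I j)) * ∏ j, c j (I j) := by
  have : ∀ j, ⟪x j, c j⟫ = ∑ i, x j i * c j i := fun j => by
    rw [PiLp.inner_apply]
    exact Finset.sum_congr rfl fun i _ => by simp [mul_comm]
  simp_rw [this, Finset.prod_univ_sum, Fintype.piFinset_univ, Finset.prod_mul_distrib]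

/-- Expanding the multilinear forms in coordinates gives `d ^ ℓ` terms, each at most `ε` times the
product of the norms. -/
theorem tensorClose_of_entries {d : ℕ} {ι μ : Type*} [Fintype ι] [Fintype μ] [DecidableEq μ]
    {ε : ℝ} {w v : ι → ℝ} {a b : μ → ι → Fin d → ℝ}
    (h : ∀ I : μ → Fin d,
      |∑ r, w r * ∏ j, a j r (I j) - ∑ s, v s * ∏ j, b j s (I j)| ≤ ε) :
    TensorClose ((d : ℝ) ^ Fintype.card μ * ε) w v
      (fun j r => (WithLp.toLp 2 (a j r) : EuclideanSpace ℝ (Fin d)))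
      fun j r => (WithLp.toLp 2 (b j r) : EuclideanSpace ℝ (Fin d)) := by
  intro x
  have e : ∀ (w : ι → ℝ) (a : μ → ι → Fin d → ℝ),
      ∑ r, w r * ∏ j, ⟪x j, (WithLp.toLp 2 (a j r) : EuclideanSpace ℝ (Fin d))⟫
        = ∑ I : μ → Fin d, (∏ j, x j (I j)) * ∑ r, w r * ∏ j, a j r (I j) := by
    intro w a
    simp_rw [prod_inner_eq_sum, Finset.mul_sum]
    rw [Finset.sum_comm]
    refine Finset.sum_congr rfl fun I _ => Finset.sum_congr rfl fun r _ => ?_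
    ring
  rw [e, e, ← Finset.sum_sub_distrib]
  refine (Finset.abs_sum_le_sum_abs _ _).trans ?_
  have hterm : ∀ I ∈ (Finset.univ : Finset (μ → Fin d)),
      |(∏ j, x j (I j)) * ∑ r, w r * ∏ j, a j r (I j)
        - (∏ j, x j (I j)) * ∑ r, v r * ∏ j, b j r (I j)| ≤ (∏ j, ‖x j‖) * ε := by
    intro I _
    rw [← mul_sub, abs_mul, Finset.abs_prod]
    refine mul_le_mul ?_ (h I) (abs_nonneg _) (Finset.prod_nonneg fun _ _ => norm_nonneg _)
    exact Finset.prod_le_prod (fun _ _ => abs_nonneg _) fun j _ => PiLp.norm_apply_le (x j) (I j)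
  refine (Finset.sum_le_sum hterm).trans (le_of_eq ?_)
  rw [Finset.sum_const, Finset.card_univ, Fintype.card_fun, Fintype.card_fin, nsmul_eq_mul]
  push_cast
  ring

theorem norm_toLp_le {d : ℕ} {u : Fin d → ℝ} (hu : ∀ i, |u i| ≤ 1) :
    ‖(WithLp.toLp 2 u : EuclideanSpace ℝ (Fin d))‖ ≤ d := by
  have h1 : ‖(WithLp.toLp 2 u : EuclideanSpace ℝ (Fin d))‖ ^ 2 ≤ d := by
    rw [EuclideanSpace.norm_sq_eq]
    refine (Finset.sum_le_sum (g := fun _ => (1 : ℝ)) fun i _ => ?_).trans (by simp)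
    rw [Real.norm_eq_abs, sq_abs]
    exact (sq_le_one_iff_abs_le_one _).2 (hu i)
  refine le_of_sq_le_sq (h1.trans ?_) (by positivity)
  exact_mod_cast Nat.le_self_pow two_ne_zero d

end Coordinates

/-! ### Representing the factors by few columns of the tensor -/

/-- Among finitely many vectors spanning a space of dimension at most `R` there are `R` such that
all of them are combinations of these with coefficients in `[-1, 1]`. -/
theorem exists_bounded_spanning_family {κ V : Type*} [Finite κ] [Nonempty κ] [AddCommGroup V]
    [Module ℝ V] (v : κ → V) {R : ℕ}
    (hR : Module.finrank ℝ (Submodule.span ℝ (Set.range v)) ≤ R) :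
    ∃ s : Fin R → κ, ∀ i, ∃ c : Fin R → ℝ, (∀ t, |c t| ≤ 1) ∧ v i = ∑ t, c t • v (s t) := by
  classical
  set W := Submodule.span ℝ (Set.range v) with hW
  have : FiniteDimensional ℝ W := FiniteDimensional.span_of_finite ℝ (Set.finite_range v)
  set m := Module.finrank ℝ W with hm
  let v' : κ → W := fun i => ⟨v i, Submodule.subset_span ⟨i, rfl⟩⟩
  let b := Module.finBasis ℝ W
  -- A barycentric spanner: choose `m` of the vectors with determinant of largest modulus. By
  -- Cramer's rule the coefficients of any other vector are ratios of determinants with this one as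
  -- denominator.
  obtain ⟨s₀, hmax⟩ := Finite.exists_max fun s : Fin m → κ => |b.det (v' ∘ s)|
  have hne : b.det (v' ∘ s₀) ≠ 0 := by
    obtain ⟨f, hf, hspan, hli⟩ := Submodule.exists_fun_fin_finrank_span_eq ℝ (Set.range v)
    choose s hs using hf
    have hvs : v ∘ s = f := funext hs
    have hli' : LinearIndependent ℝ (v' ∘ s) := by
      refine LinearIndependent.of_comp W.subtype ?_
      have : W.subtype ∘ (v' ∘ s) = f := by rw [← hvs]; rfl
      rw [this]; exact hli
    let b' := Module.Basis.mk hli' (hli'.span_eq_top_of_card_eq_finrank' (Fintype.card_fin _)).ge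
    have h1 : IsUnit (b.det b') := b.isUnit_det b'
    rw [Module.Basis.coe_mk] at h1
    intro h0
    have := hmax s
    rw [h0, abs_zero] at this
    exact h1.ne_zero (abs_eq_zero.1 (le_antisymm this (abs_nonneg _)))
  obtain ⟨hli, hsp⟩ := (Module.Basis.is_basis_iff_det b).2 (isUnit_iff_ne_zero.2 hne)
  let b' := Module.Basis.mk hli hsp.ge
  have hcoef : ∀ i t, |b'.repr (v' i) t| ≤ 1 := by
    intro i t
    have h1 : b.det (Function.update (v' ∘ s₀) t (v' i)) = b'.repr (v' i) t * b.det (v' ∘ s₀) := by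
      conv_lhs => rw [← b'.sum_repr (v' i)]
      rw [AlternatingMap.map_update_sum, Finset.sum_eq_single t]
      · rw [AlternatingMap.map_update_smul, smul_eq_mul]
        congr 2
        rw [show b' t = (v' ∘ s₀) t from Module.Basis.mk_apply hli hsp.ge t,
          Function.update_eq_self]
      · intro t' _ htt
        rw [AlternatingMap.map_update_smul,
          show b' t' = (v' ∘ s₀) t' from Module.Basis.mk_apply hli hsp.ge t',
          AlternatingMap.map_update_self _ _ htt.symm, smul_zero]
      · simp
    have h2 : Function.update (v' ∘ s₀) t (v' i) = v' ∘ Function.update s₀ t i := by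
      rw [Function.comp_update]
    have h3 := hmax (Function.update s₀ t i)
    rw [← h2, h1, abs_mul] at h3
    exact le_of_mul_le_mul_right (by rwa [one_mul]) (abs_pos.2 hne)
  obtain ⟨i₀⟩ := ‹Nonempty κ›
  -- If the span has dimension below `R`, the family is padded with an arbitrary index and
  -- coefficient 0.
  refine ⟨fun t => if h : (t : ℕ) < m then s₀ ⟨t, h⟩ else i₀, fun i =>
    ⟨fun t => if h : (t : ℕ) < m then b'.repr (v' i) ⟨t, h⟩ else 0, fun t => ?_, ?_⟩⟩
  · dsimp only
    split_ifs with h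
    · exact hcoef _ _
    · simp
  · have h1 : v i = ∑ t, b'.repr (v' i) t • v (s₀ t) := by
      have := congrArg W.subtype (b'.sum_repr (v' i))
      rw [map_sum] at this
      rw [show v i = W.subtype (v' i) from rfl, ← this]
      refine Finset.sum_congr rfl fun t _ => ?_
      rw [map_smul, show b' t = (v' ∘ s₀) t from Module.Basis.mk_apply hli hsp.ge t]
      rfl
    rw [h1]
    obtain ⟨e, he⟩ := Nat.exists_eq_add_of_le hR
    subst he
    rw [Fin.sum_univ_add]
    simp
    rfl

/-- A single column has norm at least `1 / τ` and at most `c * √n`. This excludes `n = 0` and `c =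
0`, and bounds `n` by a power of `n * τ * c`. -/
theorem RobustIndep.one_le {n k : ℕ} {ι : Type*} [Fintype ι] [DecidableEq ι] {τ c : ℝ}
    (hk : 1 ≤ k) {A : ι → Fin n → ℝ} (hA : ∀ r i, |A r i| ≤ c) (r : ι)
    (h : RobustIndep k τ fun r => (WithLp.toLp 2 (A r) : EuclideanSpace ℝ (Fin n))) :
    1 ≤ τ ^ 2 * (n * c ^ 2) := by
  have h1 := h {r} (Pi.single r 1) (by simpa using hk) (fun i hi => by
    simp only [Finset.mem_singleton] at hi; simp [hi]) r
  have h2 : ∑ i, (Pi.single r 1 : ι → ℝ) i • (WithLp.toLp 2 (A i) : EuclideanSpace ℝ (Fin n))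
      = WithLp.toLp 2 (A r) := by
    simp [Pi.single_apply, ite_smul]
  rw [h2, Pi.single_eq_same, abs_one] at h1
  have h3 : ‖(WithLp.toLp 2 (A r) : EuclideanSpace ℝ (Fin n))‖ ^ 2 ≤ n * c ^ 2 := by
    rw [EuclideanSpace.norm_sq_eq]
    refine (Finset.sum_le_sum (g := fun _ => c ^ 2) fun i _ => ?_).trans (by simp)
    rw [Real.norm_eq_abs]
    exact pow_le_pow_left₀ (abs_nonneg _) (hA r i) 2
  calc (1 : ℝ) ≤ (τ * ‖(WithLp.toLp 2 (A r) : EuclideanSpace ℝ (Fin n))‖) ^ 2 := one_le_pow₀ h1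
    _ = τ ^ 2 * ‖(WithLp.toLp 2 (A r) : EuclideanSpace ℝ (Fin n))‖ ^ 2 := mul_pow _ _ _
    _ ≤ _ := mul_le_mul_of_nonneg_left h3 (sq_nonneg _)

/-- The tensor `∑ w r ⊗ⱼ a j r`. -/
def mixtureTensor {μ ι : Type*} [Fintype μ] [Fintype ι] {d : ℕ} (w : ι → ℝ)
    (a : μ → ι → Fin d → ℝ) (I : μ → Fin d) : ℝ :=
  ∑ r, w r * ∏ j, a j r (I j)

theorem mixtureTensor_update {μ ι : Type*} [Fintype μ] [DecidableEq μ] [Fintype ι] {d : ℕ}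
    (w : ι → ℝ) (a : μ → ι → Fin d → ℝ) (I : μ → Fin d) (j : μ) (i : Fin d) :
    mixtureTensor w a (Function.update I j i)
      = ∑ r, (w r * ∏ j' ∈ Finset.univ.erase j, a j' r (I j')) * a j r i := by
  refine Finset.sum_congr rfl fun r _ => ?_
  rw [← Finset.mul_prod_erase _ _ (Finset.mem_univ j), Function.update_self,
    Finset.prod_congr rfl fun j' hj' => by
      rw [Function.update_of_ne (Finset.ne_of_mem_erase hj')]]
  ring

-- Contracting all modes other than `j` with functionals dual to the component `r` turns the tensor
-- into `w r` times the factor `a j r`; the coefficients are products of entries of the dual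
-- vectors.
open scoped RealInnerProductSpace in
theorem exists_column_coefficients {μ ι : Type*} [Fintype μ] [DecidableEq μ] [Fintype ι]
    [DecidableEq ι] {d k : ℕ} {τ γ : ℝ} {w : ι → ℝ} {a : μ → ι → Fin d → ℝ} (hd : 0 < d)
    (ha : ∀ j, RobustIndep k τ fun r => (WithLp.toLp 2 (a j r) : EuclideanSpace ℝ (Fin d)))
    (hτ : 1 ≤ τ) (hk : 2 ≤ k) (hkl : Fintype.card ι ≤ (Fintype.card μ - 1) * (k - 1))
    (hγ : 0 < γ) (hw : ∀ r, γ ≤ w r) (j : μ) (r : ι) :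
    ∃ c : (μ → Fin d) → ℝ, (∀ I, |c I| ≤ τ ^ Fintype.card μ / γ) ∧
      ∀ i, a j r i = ∑ I, c I * mixtureTensor w a (Function.update I j i) := by
  have hd0 : (d : ℝ) ≠ 0 := by positivity
  have hd1 : (1 : ℝ) ≤ d := by exact_mod_cast hd
  have hwr : 0 < w r := hγ.trans_le (hw r)
  have hcard : (Finset.univ.erase j : Finset μ).card = Fintype.card μ - 1 := by
    rw [Finset.card_erase_of_mem (Finset.mem_univ _), Finset.card_univ]
  obtain ⟨x, hx, hx1, hx0⟩ := exists_dual_product ha (by omega) (Finset.univ.erase j)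
    (W := Finset.univ.erase r) (r := r)
    (by rw [hcard, Finset.card_erase_of_mem (Finset.mem_univ _), Finset.card_univ]; omega)
    (Finset.notMem_erase _ _)
  have hsum : ∀ q, ∑ I : μ → Fin d, (∏ j' ∈ Finset.univ.erase j, x j' (I j')) * (d : ℝ)⁻¹ *
      ∏ j' ∈ Finset.univ.erase j, a j' q (I j') = if q = r then 1 else 0 := by
    intro q
    -- The sum runs over full index tuples although coordinate `j` of `I` is irrelevant. The
    -- constant vectors `1 / d` and `1` in mode `j`, with inner product 1, average over it.
    have h1 := prod_inner_eq_sum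
      (Function.update x j (WithLp.toLp 2 fun _ => (d : ℝ)⁻¹))
      (Function.update (fun j => (WithLp.toLp 2 (a j q) : EuclideanSpace ℝ (Fin d))) j
        (WithLp.toLp 2 fun _ => (1 : ℝ)))
    rw [← Finset.mul_prod_erase _ _ (Finset.mem_univ j)] at h1
    rw [Finset.prod_congr rfl fun j' hj' => by
      rw [Function.update_of_ne (Finset.ne_of_mem_erase hj'),
        Function.update_of_ne (Finset.ne_of_mem_erase hj')]] at h1
    rw [Function.update_self, Function.update_self] at h1
    have h2 : ⟪(WithLp.toLp 2 fun _ => (d : ℝ)⁻¹ : EuclideanSpace ℝ (Fin d)),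
        WithLp.toLp 2 fun _ => (1 : ℝ)⟫ = 1 := by
      simp [PiLp.inner_apply, hd0]
    rw [h2, one_mul] at h1
    have h3 : ∏ j' ∈ Finset.univ.erase j,
        ⟪x j', (WithLp.toLp 2 (a j' q) : EuclideanSpace ℝ (Fin d))⟫ = if q = r then 1 else 0 := by
      split_ifs with hq
      · rw [hq]; exact hx1
      · exact hx0 q (Finset.mem_erase.2 ⟨hq, Finset.mem_univ _⟩)
    rw [← h3, h1]
    refine Finset.sum_congr rfl fun I _ => ?_
    rw [← Finset.mul_prod_erase _ _ (Finset.mem_univ j),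
      ← Finset.mul_prod_erase Finset.univ (fun j' => (Function.update
        (fun j => (WithLp.toLp 2 (a j q) : EuclideanSpace ℝ (Fin d))) j
        (WithLp.toLp 2 fun _ => (1 : ℝ)) j').ofLp (I j')) (Finset.mem_univ j)]
    have h4 : ∀ y : μ → EuclideanSpace ℝ (Fin d), ∀ z, ∏ j' ∈ Finset.univ.erase j,
        (Function.update y j z j').ofLp (I j') = ∏ j' ∈ Finset.univ.erase j, y j' (I j') :=
      fun y z => Finset.prod_congr rfl fun j' hj' => by
        rw [Function.update_of_ne (Finset.ne_of_mem_erase hj')]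
    rw [h4, h4]
    simp only [Function.update_self]
    ring
  refine ⟨fun I => (∏ j' ∈ Finset.univ.erase j, x j' (I j')) * (d : ℝ)⁻¹ / w r, fun I => ?_,
    fun i => ?_⟩
  · rw [abs_div, abs_mul, abs_of_pos hwr, abs_inv, Nat.abs_cast, Finset.abs_prod]
    have h1 : ∏ j' ∈ Finset.univ.erase j, |x j' (I j')| ≤ τ ^ Fintype.card μ := by
      refine (Finset.prod_le_prod (fun _ _ => abs_nonneg _) fun j' hj' =>
        (PiLp.norm_apply_le (x j') (I j')).trans (hx j' hj')).trans ?_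
      rw [Finset.prod_const, hcard]
      exact pow_le_pow_right₀ hτ (by omega)
    have h2 : (d : ℝ)⁻¹ ≤ 1 := inv_le_one_of_one_le₀ hd1
    have h3 : 0 ≤ ∏ j' ∈ Finset.univ.erase j, |x j' (I j')| :=
      Finset.prod_nonneg fun _ _ => abs_nonneg _
    refine div_le_div₀ (by positivity) ?_ hγ (hw r)
    calc _ ≤ τ ^ Fintype.card μ * 1 := mul_le_mul h1 h2 (by positivity) (by positivity)
      _ = _ := mul_one _
  · have : ∑ I : μ → Fin d, (∏ j' ∈ Finset.univ.erase j, x j' (I j')) * (d : ℝ)⁻¹ / w r *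
        mixtureTensor w a (Function.update I j i)
        = ∑ q, (w q / w r * a j q i) * ∑ I : μ → Fin d,
          (∏ j' ∈ Finset.univ.erase j, x j' (I j')) * (d : ℝ)⁻¹ *
            ∏ j' ∈ Finset.univ.erase j, a j' q (I j') := by
      simp_rw [mixtureTensor_update, Finset.mul_sum]
      rw [Finset.sum_comm]
      refine Finset.sum_congr rfl fun q _ => Finset.sum_congr rfl fun I _ => ?_
      ring
    rw [this]
    simp_rw [hsum]
    simp [hwr.ne']

/-- In each mode, the factors are combinations, with bounded coefficients, of `R` columns of the
flattened tensor. -/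
theorem exists_column_representation {μ : Type*} [Fintype μ] [DecidableEq μ] {R d k : ℕ}
    {τ γ : ℝ} {w : Fin R → ℝ} {a : μ → Fin R → Fin d → ℝ} (hd : 0 < d)
    (ha : ∀ j, RobustIndep k τ fun r => (WithLp.toLp 2 (a j r) : EuclideanSpace ℝ (Fin d)))
    (hτ : 1 ≤ τ) (hk : 2 ≤ k) (hkl : R ≤ (Fintype.card μ - 1) * (k - 1))
    (hγ : 0 < γ) (hw : ∀ r, γ ≤ w r) (j : μ) :
    ∃ (s : Fin R → μ → Fin d) (C : Fin R → Fin R → ℝ),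
      (∀ t r, |C t r| ≤ (d : ℝ) ^ Fintype.card μ * (τ ^ Fintype.card μ / γ)) ∧
      ∀ r i, a j r i = ∑ t, C t r * mixtureTensor w a (Function.update (s t) j i) := by
  have : Nonempty (μ → Fin d) := ⟨fun _ => ⟨0, hd⟩⟩
  let col : (μ → Fin d) → Fin d → ℝ := fun I i => mixtureTensor w a (Function.update I j i)
  -- All mode-`j` columns are combinations of the `R` factors, so `R` of them suffice to represent
  -- every column with coefficients in `[-1, 1]`.
  have hfin : Module.finrank ℝ (Submodule.span ℝ (Set.range col)) ≤ R := by
    have hle : Submodule.span ℝ (Set.range col) ≤ Submodule.span ℝ (Set.range (a j)) := by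
      rw [Submodule.span_le]
      rintro _ ⟨I, rfl⟩
      have : col I = ∑ r, (w r * ∏ j' ∈ Finset.univ.erase j, a j' r (I j')) • a j r := by
        funext i
        simp [col, mixtureTensor_update, Finset.sum_apply]
      rw [this]
      exact Submodule.sum_mem _ fun r _ =>
        Submodule.smul_mem _ _ (Submodule.subset_span ⟨r, rfl⟩)
    refine (Submodule.finrank_mono hle).trans ?_
    have := finrank_range_le_card (R := ℝ) (a j)
    simpa [Set.finrank] using this
  obtain ⟨s, hs⟩ := exists_bounded_spanning_family col hfin
  choose e he1 he using hs
  choose c hc1 hc using exists_column_coefficients hd ha hτ hk (by simpa using hkl) hγ hw j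
  refine ⟨s, fun t r => ∑ I, c r I * e I t, fun t r => ?_, fun r i => ?_⟩
  · refine (Finset.abs_sum_le_sum_abs _ _).trans ?_
    refine (Finset.sum_le_sum (g := fun _ => τ ^ Fintype.card μ / γ) fun I _ => ?_).trans
      (le_of_eq ?_)
    · rw [abs_mul]
      calc _ ≤ τ ^ Fintype.card μ / γ * 1 :=
            mul_le_mul (hc1 r I) (he1 I t) (abs_nonneg _) (by positivity)
        _ = _ := mul_one _
    · rw [Finset.sum_const, Finset.card_univ, Fintype.card_fun, Fintype.card_fin, nsmul_eq_mul]
      push_cast; ring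
  · rw [hc r i]
    have h1 : ∀ I, mixtureTensor w a (Function.update I j i)
        = ∑ t, e I t * mixtureTensor w a (Function.update (s t) j i) := fun I => by
      have := congrFun (he I) i
      simpa [col, Finset.sum_apply] using this
    simp_rw [Finset.sum_mul]
    rw [Finset.sum_comm]
    refine Finset.sum_congr rfl fun I _ => ?_
    rw [h1, Finset.mul_sum]
    exact Finset.sum_congr rfl fun t _ => by ring

/-! ### Candidate decompositions encoded by digits -/

/-- The truncation of a real number to `[-1, 1]`. -/
def clampUnit (y : ℝ) : ℝ := max (-1) (min 1 y)

theorem abs_clampUnit_le (y : ℝ) : |clampUnit y| ≤ 1 :=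
  abs_le.2 ⟨le_max_left _ _, max_le (by norm_num) (min_le_left _ _)⟩

theorem abs_clampUnit_sub_le {x : ℝ} (hx : |x| ≤ 1) (y : ℝ) : |clampUnit y - x| ≤ |y - x| := by
  obtain ⟨h1, h2⟩ := abs_le.1 hx
  rw [clampUnit, abs_le]
  constructor
  · rcases le_total y 1 with h | h
    · rw [min_eq_right h]
      have := le_max_right (-1) y
      have := neg_abs_le (y - x)
      linarith
    · rw [min_eq_left h]
      have := le_max_right (-1 : ℝ) 1
      have := abs_nonneg (y - x)
      linarith
  · rw [sub_le_iff_le_add]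
    refine max_le ?_ ((min_le_right _ _).trans ?_)
    · have := abs_nonneg (y - x)
      linarith
    · have := le_abs_self (y - x)
      linarith

/-- The position of the digit with coordinates `(t, r)` in block `A`. -/
def blockPos (R A t r : ℕ) : ℕ := A * (R * R) + t * R + r

variable {ℓ : ℕ}

/-- The coefficient of column `t` in component `r` of mode `j`. -/
def codeCoef (R L : ℕ) (B : ℝ) (dg : ℕ → ℕ) (j t r : ℕ) : ℝ :=
  (2 * (dg (blockPos R j t r) / L) - 1) * B

/-- The index in mode `m` of column `t` for mode `j`. -/
def codeIndex (ℓ n R : ℕ) (dg : ℕ → ℕ) (j t m : ℕ) : ℕ :=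
  min (dg (blockPos R (ℓ + j * ℓ + m) t 0)) n

/-- The weight of component `r`. -/
def codeWeight (ℓ R L : ℕ) (dg : ℕ → ℕ) (r : ℕ) : ℝ :=
  dg (blockPos R (ℓ + ℓ * ℓ) 0 r) / L

/-- Entry `i` of the factor of component `r` in mode `j`. -/
def codeFactor (n R L : ℕ) (B : ℝ) (That : (Fin ℓ → ℕ) → ℝ) (dg : ℕ → ℕ) (j : Fin ℓ) (r i : ℕ) :
    ℝ :=
  if i = 0 then 1 else clampUnit (∑ t ∈ Finset.range R, codeCoef R L B dg j t r *
    That (Function.update (fun m : Fin ℓ => codeIndex ℓ n R dg j t m) j i))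

/-- The decomposition encoded by the digits reproduces the tensor up to `ε`. -/
def CodePasses (n R L : ℕ) (B ε : ℝ) (That : (Fin ℓ → ℕ) → ℝ) (dg : ℕ → ℕ) : Prop :=
  ∀ I : Fin ℓ → ℕ, (∀ j, I j ≤ n) → |That I - ∑ r ∈ Finset.range R, codeWeight ℓ R L dg r *
    ∏ j, codeFactor n R L B That dg j r (I j)| ≤ ε

theorem exists_code {L D : ℕ} (dg : ℕ → ℕ) (h : ∀ p, dg p < L) :
    ∃ m < L ^ D, ∀ p < D, m / L ^ p % L = dg p := by
  induction D with
  | zero => exact ⟨0, by simp, by simp⟩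
  | succ D ih =>
    obtain ⟨m, hm, hmd⟩ := ih
    have hL : 0 < L := (Nat.zero_le _).trans_lt (h 0)
    refine ⟨m + L ^ D * dg D, ?_, fun p hp => ?_⟩
    · calc m + L ^ D * dg D < L ^ D + L ^ D * dg D := by omega
        _ = L ^ D * (dg D + 1) := by ring
        _ ≤ L ^ D * L := Nat.mul_le_mul_left _ (h D)
        _ = L ^ (D + 1) := by ring
    · rcases Nat.lt_succ_iff_lt_or_eq.1 hp with hp | rfl
      · obtain ⟨e, rfl⟩ : ∃ e, D = p + (e + 1) := ⟨D - p - 1, by omega⟩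
        have : m + L ^ (p + (e + 1)) * dg (p + (e + 1))
            = m + L ^ p * (L * (L ^ e * dg (p + (e + 1)))) := by ring
        rw [this, Nat.add_mul_div_left _ _ (by positivity), Nat.add_mul_mod_self_left]
        exact hmd p hp
      · rw [Nat.add_mul_div_left _ _ (by positivity), Nat.div_eq_of_lt hm, zero_add,
          Nat.mod_eq_of_lt (h p)]

theorem exists_digit {L : ℕ} (hL : 0 < L) {u : ℝ} (h0 : 0 ≤ u) (h1 : u ≤ 1) :
    ∃ q < L, |(q : ℝ) / L - u| ≤ 1 / L := by
  have hL' : (0 : ℝ) < L := by exact_mod_cast hL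
  have e : ∀ q : ℝ, |q / L - u| = |q - u * L| / L := fun q => by
    rw [← abs_of_pos hL', ← abs_div, abs_of_pos hL', sub_div, mul_div_assoc, div_self hL'.ne',
      mul_one]
  rcases h1.lt_or_eq with h1 | rfl
  · refine ⟨⌊u * L⌋₊, ?_, ?_⟩
    · rw [Nat.floor_lt (by positivity)]; nlinarith
    · rw [e]
      refine div_le_div_of_nonneg_right ?_ hL'.le
      have h2 := Nat.floor_le (show 0 ≤ u * L by positivity)
      have h3 := Nat.lt_floor_add_one (u * L)
      rw [abs_le]; constructor <;> linarith
  -- For `u = 1` the floor is `L`, which is not a digit; `L - 1` is still within `1 / L`.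
  · refine ⟨L - 1, by omega, ?_⟩
    rw [e, Nat.cast_sub (by omega)]
    refine div_le_div_of_nonneg_right ?_ hL'.le
    simp

theorem exists_coef_digit {L : ℕ} (hL : 0 < L) {B c : ℝ} (hB : 0 < B) (hc : |c| ≤ B) :
    ∃ q < L, |(2 * ((q : ℝ) / L) - 1) * B - c| ≤ 2 * B / L := by
  obtain ⟨h1, h2⟩ := abs_le.1 hc
  have h3 : -1 ≤ c / B := by rw [le_div_iff₀ hB]; linarith
  have h4 : c / B ≤ 1 := by rw [div_le_iff₀ hB]; linarith
  obtain ⟨q, hq, hqu⟩ := exists_digit hL (u := (c / B + 1) / 2) (by linarith) (by linarith)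
  refine ⟨q, hq, ?_⟩
  have e : (2 * ((q : ℝ) / L) - 1) * B - c = (2 * B) * ((q : ℝ) / L - (c / B + 1) / 2) := by
    field_simp; ring
  rw [e, abs_mul, abs_of_pos (by positivity)]
  calc _ ≤ 2 * B * (1 / L) := mul_le_mul_of_nonneg_left hqu (by positivity)
    _ = _ := by ring

theorem blockPos_decode {R A t r : ℕ} (ht : t < R) (hr : r < R) :
    blockPos R A t r / (R * R) = A ∧ blockPos R A t r / R % R = t ∧ blockPos R A t r % R = r := by
  have hR : 0 < R := by omega
  have e : blockPos R A t r = r + R * (t + R * A) := by rw [blockPos]; ring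
  have e1 : blockPos R A t r / R = t + R * A := by
    rw [e, Nat.add_mul_div_left _ _ hR, Nat.div_eq_of_lt hr, zero_add]
  refine ⟨?_, ?_, ?_⟩
  · rw [← Nat.div_div_eq_div_mul, e1, Nat.add_mul_div_left _ _ hR, Nat.div_eq_of_lt ht, zero_add]
  · rw [e1, Nat.add_mul_mod_self_left, Nat.mod_eq_of_lt ht]
  · rw [e, Nat.add_mul_mod_self_left, Nat.mod_eq_of_lt hr]

theorem blockPos_lt {R A A₀ t r : ℕ} (ht : t < R) (hr : r < R) (hA : A < A₀) :
    blockPos R A t r < A₀ * (R * R) := by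
  have h1 := (blockPos_decode (A := A) ht hr).1
  have hR : 0 < R * R := Nat.mul_pos (by omega) (by omega)
  rw [← h1] at hA
  rwa [Nat.div_lt_iff_lt_mul hR] at hA

theorem abs_codeFactor_le (n R L : ℕ) (B : ℝ) (That : (Fin ℓ → ℕ) → ℝ) (dg : ℕ → ℕ) (j : Fin ℓ)
    (r i : ℕ) : |codeFactor n R L B That dg j r i| ≤ 1 := by
  rw [codeFactor]
  split_ifs
  · simp
  · exact abs_clampUnit_le _

/-- A normalised mixture with all parameters bounded by `G`. -/
structure IsBoundedMixture (n R k : ℕ) (τ γ G : ℝ) (w : Fin R → ℝ)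
    (a : Fin ℓ → Fin R → Fin (n + 1) → ℝ) : Prop where
  indep : ∀ j, RobustIndep k τ
    fun r => (WithLp.toLp 2 (a j r) : EuclideanSpace ℝ (Fin (n + 1)))
  two_le : 2 ≤ k
  le_card : k ≤ R
  two_mul_le : 2 * R ≤ ℓ * (k - 1)
  one_le_τ : 1 ≤ τ
  τ_le : τ ≤ G
  γ_pos : 0 < γ
  γ_le : 1 / γ ≤ G
  le_weight : ∀ r, γ ≤ w r
  weight_le : ∀ r, w r ≤ 1
  sum_weight : ∑ r, w r = 1
  abs_le : ∀ j r i, |a j r i| ≤ 1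
  zero : ∀ j r, a j r 0 = 1
  four_le : 4 ≤ G
  dim_le : (n : ℝ) + 1 ≤ G
  card_le : (R : ℝ) ≤ G
  order_le : (ℓ : ℝ) ≤ G

/-! ### Passing codes are correct, and an accurate empirical tensor has a passing code -/

namespace IsBoundedMixture

variable {n R k : ℕ} {τ γ G : ℝ} {w : Fin R → ℝ} {a : Fin ℓ → Fin R → Fin (n + 1) → ℝ}

theorem one_le_G (h : IsBoundedMixture n R k τ γ G w a) : 1 ≤ G := by
  linarith [h.four_le]

theorem abs_tensor_le (h : IsBoundedMixture n R k τ γ G w a) (I : Fin ℓ → Fin (n + 1)) :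
    |mixtureTensor w a I| ≤ 1 := by
  refine (Finset.abs_sum_le_sum_abs _ _).trans ?_
  rw [← h.sum_weight]
  refine Finset.sum_le_sum fun r _ => ?_
  have hw : 0 ≤ w r := h.γ_pos.le.trans (h.le_weight r)
  rw [abs_mul, abs_of_nonneg hw, Finset.abs_prod]
  exact mul_le_of_le_one_right hw (Finset.prod_le_one (fun _ _ => abs_nonneg _)
    fun j _ => h.abs_le j r _)

/-- Any decomposition that reproduces the tensor is close to the true one. -/
theorem exists_perm_of_codePasses (h : IsBoundedMixture n R k τ γ G w a) {L : ℕ} {B ε : ℝ}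
    {That : (Fin ℓ → ℕ) → ℝ} {dg : ℕ → ℕ} (hdg : ∀ p, dg p ≤ L)
    (hT : ∀ I : Fin ℓ → Fin (n + 1), |That (fun j => I j) - mixtureTensor w a I| ≤ ε)
    (hpass : CodePasses n R L B ε That dg) (hε : ε ≤ (G ^ (9 * ℓ + 41))⁻¹) :
    ∃ π : Equiv.Perm (Fin R), ∀ r,
      (∀ j i, |a j r i - codeFactor n R L B That dg j (π r) (i : Fin (n + 1))| ≤ (G ^ 10)⁻¹) ∧
      |w r - codeWeight ℓ R L dg (π r)| ≤ (G ^ 10)⁻¹ := by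
  set b : Fin ℓ → Fin R → Fin (n + 1) → ℝ := fun j r i => codeFactor n R L B That dg j r i with hb
  set v : Fin R → ℝ := fun r => codeWeight ℓ R L dg r with hv
  have hG0 : 0 < G := by linarith [h.four_le]
  have hG1 := h.one_le_G
  have hε0 : 0 ≤ ε := (abs_nonneg _).trans (hT 0)
  have hclose : ∀ I : Fin ℓ → Fin (n + 1),
      |∑ r, w r * ∏ j, a j r (I j) - ∑ s, v s * ∏ j, b j s (I j)| ≤ 2 * ε := by
    intro I
    have h1 := hT I
    have h2 := hpass (fun j => I j) fun j => Nat.lt_succ_iff.1 (I j).2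
    rw [Finset.sum_range fun r => codeWeight ℓ R L dg r *
      ∏ j, codeFactor n R L B That dg j r (I j)] at h2
    rw [abs_sub_comm] at h1
    have := (abs_sub_le (mixtureTensor w a I) (That fun j => I j)
      (∑ s, v s * ∏ j, b j s (I j))).trans (add_le_add h1 h2)
    rw [two_mul]
    exact this
  have htc := tensorClose_of_entries hclose
  rw [Fintype.card_fin] at htc
  set ε' := ((n + 1 : ℕ) : ℝ) ^ ℓ * (2 * ε) with hε'
  have hdim : ((n + 1 : ℕ) : ℝ) ≤ G := by push_cast; exact h.dim_le
  -- The passage from entries to the norm and the factor 2 cost `G ^ (ℓ + 1)`, whence the exponent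
  -- `9 * ℓ + 41` of the tolerance. The rest covers the loss `G ^ (8 * ℓ + 30)` in robust uniqueness
  -- and leaves `G ^ 10`.
  have hε'G : G ^ (8 * ℓ + 40) * ε' ≤ 1 := by
    have h2 : (2 : ℝ) ≤ G := by linarith [h.four_le]
    calc G ^ (8 * ℓ + 40) * ε'
        ≤ G ^ (8 * ℓ + 40) * (G ^ ℓ * (G * (G ^ (9 * ℓ + 41))⁻¹)) := by rw [hε']; gcongr
      _ = G ^ (9 * ℓ + 41) * (G ^ (9 * ℓ + 41))⁻¹ := by ring
      _ = 1 := mul_inv_cancel₀ (by positivity)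
  have hε'0 : 0 ≤ ε' := by positivity
  have hin : ∀ u : Fin (n + 1) → ℝ, inner ℝ (EuclideanSpace.single (0 : Fin (n + 1)) (1 : ℝ))
      (WithLp.toLp 2 u : EuclideanSpace ℝ (Fin (n + 1))) = u 0 := fun u => by
    rw [EuclideanSpace.inner_single_left]; simp
  obtain ⟨π, hπ⟩ := htc.exists_perm (k := k) (τ := τ) (γ := γ) (B := G) (G := G)
    h.indep h.two_le (by simpa using h.le_card) (by simpa using h.two_mul_le) h.one_le_τ hG1
    h.γ_pos hε'0 h.le_weight
    (fun s => by
      rw [hv]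
      simp only [codeWeight]
      rw [abs_of_nonneg (by positivity)]
      exact div_le_one_of_le₀ (by exact_mod_cast hdg _) (by positivity))
    (fun j s => (norm_toLp_le fun i => abs_codeFactor_le _ _ _ _ _ _ _ _ _).trans hdim)
    -- The normalising functional reads coordinate 0, which is 1 for true and coded factors alike.
    (e := EuclideanSpace.single (0 : Fin (n + 1)) (1 : ℝ)) (by simp)
    (fun j r => by rw [hin, h.zero]) (fun j r => by rw [hin]; simp [hb, codeFactor])
    h.four_le h.τ_le le_rfl h.γ_le (by simpa using h.card_le) (by simpa using h.order_le)
    (by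
      rw [Fintype.card_fin]
      refine le_trans (mul_le_mul_of_nonneg_right (pow_le_pow_right₀ hG1 ?_) hε'0) hε'G
      omega)
  have hfin : G ^ (8 * Fintype.card (Fin ℓ) + 30) * ε' ≤ (G ^ 10)⁻¹ := by
    rw [Fintype.card_fin, ← one_div, le_div_iff₀ (by positivity)]
    calc _ = G ^ (8 * ℓ + 40) * ε' := by ring
      _ ≤ 1 := hε'G
  refine ⟨π, fun r => ⟨fun j i => ?_, (hπ r).2.trans hfin⟩⟩
  have h1 := PiLp.norm_apply_le ((WithLp.toLp 2 (a j r) : EuclideanSpace ℝ (Fin (n + 1)))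
    - WithLp.toLp 2 (b j (π r))) i
  exact (h1.trans ((hπ r).1 j)).trans hfin

/-- Some code reproduces the empirical tensor. -/
theorem exists_codePasses (h : IsBoundedMixture n R k τ γ G w a) {L : ℕ} {ε₀ : ℝ}
    {That : (Fin ℓ → ℕ) → ℝ}
    (hT : ∀ I : Fin ℓ → Fin (n + 1), |That (fun j => I j) - mixtureTensor w a I| ≤ ε₀)
    (hε₀ : ε₀ ≤ (G ^ (12 * ℓ + 50))⁻¹) (hL : G ^ (12 * ℓ + 50) ≤ L) :
    ∃ m < L ^ ((ℓ + ℓ * ℓ + 1) * (R * R)),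
      CodePasses n R L (G ^ (2 * ℓ + 1)) (G ^ (9 * ℓ + 41))⁻¹ That fun p => m / L ^ p % L := by
  have hG0 : 0 < G := by linarith [h.four_le]
  have hG1 := h.one_le_G
  have hε₀0 : 0 ≤ ε₀ := (abs_nonneg _).trans (hT 0)
  set B := G ^ (2 * ℓ + 1) with hB
  have hB0 : 0 < B := by positivity
  have hLpos : (0 : ℝ) < L := lt_of_lt_of_le (by positivity) hL
  have hL0 : 0 < L := by exact_mod_cast hLpos
  have hR2 : 2 ≤ R := h.two_le.trans h.le_card
  have hnL : n < L := by
    have : (n : ℝ) + 1 ≤ L := h.dim_le.trans ((le_self_pow₀ hG1 (by omega)).trans hL)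
    exact_mod_cast this
  -- One mode is left free. The loss of `k - 1` is harmless since `2 * R ≤ ℓ * (k - 1)` and `k - 1 <
  -- R`.
  have hkl : R ≤ (Fintype.card (Fin ℓ) - 1) * (k - 1) := by
    rw [Fintype.card_fin]
    have h1 := h.two_mul_le
    have h2 := h.le_card
    obtain ⟨m, hm⟩ : ∃ m, k = m + 1 := ⟨k - 1, by have := h.two_le; omega⟩
    subst hm
    simp only [Nat.add_sub_cancel] at h1 ⊢
    rcases ℓ with - | p
    · omega
    · simp only [Nat.add_sub_cancel]
      have : (p + 1) * m = p * m + m := by ring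
      omega
  choose s C hC hrep using exists_column_representation (Nat.succ_pos n) h.indep h.one_le_τ
    h.two_le hkl h.γ_pos h.le_weight
  have hCB : ∀ j t r, |C j t r| ≤ B := fun j t r => by
    refine (hC j t r).trans ?_
    have hdim : ((n + 1 : ℕ) : ℝ) ≤ G := by push_cast; exact h.dim_le
    have hτ0 : 0 ≤ τ := by linarith [h.one_le_τ]
    rw [Fintype.card_fin, div_eq_mul_one_div]
    have hγ := h.γ_pos
    calc _ ≤ G ^ ℓ * (G ^ ℓ * G) := by
          gcongr
          · exact h.τ_le
          · exact h.γ_le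
      _ = B := by rw [hB]; ring
  choose qC hqC hqCa using fun j t r => exists_coef_digit hL0 hB0 (hCB j t r)
  choose qw hqw hqwa using fun r => exists_digit hL0
    (h.γ_pos.le.trans (h.le_weight r)) (h.weight_le r)
  -- the digits
  let dg : ℕ → ℕ := fun p =>
    let A := p / (R * R)
    let t := p / R % R
    let r := p % R
    if ht : t < R ∧ r < R then
      if hA : A < ℓ then qC ⟨A, hA⟩ ⟨t, ht.1⟩ ⟨r, ht.2⟩
      else if hA' : (A - ℓ) / ℓ < ℓ ∧ (A - ℓ) % ℓ < ℓ then
        s ⟨_, hA'.1⟩ ⟨t, ht.1⟩ ⟨_, hA'.2⟩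
      else qw ⟨r, ht.2⟩
    else 0
  have hdgL : ∀ p, dg p < L := by
    intro p
    simp only [dg]
    split_ifs
    · exact hqC _ _ _
    · exact lt_of_le_of_lt (Nat.lt_succ_iff.1 (Fin.is_lt _)) hnL
    · exact hqw _
    · exact hL0
  obtain ⟨m, hm, hmd⟩ := exists_code (D := (ℓ + ℓ * ℓ + 1) * (R * R)) dg hdgL
  have hdec : ∀ A < ℓ + ℓ * ℓ + 1, ∀ t < R, ∀ r < R,
      m / L ^ blockPos R A t r % L = dg (blockPos R A t r) := fun A hA t ht r hr =>
    hmd _ (blockPos_lt ht hr hA)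
  refine ⟨m, hm, ?_⟩
  set dg' : ℕ → ℕ := fun p => m / L ^ p % L with hdg'
  have hcoef : ∀ (j : Fin ℓ) (t r : Fin R),
      |codeCoef R L B dg' j t r - C j t r| ≤ 2 * B / L := by
    intro j t r
    have h1 : dg' (blockPos R j t r) = qC j t r := by
      rw [hdg']
      simp only
      rw [hdec j (by omega) t t.2 r r.2]
      obtain ⟨e1, e2, e3⟩ := blockPos_decode (A := (j : ℕ)) t.2 r.2
      simp only [dg, e1, e2, e3]
      simp
    rw [codeCoef, h1]
    exact hqCa j t r
  have hindex : ∀ (j : Fin ℓ) (t : Fin R) (m' : Fin ℓ),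
      codeIndex ℓ n R dg' j t m' = s j t m' := by
    intro j t m'
    have hℓ : 0 < ℓ := j.pos
    have h1 : dg' (blockPos R (ℓ + j * ℓ + m') t 0) = s j t m' := by
      rw [hdg']
      simp only
      have hlt : (j : ℕ) * ℓ + m' < ℓ * ℓ := by
        calc (j : ℕ) * ℓ + m' < j * ℓ + ℓ := by omega
          _ = (j + 1) * ℓ := by ring
          _ ≤ ℓ * ℓ := Nat.mul_le_mul_right _ j.2
      rw [hdec _ (by omega) t t.2 0 (by omega)]
      obtain ⟨e1, e2, e3⟩ := blockPos_decode (A := ℓ + j * ℓ + m') t.2 (show 0 < R by omega)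
      have f1 : (ℓ + j * ℓ + m' - ℓ) / ℓ = j := by
        rw [show ℓ + j * ℓ + m' - ℓ = m' + ℓ * j by rw [mul_comm]; omega,
          Nat.add_mul_div_left _ _ hℓ, Nat.div_eq_of_lt m'.2, zero_add]
      have f2 : (ℓ + j * ℓ + m' - ℓ) % ℓ = m' := by
        rw [show ℓ + j * ℓ + m' - ℓ = m' + ℓ * j by rw [mul_comm]; omega,
          Nat.add_mul_mod_self_left, Nat.mod_eq_of_lt m'.2]
      have hnot : ¬ ℓ + j * ℓ + m' < ℓ := by omega
      have hR0 : 0 < R := by omega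
      simp only [dg, e1, e2, e3, f1, f2]
      simp [hnot, hR0]
    rw [codeIndex, h1]
    exact min_eq_left (Nat.lt_succ_iff.1 (Fin.is_lt _))
  have hweight : ∀ r : Fin R, |codeWeight ℓ R L dg' r - w r| ≤ 1 / L := by
    intro r
    have h1 : dg' (blockPos R (ℓ + ℓ * ℓ) 0 r) = qw r := by
      rw [hdg']
      simp only
      have hR0 : 0 < R := by omega
      rw [hdec _ (by omega) 0 hR0 r r.2]
      obtain ⟨e1, e2, e3⟩ := blockPos_decode (A := ℓ + ℓ * ℓ) hR0 r.2
      have hnot : ¬ ℓ + ℓ * ℓ < ℓ := by omega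
      have hnot' : ¬ ((ℓ + ℓ * ℓ - ℓ) / ℓ < ℓ) := by
        rw [show ℓ + ℓ * ℓ - ℓ = ℓ * ℓ by omega]
        rcases Nat.eq_zero_or_pos ℓ with h0 | h0
        · simp [h0]
        · rw [Nat.mul_div_cancel _ h0]; omega
      simp only [dg, e1, e2, e3]
      simp [hR0]
      intro hp
      rw [show ℓ + ℓ * ℓ - ℓ = ℓ * ℓ by omega] at hnot'
      exact absurd hp hnot'
    rw [codeWeight, h1]
    exact hqwa r
  -- the errors
  set X := (G ^ (12 * ℓ + 50))⁻¹ with hX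
  have hX0 : 0 < X := by positivity
  have hLX : 1 / (L : ℝ) ≤ X := by
    rw [hX, one_div]
    exact inv_anti₀ (by positivity) hL
  have hX1 : X ≤ 1 := inv_le_one_of_one_le₀ (one_le_pow₀ hG1)
  have h4 := h.four_le
  -- The code combines columns of the empirical tensor, not of the true one. In each column,
  -- rounding the coefficient contributes `4 * B * X` and the sampling error `B * X`. Truncation to
  -- `[-1, 1]` does no harm because the true entries lie there.
  have hfactor : ∀ (j : Fin ℓ) (r : Fin R) (i : Fin (n + 1)),
      |codeFactor n R L B That dg' j r i - a j r i| ≤ G ^ (2 * ℓ + 4) * X := by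
    intro j r i
    rw [codeFactor]
    split_ifs with hi
    · have : i = 0 := Fin.ext hi
      rw [this, h.zero, sub_self, abs_zero]; positivity
    refine (abs_clampUnit_sub_le (h.abs_le j r i) _).trans ?_
    rw [hrep j r i, Finset.sum_range fun t => codeCoef R L B dg' j t r *
      That (Function.update (fun m : Fin ℓ => codeIndex ℓ n R dg' j t m) j i),
      ← Finset.sum_sub_distrib]
    refine (Finset.abs_sum_le_sum_abs _ _).trans ?_
    have hterm : ∀ t ∈ (Finset.univ : Finset (Fin R)), |codeCoef R L B dg' j t r *
        That (Function.update (fun m : Fin ℓ => codeIndex ℓ n R dg' j t m) j i)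
        - C j t r * mixtureTensor w a (Function.update (s j t) j i)| ≤ (5 * B) * X := by
      intro t _
      have e1 : Function.update (fun m : Fin ℓ => codeIndex ℓ n R dg' j t m) j (i : ℕ)
          = fun m => ((Function.update (s j t) j i m : Fin (n + 1)) : ℕ) := by
        funext m'
        by_cases hm' : m' = j
        · subst hm'; simp
        · rw [Function.update_of_ne hm', Function.update_of_ne hm']
          exact hindex j t m'
      rw [e1]
      have h1 := (hT (Function.update (s j t) j i)).trans hε₀
      have h2 := (hcoef j t r)
      have h3 := h.abs_tensor_le (Function.update (s j t) j i)
      set u := That fun m => ((Function.update (s j t) j i m : Fin (n + 1)) : ℕ)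
      set u' := mixtureTensor w a (Function.update (s j t) j i)
      have hu : |u| ≤ 2 := by
        have := abs_sub_abs_le_abs_sub u u'
        linarith
      have h2' : |codeCoef R L B dg' j t r - C j t r| ≤ 2 * B * X := by
        refine h2.trans ?_
        rw [div_eq_mul_one_div]
        exact mul_le_mul_of_nonneg_left hLX (by positivity)
      have e2 : codeCoef R L B dg' j t r * u - C j t r * u'
          = (codeCoef R L B dg' j t r - C j t r) * u + C j t r * (u - u') := by ring
      rw [e2]
      refine (abs_add_le _ _).trans ?_
      rw [abs_mul, abs_mul]
      calc _ ≤ 2 * B * X * 2 + B * X := by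
            gcongr
            exact hCB j t r
        _ = _ := by ring
    refine (Finset.sum_le_sum hterm).trans ?_
    rw [Finset.sum_const, Finset.card_univ, Fintype.card_fin, nsmul_eq_mul]
    have h5 : (5 : ℝ) ≤ G ^ 2 := by nlinarith
    calc _ ≤ G * (G ^ 2 * B * X) := by
          gcongr
          exact h.card_le
      _ = _ := by rw [hB]; ring
  intro I hI
  let I' : Fin ℓ → Fin (n + 1) := fun j => ⟨I j, Nat.lt_succ_iff.2 (hI j)⟩
  have h1 : |That I - mixtureTensor w a I'| ≤ X := (hT I').trans hε₀
  have h2 : |mixtureTensor w a I' - ∑ r ∈ Finset.range R, codeWeight ℓ R L dg' r *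
      ∏ j, codeFactor n R L B That dg' j r (I j)| ≤ G ^ (2 * ℓ + 7) * X := by
    rw [Finset.sum_range, mixtureTensor, ← Finset.sum_sub_distrib]
    refine (Finset.abs_sum_le_sum_abs _ _).trans ?_
    have hterm : ∀ r ∈ (Finset.univ : Finset (Fin R)), |w r * ∏ j, a j r (I' j)
        - codeWeight ℓ R L dg' r * ∏ j, codeFactor n R L B That dg' j r (I j)|
        ≤ G ^ (2 * ℓ + 6) * X := by
      intro r _
      have h3 : |∏ j, a j r (I' j) - ∏ j, codeFactor n R L B That dg' j r (I j)|
          ≤ ℓ * (G ^ (2 * ℓ + 4) * X) := by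
        have := abs_prod_sub_prod_le Finset.univ (fun j => a j r (I' j))
          (fun j => codeFactor n R L B That dg' j r (I j)) le_rfl
          (show 0 ≤ G ^ (2 * ℓ + 4) * X by positivity) (fun j _ => h.abs_le _ _ _)
          (fun j _ => abs_codeFactor_le _ _ _ _ _ _ _ _ _)
          (fun j _ => by
            rw [abs_sub_comm]
            exact hfactor j r (I' j))
        simpa using this
      have h5 : |∏ j, codeFactor n R L B That dg' j r (I j)| ≤ 1 := by
        rw [Finset.abs_prod]
        exact Finset.prod_le_one (fun _ _ => abs_nonneg _)
          fun j _ => abs_codeFactor_le _ _ _ _ _ _ _ _ _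
      have hw : |w r| ≤ 1 := by
        rw [_root_.abs_of_nonneg (h.γ_pos.le.trans (h.le_weight r))]; exact h.weight_le r
      have hwt := (hweight r).trans hLX
      rw [abs_sub_comm] at hwt
      have e2 : w r * ∏ j, a j r (I' j)
          - codeWeight ℓ R L dg' r * ∏ j, codeFactor n R L B That dg' j r (I j)
          = w r * (∏ j, a j r (I' j) - ∏ j, codeFactor n R L B That dg' j r (I j))
            + (w r - codeWeight ℓ R L dg' r) * ∏ j, codeFactor n R L B That dg' j r (I j) := by
        ring
      rw [e2]
      refine (abs_add_le _ _).trans ?_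
      rw [abs_mul, abs_mul]
      have h6 : (1 : ℝ) ≤ G ^ (2 * ℓ + 5) := one_le_pow₀ hG1
      calc _ ≤ 1 * (G * (G ^ (2 * ℓ + 4) * X)) + X * 1 := by
            gcongr
            refine h3.trans ?_
            gcongr
            exact h.order_le
        _ ≤ 2 * (G ^ (2 * ℓ + 5) * X) := by
            have : X ≤ G ^ (2 * ℓ + 5) * X := le_mul_of_one_le_left hX0.le h6
            have e3 : G * (G ^ (2 * ℓ + 4) * X) = G ^ (2 * ℓ + 5) * X := by ring
            rw [e3]; linarith
        _ ≤ G * (G ^ (2 * ℓ + 5) * X) := by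
            gcongr
            linarith
        _ = _ := by ring
    refine (Finset.sum_le_sum hterm).trans ?_
    rw [Finset.sum_const, Finset.card_univ, Fintype.card_fin, nsmul_eq_mul]
    calc _ ≤ G * (G ^ (2 * ℓ + 6) * X) := by
          gcongr
          exact h.card_le
      _ = _ := by ring
  refine (abs_sub_le _ (mixtureTensor w a I') _).trans ((add_le_add h1 h2).trans ?_)
  have h6 : (1 : ℝ) ≤ G ^ (2 * ℓ + 7) := one_le_pow₀ hG1
  have h7 : X ≤ G ^ (2 * ℓ + 7) * X := le_mul_of_one_le_left hX0.le h6
  -- Error times inverse tolerance is at most `G ^ (11 * ℓ + 49) * X`, and `X` is the inverse of `G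
  -- ^ (12 * ℓ + 50)`.
  rw [← one_div, le_div_iff₀ (by positivity)]
  calc (X + G ^ (2 * ℓ + 7) * X) * G ^ (9 * ℓ + 41)
      ≤ (G * (G ^ (2 * ℓ + 7) * X)) * G ^ (9 * ℓ + 41) := by
        gcongr
        have : 0 ≤ G ^ (2 * ℓ + 7) * X := by positivity
        nlinarith
    _ = G ^ (11 * ℓ + 49) * X := by ring
    _ ≤ G ^ (12 * ℓ + 50) * X :=
        mul_le_mul_of_nonneg_right (pow_le_pow_right₀ hG1 (by omega)) hX0.le
    _ = 1 := mul_inv_cancel₀ (by positivity)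

end IsBoundedMixture

/-! ### Concentration of the empirical tensor -/

/-- The empirical moment tensor of the normalised and augmented samples. -/
def empiricalTensor {ℓ n N : ℕ} (c : ℝ) (s : Fin N → Fin ℓ → Fin n → ℝ)
    (I : Fin ℓ → Fin (n + 1)) : ℝ :=
  (∑ t, ∏ j, augment c (s t j) (I j)) / N

theorem measurable_augment {n : ℕ} (c : ℝ) (i : Fin (n + 1)) :
    Measurable fun u : Fin n → ℝ => augment c u i := by
  refine Fin.cases ?_ (fun i => ?_) i
  · simp only [augment_zero]; exact measurable_const
  · simp only [augment_succ]; fun_prop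

theorem abs_augment_le {n : ℕ} {c : ℝ} (hc : 0 < c) {u : Fin n → ℝ} (hu : ∀ i, |u i| ≤ c)
    (i : Fin (n + 1)) : |augment c u i| ≤ 1 := by
  refine Fin.cases ?_ (fun i => ?_) i
  · simp
  · rw [augment_succ, abs_div, abs_of_pos hc]
    exact div_le_one_of_le₀ (hu i) hc.le

namespace IsMultiViewMixture

variable {Ω : Type*} [MeasurableSpace Ω] {P : Measure Ω} {ℓ n R : ℕ} {h : Ω → Fin R}
  {x : Fin ℓ → Ω → (Fin n → ℝ)} {w : Fin R → ℝ} {M : Fin ℓ → Matrix (Fin n) (Fin R) ℝ} {c : ℝ}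

theorem sum_weight (hm : IsMultiViewMixture P h x w M c) : ∑ r, w r = 1 := by
  have := hm.isProbabilityMeasure
  have h1 := sum_measureReal_preimage_singleton (μ := P) (f := h) Finset.univ
    (fun r _ => hm.measurable_latent (measurableSet_singleton r))
  simp only [Finset.coe_univ, Set.preimage_univ, probReal_univ] at h1
  rw [← h1]
  exact Finset.sum_congr rfl fun r _ => (hm.weight r).symm

theorem ae_cond_bounded (hm : IsMultiViewMixture P h x w M c) (r : Fin R) (j : Fin ℓ) :
    ∀ᵐ ω ∂P[|h ⁻¹' {r}], ∀ i, |x j ω i| ≤ c :=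
  cond_absolutelyContinuous.ae_le (hm.bounded j)

theorem measure_ne_zero (hm : IsMultiViewMixture P h x w M c) {r : Fin R} (hw : 0 < w r) :
    P (h ⁻¹' {r}) ≠ 0 := by
  intro h0
  have := hm.weight r
  rw [measureReal_def, h0] at this
  simp at this
  exact hw.ne this

theorem abs_mean_le (hm : IsMultiViewMixture P h x w M c) {r : Fin R} (hw : 0 < w r)
    (j : Fin ℓ) (i : Fin n) : |M j i r| ≤ c := by
  have := hm.isProbabilityMeasure
  have hne := hm.measure_ne_zero hw
  have := cond_isProbabilityMeasure hne
  rw [← hm.mean r hne j i]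
  have := norm_integral_le_of_norm_le_const (μ := P[|h ⁻¹' {r}]) (f := fun ω => x j ω i) (C := c)
    ((hm.ae_cond_bounded r j).mono fun ω hω => hω i)
  simpa using this

/-- Split `P` according to the value of `h`. Under each conditional law the views are independent,
so the expectation of the product is the product of the conditional means. -/
theorem integral_prod_augment (hm : IsMultiViewMixture P h x w M c) (hc : 0 < c)
    (hw : ∀ r, 0 < w r) (I : Fin ℓ → Fin (n + 1)) :
    ∫ ω, ∏ j, augment c (x j ω) (I j) ∂P
      = mixtureTensor w (fun j r => augment c fun i => M j i r) I := by
  have := hm.isProbabilityMeasure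
  have hmeas : Measurable fun ω => ∏ j, augment c (x j ω) (I j) :=
    Finset.measurable_prod _ fun j _ => (measurable_augment c (I j)).comp (hm.measurable_view j)
  have hbdd : ∀ᵐ ω ∂P, |∏ j, augment c (x j ω) (I j)| ≤ 1 := by
    have := (ae_all_iff.2 hm.bounded)
    filter_upwards [this] with ω hω
    rw [Finset.abs_prod]
    exact Finset.prod_le_one (fun _ _ => abs_nonneg _) fun j _ => abs_augment_le hc (hω j) _
  have hInt : Integrable (fun ω => ∏ j, augment c (x j ω) (I j)) P :=
    Integrable.of_bound hmeas.aestronglyMeasurable 1 hbdd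
  conv_lhs => rw [← sum_meas_smul_cond_fiber hm.measurable_latent P]
  rw [integral_finsetSum_measure]
  · refine Finset.sum_congr rfl fun r _ => ?_
    rw [integral_smul_measure, smul_eq_mul, ← measureReal_def, hm.weight r]
    congr 1
    have hne := hm.measure_ne_zero (hw r)
    have := cond_isProbabilityMeasure hne
    rw [(hm.condIndep r hne).integral_fun_prod_comp
      (f := fun j u => augment c u (I j))
      (fun j => (hm.measurable_view j).aemeasurable)
      (fun j => (measurable_augment c (I j)).aestronglyMeasurable)]
    refine Finset.prod_congr rfl fun j _ => ?_
    refine Fin.cases ?_ (fun i => ?_) (I j)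
    · simp
    · simp only [augment_succ]
      rw [integral_div, hm.mean r hne j i]
  · intro r _
    refine Integrable.smul_measure ?_ (measure_ne_top _ _)
    refine Integrable.of_bound hmeas.aestronglyMeasurable 1 ?_
    exact cond_absolutelyContinuous.ae_le hbdd

/-- Chebyshev's inequality for a sum of `N` independent copies of a variable with values in `[-1,
1]`, whose variance is at most 1. -/
theorem sampleLaw_deviation_le (hm : IsMultiViewMixture P h x w M c) (hc : 0 < c)
    (hw : ∀ r, 0 < w r) {N : ℕ} (hN : 0 < N) {ε : ℝ} (hε : 0 < ε) (I : Fin ℓ → Fin (n + 1)) :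
    sampleLaw P x N {s | ε ≤ |empiricalTensor c s I
      - mixtureTensor w (fun j r => augment c fun i => M j i r) I|}
      ≤ ENNReal.ofReal (1 / (N * ε ^ 2)) := by
  have := hm.isProbabilityMeasure
  have hN' : (0 : ℝ) < N := by exact_mod_cast hN
  have hxm : Measurable fun ω j => x j ω := measurable_pi_lambda _ hm.measurable_view
  set ν := P.map fun ω j => x j ω with hν
  have : IsProbabilityMeasure ν := Measure.isProbabilityMeasure_map hxm.aemeasurable
  set f : (Fin ℓ → Fin n → ℝ) → ℝ := fun y => ∏ j, augment c (y j) (I j) with hf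
  have hfm : Measurable f := Finset.measurable_prod _ fun j _ =>
    (measurable_augment c (I j)).comp (measurable_pi_apply j)
  have hfb : ∀ᵐ y ∂ν, |f y| ≤ 1 := by
    rw [hν, ae_map_iff hxm.aemeasurable (measurableSet_le (by fun_prop) measurable_const)]
    filter_upwards [ae_all_iff.2 hm.bounded] with ω hω
    rw [hf, Finset.abs_prod]
    exact Finset.prod_le_one (fun _ _ => abs_nonneg _) fun j _ => abs_augment_le hc (hω j) _
  have hfL : MemLp f 2 ν := MemLp.of_bound hfm.aestronglyMeasurable 1 hfb
  have hmean : ∫ y, f y ∂ν = mixtureTensor w (fun j r => augment c fun i => M j i r) I := by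
    rw [hν, integral_map hxm.aemeasurable hfm.aestronglyMeasurable]
    exact hm.integral_prod_augment hc hw I
  set S : (Fin N → Fin ℓ → Fin n → ℝ) → ℝ := ∑ t, fun s => f (s t) with hS
  have hSL : MemLp S 2 (Measure.pi fun _ : Fin N => ν) := by
    rw [hS]
    exact memLp_finsetSum' _ fun t _ =>
      hfL.comp_measurePreserving (measurePreserving_eval (fun _ : Fin N => ν) t)
  have hSmean : ∫ s, S s ∂(Measure.pi fun _ : Fin N => ν)
      = N * mixtureTensor w (fun j r => augment c fun i => M j i r) I := by
    have h1 : ∀ t : Fin N, ∫ s, f (s t) ∂(Measure.pi fun _ : Fin N => ν) = ∫ y, f y ∂ν := by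
      intro t
      have := (measurePreserving_eval (fun _ : Fin N => ν) t)
      rw [← this.map_eq, integral_map this.measurable.aemeasurable
        hfm.aestronglyMeasurable, this.map_eq]
    simp only [hS, Finset.sum_apply]
    rw [integral_finsetSum]
    · simp_rw [h1, hmean]
      simp
    · intro t _
      exact ((hfL.comp_measurePreserving
        (measurePreserving_eval (fun _ : Fin N => ν) t)).integrable one_le_two)
  have hvar : Var[S; Measure.pi fun _ : Fin N => ν] ≤ N := by
    rw [hS, variance_sum_pi fun _ => hfL]
    have h1 : Var[f; ν] ≤ 1 := by
      have := variance_le_sq_of_bounded (μ := ν) (a := -1) (b := 1) (X := f)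
        (hfb.mono fun y hy => abs_le.1 hy) hfm.aemeasurable
      norm_num at this
      exact this
    refine (Finset.sum_le_sum fun _ _ => h1).trans ?_
    simp
  have hcheb := meas_ge_le_variance_div_sq hSL (c := N * ε) (by positivity)
  rw [hSmean] at hcheb
  have hset : {s : Fin N → Fin ℓ → Fin n → ℝ | ε ≤ |empiricalTensor c s I
      - mixtureTensor w (fun j r => augment c fun i => M j i r) I|}
      = {s | N * ε ≤ |S s - N * mixtureTensor w (fun j r => augment c fun i => M j i r) I|} := by
    ext s
    simp only [Set.mem_ofPred_eq]
    have e : empiricalTensor c s I = S s / N := by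
      simp only [empiricalTensor, hS, Finset.sum_apply, hf]
    have e2 : S s - N * mixtureTensor w (fun j r => augment c fun i => M j i r) I
        = N * (S s / N - mixtureTensor w (fun j r => augment c fun i => M j i r) I) := by
      field_simp
    rw [e, e2, abs_mul, abs_of_pos hN', mul_le_mul_iff_right₀ hN']
  rw [sampleLaw, ← hν, hset]
  refine hcheb.trans (ENNReal.ofReal_le_ofReal ?_)
  rw [mul_pow]
  calc _ ≤ (N : ℝ) / (N ^ 2 * ε ^ 2) := by gcongr
    _ = _ := by field_simp

/-- With high probability all entries of the empirical tensor are accurate. -/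
theorem sampleLaw_exists_deviation_le (hm : IsMultiViewMixture P h x w M c) (hc : 0 < c)
    (hw : ∀ r, 0 < w r) {N : ℕ} (hN : 0 < N) {ε : ℝ} (hε : 0 < ε) :
    sampleLaw P x N {s | ∃ I, ε ≤ |empiricalTensor c s I
      - mixtureTensor w (fun j r => augment c fun i => M j i r) I|}
      ≤ ENNReal.ofReal (((n : ℝ) + 1) ^ ℓ * (1 / (N * ε ^ 2))) := by
  have : {s : Fin N → Fin ℓ → Fin n → ℝ | ∃ I, ε ≤ |empiricalTensor c s I
      - mixtureTensor w (fun j r => augment c fun i => M j i r) I|}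
      = ⋃ I, {s | ε ≤ |empiricalTensor c s I
        - mixtureTensor w (fun j r => augment c fun i => M j i r) I|} := by
    ext s; simp
  rw [this]
  refine (measure_iUnion_fintype_le _ _).trans ?_
  refine (Finset.sum_le_sum fun I _ => hm.sampleLaw_deviation_le hc hw hN hε I).trans ?_
  rw [Finset.sum_const, Finset.card_univ, Fintype.card_fun, Fintype.card_fin, Fintype.card_fin,
    nsmul_eq_mul, ENNReal.ofReal_mul (by positivity)]
  refine mul_le_mul_left (le_of_eq ?_) _
  rw [← ENNReal.ofReal_natCast]
  push_cast
  rfl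

end IsMultiViewMixture

/-! ### Programming the real random access machine -/

namespace RealRAM

/-- The program `p` leads from `σ` to `σ'` in at most `T` steps. -/
def Runs (p : Program) (σ σ' : State) (T : ℕ) : Prop := ∃ t ≤ T, Exec p σ σ' t

theorem Runs.mono {p : Program} {σ σ' : State} {T T' : ℕ} (h : Runs p σ σ' T) (hT : T ≤ T') :
    Runs p σ σ' T' := by
  obtain ⟨t, ht, he⟩ := h
  exact ⟨t, ht.trans hT, he⟩

theorem Runs.seq {p q : Program} {σ σ₁ σ₂ : State} {S T : ℕ} (hp : Runs p σ σ₁ S)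
    (hq : Runs q σ₁ σ₂ T) : Runs (.seq p q) σ σ₂ (S + T) := by
  obtain ⟨s, hs, he⟩ := hp
  obtain ⟨t, ht, he'⟩ := hq
  exact ⟨s + t, by omega, .seq he he'⟩

theorem Runs.ite_true {b : Test} {p q : Program} {σ σ' : State} {T : ℕ} (hb : b.Holds σ)
    (hp : Runs p σ σ' T) : Runs (.ite b p q) σ σ' (1 + b.cost + T) := by
  obtain ⟨t, ht, he⟩ := hp
  exact ⟨1 + b.cost + t, by omega, .ite_true hb he⟩

theorem Runs.ite_false {b : Test} {p q : Program} {σ σ' : State} {T : ℕ} (hb : ¬ b.Holds σ)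
    (hq : Runs q σ σ' T) : Runs (.ite b p q) σ σ' (1 + b.cost + T) := by
  obtain ⟨t, ht, he⟩ := hq
  exact ⟨1 + b.cost + t, by omega, .ite_false hb he⟩

/-- A loop with an invariant that depends on a decreasing counter. -/
theorem Runs.while_counter {b : Test} {p : Program} (Inv : ℕ → State → Prop) (T : ℕ)
    (hstep : ∀ m σ, Inv m σ → b.Holds σ → ∃ m' σ', m' < m ∧ Runs p σ σ' T ∧ Inv m' σ') (m : ℕ)
    (σ : State) (hσ : Inv m σ) :
    ∃ m' σ', Runs (.while b p) σ σ' (m * (1 + b.cost + T) + (1 + b.cost)) ∧ Inv m' σ' ∧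
      ¬ b.Holds σ' := by
  induction m using Nat.strong_induction_on generalizing σ with
  | _ m ih =>
    by_cases hb : b.Holds σ
    · obtain ⟨m₁, σ₁, hlt, ⟨s, hs, he⟩, hI⟩ := hstep m σ hσ hb
      obtain ⟨m₂, σ₂, ⟨t, ht, he'⟩, hI', hb'⟩ := ih m₁ hlt σ₁ hI
      refine ⟨m₂, σ₂, ⟨_, ?_, .while_true hb he he'⟩, hI', hb'⟩
      have h2 := Nat.mul_le_mul_right (1 + b.cost + T) (show m₁ + 1 ≤ m from hlt)
      rw [add_mul, one_mul] at h2
      omega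
    · exact ⟨m, σ, ⟨_, by omega, .while_false hb⟩, hσ, hb⟩

/-- A loop with an invariant and a decreasing variant. -/
theorem Runs.while_variant {b : Test} {p : Program} (Inv : State → Prop) (μ : State → ℕ) (T : ℕ)
    (hstep : ∀ σ, Inv σ → b.Holds σ → ∃ σ', Runs p σ σ' T ∧ Inv σ' ∧ μ σ' < μ σ) (σ : State)
    (hσ : Inv σ) :
    ∃ σ', Runs (.while b p) σ σ' (μ σ * (1 + b.cost + T) + (1 + b.cost)) ∧ Inv σ' ∧
      ¬ b.Holds σ' := by
  obtain ⟨_, σ', hr, ⟨hI, _⟩, hb⟩ := Runs.while_counter (fun m σ => Inv σ ∧ μ σ = m) T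
    (fun m σ₁ h₁ hb => by
      obtain ⟨σ₂, hr, hI, hlt⟩ := hstep σ₁ h₁.1 hb
      exact ⟨μ σ₂, σ₂, h₁.2 ▸ hlt, hr, hI, rfl⟩) (μ σ) σ ⟨hσ, rfl⟩
  exact ⟨σ', hr, hI, hb⟩

/-- The state after an assignment to a natural cell. -/
def State.setN (σ : State) (ad : List ℕ) (v : ℕ) : State :=
  { σ with nat := Function.update σ.nat ad v }

/-- The state after an assignment to a real cell. -/
def State.setR (σ : State) (ad : List ℕ) (v : ℝ) : State :=
  { σ with real := Function.update σ.real ad v }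

@[simp] theorem State.setN_nat (σ : State) (ad : List ℕ) (v : ℕ) :
    (σ.setN ad v).nat = Function.update σ.nat ad v := rfl

@[simp] theorem State.setN_real (σ : State) (ad : List ℕ) (v : ℕ) :
    (σ.setN ad v).real = σ.real := rfl

@[simp] theorem State.setR_nat (σ : State) (ad : List ℕ) (v : ℝ) :
    (σ.setR ad v).nat = σ.nat := rfl

@[simp] theorem State.setR_real (σ : State) (ad : List ℕ) (v : ℝ) :
    (σ.setR ad v).real = Function.update σ.real ad v := rfl

/-- Assignment to the natural cell with the given list of address expressions. -/
def assignN (idx : List NExp) (e : NExp) : Program := .setN idx.length idx.get e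

/-- Assignment to the real cell with the given list of address expressions. -/
def assignR (idx : List NExp) (e : RExp) : Program := .setR idx.length idx.get e

/-- Reading a natural cell. -/
def NExp.at (idx : List NExp) : NExp := .load idx.length idx.get

/-- Reading a real cell. -/
def RExp.at (idx : List NExp) : RExp := .load idx.length idx.get

theorem ofFn_get_eval (idx : List NExp) (σ : State) :
    (List.ofFn fun i => (idx.get i).eval σ) = idx.map (NExp.eval σ) := by
  rw [← List.ofFn_get (idx.map (NExp.eval σ))]
  simp [List.ofFn_eq_map]

@[simp] theorem NExp.eval_at (idx : List NExp) (σ : State) :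
    (NExp.at idx).eval σ = σ.nat (idx.map (NExp.eval σ)) := by
  rw [NExp.at, NExp.eval, ofFn_get_eval]

@[simp] theorem RExp.eval_at (idx : List NExp) (σ : State) :
    (RExp.at idx).eval σ = σ.real (idx.map (NExp.eval σ)) := by
  rw [RExp.at, RExp.eval, ofFn_get_eval]

theorem runs_assignN (idx : List NExp) (e : NExp) : ∃ K, ∀ σ,
    Runs (assignN idx e) σ (σ.setN (idx.map (NExp.eval σ)) (e.eval σ)) K := by
  refine ⟨1 + ∑ i, (idx.get i).cost + e.cost, fun σ => ⟨_, le_rfl, ?_⟩⟩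
  have := Exec.setN σ idx.length idx.get e
  rw [ofFn_get_eval] at this
  exact this

theorem runs_assignR (idx : List NExp) (e : RExp) : ∃ K, ∀ σ,
    Runs (assignR idx e) σ (σ.setR (idx.map (NExp.eval σ)) (e.eval σ)) K := by
  refine ⟨1 + ∑ i, (idx.get i).cost + e.cost, fun σ => ⟨_, le_rfl, ?_⟩⟩
  have := Exec.setR σ idx.length idx.get e
  rw [ofFn_get_eval] at this
  exact this

/-! ### Scratch cells, cost units and functions computable by programs -/

/-- `σ'` differs from `σ` at most in the scratch cells of level at least `d`. -/
structure Frame (d : ℕ) (σ σ' : State) : Prop where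
  nat : ∀ ad, (∀ e, d ≤ e → ad ≠ [8, e]) → σ'.nat ad = σ.nat ad
  real : ∀ ad, (∀ e, d ≤ e → ad ≠ [9, e]) → σ'.real ad = σ.real ad

/-- `σ'` differs from `σ` at most in the scratch cells of level at least `d` and in the output
cells. -/
structure Sim (d : ℕ) (σ σ' : State) : Prop where
  nat : ∀ ad, (∀ e, d ≤ e → ad ≠ [8, e]) → σ'.nat ad = σ.nat ad
  real : ∀ ad, (∀ e, d ≤ e → ad ≠ [9, e]) → (∀ l, ad ≠ 5 :: l) → (∀ l, ad ≠ 6 :: l) →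
    σ'.real ad = σ.real ad

theorem Frame.sim {d : ℕ} {σ σ' : State} (h : Frame d σ σ') : Sim d σ σ' :=
  ⟨h.nat, fun ad h1 _ _ => h.real ad h1⟩

theorem Frame.trans {d : ℕ} {σ σ₁ σ₂ : State} (h : Frame d σ σ₁) (h' : Frame d σ₁ σ₂) :
    Frame d σ σ₂ :=
  ⟨fun ad had => (h'.nat ad had).trans (h.nat ad had),
    fun ad had => (h'.real ad had).trans (h.real ad had)⟩

theorem Sim.trans {d : ℕ} {σ σ₁ σ₂ : State} (h : Sim d σ σ₁) (h' : Sim d σ₁ σ₂) : Sim d σ σ₂ :=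
  ⟨fun ad had => (h'.nat ad had).trans (h.nat ad had),
    fun ad h1 h2 h3 => (h'.real ad h1 h2 h3).trans (h.real ad h1 h2 h3)⟩

theorem Frame.mono {d d' : ℕ} {σ σ' : State} (h : Frame d' σ σ') (hd : d ≤ d') : Frame d σ σ' :=
  ⟨fun ad had => h.nat ad fun e he => had e (hd.trans he),
    fun ad had => h.real ad fun e he => had e (hd.trans he)⟩

theorem Sim.mono {d d' : ℕ} {σ σ' : State} (h : Sim d' σ σ') (hd : d ≤ d') : Sim d σ σ' :=
  ⟨fun ad had => h.nat ad fun e he => had e (hd.trans he),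
    fun ad had => h.real ad fun e he => had e (hd.trans he)⟩

theorem frame_setN {d e : ℕ} (h : d ≤ e) (σ : State) (v : ℕ) : Frame d σ (σ.setN [8, e] v) :=
  ⟨fun ad had => by
    rw [State.setN_nat, Function.update_of_ne (had e h)], fun _ _ => rfl⟩

theorem frame_setR {d e : ℕ} (h : d ≤ e) (σ : State) (v : ℝ) : Frame d σ (σ.setR [9, e] v) :=
  ⟨fun _ _ => rfl, fun ad had => by
    rw [State.setR_real, Function.update_of_ne (had e h)]⟩

/-- A function of the state that does not depend on the scratch cells of level at least `d` or on
the output cells. -/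
def Stable {α : Type*} (d : ℕ) (f : State → α) : Prop := ∀ σ σ', Sim d σ σ' → f σ' = f σ

theorem Stable.mono {α : Type*} {d d' : ℕ} {f : State → α} (h : Stable d f) (hd : d ≤ d') :
    Stable d' f := fun σ σ' hs => h σ σ' (hs.mono hd)

/-- The cost unit: a monomial in the dimension, the number of components and the number of
samples. -/
def costUnit (e F g : ℕ) (σ : State) : ℕ :=
  (σ.nat [0] + 1) ^ e * σ.nat [1] ^ F * σ.nat [2] ^ g

/-- The number of components and the number of samples are positive. -/
def Valid (σ : State) : Prop := 1 ≤ σ.nat [1] ∧ 1 ≤ σ.nat [2]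

theorem Sim.nat_singleton {d : ℕ} {σ σ' : State} (h : Sim d σ σ') (i : ℕ) :
    σ'.nat [i] = σ.nat [i] := h.nat _ fun e _ => by simp

theorem Sim.valid {d : ℕ} {σ σ' : State} (h : Sim d σ σ') (hv : Valid σ) : Valid σ' := by
  rw [Valid, h.nat_singleton, h.nat_singleton]; exact hv

theorem Sim.costUnit {d : ℕ} {σ σ' : State} (h : Sim d σ σ') (e F g : ℕ) :
    costUnit e F g σ' = costUnit e F g σ := by
  rw [RealRAM.costUnit, RealRAM.costUnit, h.nat_singleton, h.nat_singleton, h.nat_singleton]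

theorem costUnit_mono {σ : State} (hv : Valid σ) {e e' F F' g g' : ℕ} (he : e ≤ e') (hF : F ≤ F')
    (hg : g ≤ g') : costUnit e F g σ ≤ costUnit e' F' g' σ :=
  Nat.mul_le_mul (Nat.mul_le_mul (Nat.pow_le_pow_right (by omega) he)
    (Nat.pow_le_pow_right hv.1 hF)) (Nat.pow_le_pow_right hv.2 hg)

theorem one_le_costUnit {σ : State} (hv : Valid σ) (e F g : ℕ) : 1 ≤ costUnit e F g σ := by
  have := costUnit_mono hv (Nat.zero_le e) (Nat.zero_le F) (Nat.zero_le g)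
  simpa [costUnit] using this

/-- The value of `f` can be computed into the scratch cell of level `d`, in time of order `R ^ F * N ^ g`
times a polynomial in the dimension. -/
def ComputesAt (d F g : ℕ) (f : State → ℝ) : Prop :=
  ∃ (p : Program) (K e : ℕ), ∀ σ, Valid σ → ∃ σ', Runs p σ σ' (K * costUnit e F g σ) ∧
    Frame d σ σ' ∧ σ'.real [9, d] = f σ

/-- The function `f` depends only on variables of level below `d` and can be computed with the
scratch cells of any level at least `d`. -/
def Computable (d F g : ℕ) (f : State → ℝ) : Prop :=
  Stable d f ∧ ∀ d', d ≤ d' → ComputesAt d' F g f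

namespace Computable

variable {d F g : ℕ} {f f₁ f₂ : State → ℝ}

theorem mono {F' g' : ℕ} (h : Computable d F g f) (hF : F ≤ F') (hg : g ≤ g') :
    Computable d F' g' f := by
  refine ⟨h.1, fun d' hd => ?_⟩
  obtain ⟨p, K, e, hp⟩ := h.2 d' hd
  refine ⟨p, K, e, fun σ hv => ?_⟩
  obtain ⟨σ', hr, hf⟩ := hp σ hv
  exact ⟨σ', hr.mono (Nat.mul_le_mul_left _ (costUnit_mono hv le_rfl hF hg)), hf⟩

theorem congr (h : Computable d F g f₁) (hf : ∀ σ, f₁ σ = f₂ σ) : Computable d F g f₂ := by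
  rwa [← show f₁ = f₂ from funext hf]

theorem of_exp (e : RExp) (h : Stable d e.eval) : Computable d F g e.eval := by
  refine ⟨h, fun d' _ => ?_⟩
  obtain ⟨K, hK⟩ := runs_assignR [.const 9, .const d'] e
  refine ⟨_, K, 0, fun σ hv => ⟨_, (hK σ).mono ?_, ?_, ?_⟩⟩
  · exact Nat.le_mul_of_pos_right _ (one_le_costUnit hv _ _ _)
  · exact frame_setR le_rfl σ _
  · simp [NExp.eval]

/-- Combining two values by an expression in two scratch cells. -/
theorem map₂ (op : ℝ → ℝ → ℝ) (opE : RExp → RExp → RExp)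
    (hop : ∀ a b σ, (opE a b).eval σ = op (a.eval σ) (b.eval σ))
    (h₁ : Computable d F g f₁) (h₂ : Computable d F g f₂) :
    Computable d F g fun σ => op (f₁ σ) (f₂ σ) := by
  refine ⟨fun σ σ' hs => by simp only [h₁.1 σ σ' hs, h₂.1 σ σ' hs], fun d' hd => ?_⟩
  obtain ⟨p, K, e, hp⟩ := h₁.2 d' hd
  -- The second operand is computed one level deeper, so that it does not overwrite the first.
  obtain ⟨p', K', e', hp'⟩ := h₂.2 (d' + 1) (by omega)
  obtain ⟨k, hk⟩ := runs_assignR [.const 9, .const d']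
    (opE (.at [.const 9, .const d']) (.at [.const 9, .const (d' + 1)]))
  refine ⟨.seq p (.seq p' (assignR [.const 9, .const d']
    (opE (.at [.const 9, .const d']) (.at [.const 9, .const (d' + 1)])))), K + (K' + k), e + e',
    fun σ hv => ?_⟩
  obtain ⟨σ₁, hr₁, hf₁, hv₁⟩ := hp σ hv
  obtain ⟨σ₂, hr₂, hf₂, hv₂⟩ := hp' σ₁ (hf₁.sim.valid hv)
  refine ⟨_, (hr₁.seq (hr₂.seq (hk σ₂))).mono ?_, ?_, ?_⟩
  · rw [hf₁.sim.costUnit, add_mul, add_mul]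
    refine Nat.add_le_add (Nat.mul_le_mul_left _ (costUnit_mono hv (by omega) le_rfl le_rfl))
      (Nat.add_le_add (Nat.mul_le_mul_left _ (costUnit_mono hv (by omega) le_rfl le_rfl)) ?_)
    exact Nat.le_mul_of_pos_right _ (one_le_costUnit hv _ _ _)
  · exact (hf₁.trans (hf₂.mono (by omega))).trans (frame_setR le_rfl _ _)
  · have e1 : σ₂.real [9, d'] = f₁ σ := by
      rw [hf₂.real _ fun e he => by simp; omega, hv₁]
    have e2 : σ₂.real [9, d' + 1] = f₂ σ := by
      rw [hv₂, h₂.1 σ σ₁ (hf₁.sim.mono hd)]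
    simp [NExp.eval, hop, e1, e2]

theorem add (h₁ : Computable d F g f₁) (h₂ : Computable d F g f₂) :
    Computable d F g fun σ => f₁ σ + f₂ σ := map₂ (· + ·) .add (fun _ _ _ => rfl) h₁ h₂

theorem sub (h₁ : Computable d F g f₁) (h₂ : Computable d F g f₂) :
    Computable d F g fun σ => f₁ σ - f₂ σ := map₂ (· - ·) .sub (fun _ _ _ => rfl) h₁ h₂

theorem mul (h₁ : Computable d F g f₁) (h₂ : Computable d F g f₂) :
    Computable d F g fun σ => f₁ σ * f₂ σ := map₂ (· * ·) .mul (fun _ _ _ => rfl) h₁ h₂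

theorem div (h₁ : Computable d F g f₁) (h₂ : Computable d F g f₂) :
    Computable d F g fun σ => f₁ σ / f₂ σ := map₂ (· / ·) .div (fun _ _ _ => rfl) h₁ h₂

theorem const (c : ℚ) : Computable d F g fun _ => (c : ℝ) :=
  (of_exp (.const c) fun _ _ _ => rfl).congr fun _ => rfl

open Classical in
/-- Branching on a test. -/
theorem ite_test (b : Test) (hb : Stable d b.Holds) (h₁ : Computable d F g f₁)
    (h₂ : Computable d F g f₂) :
    Computable d F g fun σ => if b.Holds σ then f₁ σ else f₂ σ := by
  refine ⟨fun σ σ' hs => by simp only [h₁.1 σ σ' hs, h₂.1 σ σ' hs, hb σ σ' hs], fun d' hd => ?_⟩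
  obtain ⟨p, K, e, hp⟩ := h₁.2 d' hd
  obtain ⟨p', K', e', hp'⟩ := h₂.2 d' hd
  refine ⟨.ite b p p', 1 + b.cost + (K + K'), e + e', fun σ hv => ?_⟩
  have hone := one_le_costUnit hv (e + e') F g
  have hc := costUnit_mono hv (show e ≤ e + e' by omega) (le_refl F) (le_refl g)
  have hc' := costUnit_mono hv (show e' ≤ e + e' by omega) (le_refl F) (le_refl g)
  have h1 := Nat.le_mul_of_pos_right (1 + b.cost) hone
  by_cases hσ : b.Holds σ
  · obtain ⟨σ', hr, hf, hval⟩ := hp σ hv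
    refine ⟨σ', (Runs.ite_true hσ hr).mono ?_, hf, by simp only [hval, if_pos hσ]⟩
    rw [add_mul (1 + b.cost), add_mul K]
    have := Nat.mul_le_mul_left K hc
    omega
  · obtain ⟨σ', hr, hf, hval⟩ := hp' σ hv
    refine ⟨σ', (Runs.ite_false hσ hr).mono ?_, hf, by simp only [hval, if_neg hσ]⟩
    rw [add_mul (1 + b.cost), add_mul K]
    have := Nat.mul_le_mul_left K' hc'
    omega

/-- Branching on a comparison of two computed values. -/
theorem ite_le {f₃ f₄ : State → ℝ} (h₁ : Computable d F g f₁) (h₂ : Computable d F g f₂)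
    (h₃ : Computable d F g f₃) (h₄ : Computable d F g f₄) :
    Computable d F g fun σ => if f₁ σ ≤ f₂ σ then f₃ σ else f₄ σ := by
  -- The compared values sit in scratch cells, so a test that reads them is not stable. The truth
  -- value is computed as a number 0 or 1 and then selects between the two branches arithmetically.
  have hcmp : Computable d F g fun σ => if f₁ σ ≤ f₂ σ then (1 : ℝ) else 0 := by
    refine ⟨fun σ σ' hs => by simp only [h₁.1 σ σ' hs, h₂.1 σ σ' hs], fun d' hd => ?_⟩
    obtain ⟨p, K, e, hp⟩ := (h₂.sub h₁).2 d' hd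
    obtain ⟨k₁, hk₁⟩ := runs_assignR [.const 9, .const d'] (.const 1)
    obtain ⟨k₀, hk₀⟩ := runs_assignR [.const 9, .const d'] (.const 0)
    set b : Test := .leR (.const 0) (.at [.const 9, .const d'])
    refine ⟨.seq p (.ite b (assignR [.const 9, .const d'] (.const 1))
      (assignR [.const 9, .const d'] (.const 0))), K + (1 + b.cost + (k₁ + k₀)), e,
      fun σ hv => ?_⟩
    obtain ⟨σ₁, hr, hf, hval⟩ := hp σ hv
    have hone := one_le_costUnit hv e F g
    have h1 := Nat.le_mul_of_pos_right (1 + b.cost + (k₁ + k₀)) hone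
    have hb : b.Holds σ₁ ↔ f₁ σ ≤ f₂ σ := by
      simp [b, Test.Holds, RExp.eval, NExp.eval, hval]
    by_cases hσ : b.Holds σ₁
    · refine ⟨_, (hr.seq (Runs.ite_true hσ (hk₁ σ₁))).mono ?_, hf.trans (frame_setR le_rfl _ _), ?_⟩
      · rw [add_mul]; omega
      · simp [NExp.eval, RExp.eval, hb.1 hσ]
    · refine ⟨_, (hr.seq (Runs.ite_false hσ (hk₀ σ₁))).mono ?_,
        hf.trans (frame_setR le_rfl _ _), ?_⟩
      · rw [add_mul]; omega
      · simp only [if_neg fun h => hσ (hb.2 h)]; simp [NExp.eval, RExp.eval]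
  refine ((hcmp.mul h₃).add (((const 1).sub hcmp).mul h₄)).congr fun σ => ?_
  split_ifs <;> simp

/-- Summation over the values below a bound `B`, where the value of the index is given by an
expression. -/
theorem sum {F' g' : ℕ} {f : ℕ → State → ℝ} (b : NExp) (hb : Stable d b.eval)
    (hbound : ∃ K e, ∀ σ, Valid σ → ∀ e', b.eval σ * costUnit e' F g σ ≤ K * costUnit (e + e') F' g' σ)
    (h : ∀ d', d ≤ d' → ∀ x : NExp, Stable d' x.eval →
      Computable d' F g fun σ => f (x.eval σ) σ) :
    Computable d F' g' fun σ => ∑ i ∈ Finset.range (b.eval σ), f i σ := by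
  have hstab : ∀ i, Stable d (f i) := fun i => (h d le_rfl (.const i) fun _ _ _ => rfl).1
  refine ⟨fun σ σ' hs => by simp only [hb σ σ' hs, hstab _ σ σ' hs], fun d' hd => ?_⟩
  -- The loop index and the accumulator live at level `d'` and the summand is computed at level `d'
  -- + 1`, for which the index is an input.
  have hx : Stable (d' + 1) (NExp.at [.const 8, .const d']).eval := fun σ σ' hs => by
    simp only [NExp.eval_at]
    exact hs.nat _ fun e he => by simp [NExp.eval]; omega
  obtain ⟨p, K, e, hp⟩ := (h (d' + 1) (by omega) _ hx).2 (d' + 1) le_rfl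
  obtain ⟨Kb, eb, hKb⟩ := hbound
  set x : NExp := .at [.const 8, .const d'] with hxdef
  obtain ⟨k₁, hk₁⟩ := runs_assignN [.const 8, .const d'] (.const 0)
  obtain ⟨k₂, hk₂⟩ := runs_assignR [.const 9, .const d'] (.const 0)
  obtain ⟨k₃, hk₃⟩ := runs_assignR [.const 9, .const d']
    (.add (.at [.const 9, .const d']) (.at [.const 9, .const (d' + 1)]))
  obtain ⟨k₄, hk₄⟩ := runs_assignN [.const 8, .const d'] (.add x (.const 1))
  set t : Test := .neg (.leN b x) with ht
  set body : Program := .seq p (.seq (assignR [.const 9, .const d']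
    (.add (.at [.const 9, .const d']) (.at [.const 9, .const (d' + 1)])))
    (assignN [.const 8, .const d'] (.add x (.const 1)))) with hbody
  have hxe : ∀ σ : State, x.eval σ = σ.nat [8, d'] := fun σ => by
    simp [hxdef, NExp.eval]
  set c := 1 + t.cost + (K + (k₃ + k₄)) with hc
  refine ⟨.seq (assignN [.const 8, .const d'] (.const 0)) (.seq
    (assignR [.const 9, .const d'] (.const 0)) (.while t body)),
    k₁ + (k₂ + (c * Kb + (1 + t.cost))), eb + e, fun σ hv => ?_⟩
  have hone := one_le_costUnit hv (eb + e) F' g'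
  let Inv : State → Prop := fun σ₁ => Frame d' σ σ₁ ∧ σ₁.nat [8, d'] ≤ b.eval σ ∧
    σ₁.real [9, d'] = ∑ i ∈ Finset.range (σ₁.nat [8, d']), f i σ
  have hinit : Inv ((σ.setN [8, d'] 0).setR [9, d'] 0) := by
    refine ⟨(frame_setN le_rfl _ _).trans (frame_setR le_rfl _ _), ?_, ?_⟩ <;> simp
  have hloop := Runs.while_variant (b := t) (p := body) Inv
    (fun σ₁ => b.eval σ - σ₁.nat [8, d']) ((K + (k₃ + k₄)) * costUnit e F g σ) (by
    rintro σ₁ ⟨hf, hle, hval⟩ hbt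
    have hlt : σ₁.nat [8, d'] < b.eval σ := by
      simp only [ht, Test.Holds, hxe] at hbt
      have hbs := hb σ σ₁ (hf.sim.mono hd)
      simp only at hbs
      rw [hbs] at hbt
      omega
    obtain ⟨σ₂, hr₂, hf₂, hv₂⟩ := hp σ₁ (hf.sim.valid hv)
    refine ⟨_, (hr₂.seq ((hk₃ σ₂).seq (hk₄ _))).mono ?_, ?_, ?_⟩
    · rw [hf.sim.costUnit, add_mul]
      refine Nat.add_le_add_left ?_ _
      exact Nat.le_mul_of_pos_right _ (one_le_costUnit hv _ _ _)
    · have e1 : σ₂.nat [8, d'] = σ₁.nat [8, d'] := hf₂.nat _ fun e he => by simp; omega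
      have e2 : σ₂.real [9, d'] = σ₁.real [9, d'] := hf₂.real _ fun e he => by simp; omega
      refine ⟨((hf.trans (hf₂.mono (by omega))).trans (frame_setR le_rfl _ _)).trans
        (frame_setN le_rfl _ _), ?_, ?_⟩
      · simp [NExp.eval, hxe, e1]; omega
      · simp [NExp.eval, RExp.eval, hxe, e1, e2, hv₂, hval, Finset.sum_range_succ]
        exact hstab _ _ _ (hf.sim.mono hd)
    · have e1 : σ₂.nat [8, d'] = σ₁.nat [8, d'] := hf₂.nat _ fun e he => by simp; omega
      simp [NExp.eval, hxe, e1]; omega) _ hinit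
  obtain ⟨σ', hr, ⟨hf, hle, hval⟩, hnt⟩ := hloop
  have hr₀ := (hk₁ σ).seq ((hk₂ _).seq (T := b.eval σ *
    (1 + t.cost + (K + (k₃ + k₄)) * costUnit e F g σ) + (1 + t.cost)) (σ₂ := σ') (by
      simpa [NExp.eval, RExp.eval] using hr))
  refine ⟨σ', hr₀.mono ?_, hf, ?_⟩
  · have h1 := hKb σ hv e
    have h2 : 1 + t.cost + (K + (k₃ + k₄)) * costUnit e F g σ ≤ c * costUnit e F g σ := by
      rw [hc, add_mul (1 + t.cost)]
      have := Nat.le_mul_of_pos_right (1 + t.cost) (one_le_costUnit hv e F g)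
      omega
    have h3 : b.eval σ * (c * costUnit e F g σ) ≤ c * Kb * costUnit (eb + e) F' g' σ := by
      calc b.eval σ * (c * costUnit e F g σ) = c * (b.eval σ * costUnit e F g σ) := by ring
        _ ≤ c * (Kb * costUnit (eb + e) F' g' σ) := Nat.mul_le_mul_left _ h1
        _ = _ := by ring
    have h4 := Nat.mul_le_mul_left (b.eval σ) h2
    have h5 := Nat.le_mul_of_pos_right (k₁ + (k₂ + (1 + t.cost))) hone
    calc _ ≤ k₁ + (k₂ + (c * Kb * costUnit (eb + e) F' g' σ + (1 + t.cost))) := by omega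
      _ = c * Kb * costUnit (eb + e) F' g' σ + (k₁ + (k₂ + (1 + t.cost))) := by ring
      _ ≤ c * Kb * costUnit (eb + e) F' g' σ
          + (k₁ + (k₂ + (1 + t.cost))) * costUnit (eb + e) F' g' σ := by omega
      _ = _ := by ring
  · rw [hval]
    congr 2
    simp only [ht, Test.Holds, hxe, not_not] at hnt
    have hbs := hb σ σ' (hf.sim.mono hd)
    simp only at hbs
    rw [hbs] at hnt
    omega

end Computable

end RealRAM

namespace RealRAM

/-! ### Expressions and their stability -/

section Stability

variable {d : ℕ}

theorem stable_constN (c : ℕ) : Stable d (NExp.const c).eval := fun _ _ _ => rfl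

theorem Stable.addN {x y : NExp} (hx : Stable d x.eval) (hy : Stable d y.eval) :
    Stable d (NExp.add x y).eval := fun σ σ' h => by
  have h1 := hx σ σ' h
  have h2 := hy σ σ' h
  simp only [NExp.eval] at *
  rw [h1, h2]

theorem Stable.subN {x y : NExp} (hx : Stable d x.eval) (hy : Stable d y.eval) :
    Stable d (NExp.sub x y).eval := fun σ σ' h => by
  have h1 := hx σ σ' h
  have h2 := hy σ σ' h
  simp only [NExp.eval] at *
  rw [h1, h2]

theorem Stable.map_eval {idx : List NExp} (h : ∀ x ∈ idx, Stable d x.eval) :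
    Stable d fun σ => idx.map (NExp.eval σ) := fun _ _ hs =>
  List.map_congr_left fun x hx => h x hx _ _ hs

theorem stable_atN {c : ℕ} (hc : c ≠ 8) {idx : List NExp} (h : ∀ x ∈ idx, Stable d x.eval) :
    Stable d (NExp.at (.const c :: idx)).eval := fun σ σ' hs => by
  have h1 := Stable.map_eval h σ σ' hs
  simp only [NExp.eval_at, List.map_cons] at *
  rw [h1]
  exact hs.nat _ fun e _ => by simp [NExp.eval, hc]

theorem stable_atR {c : ℕ} (hc : c ≠ 9 ∧ c ≠ 5 ∧ c ≠ 6) {idx : List NExp}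
    (h : ∀ x ∈ idx, Stable d x.eval) : Stable d (RExp.at (.const c :: idx)).eval :=
  fun σ σ' hs => by
  have h1 := Stable.map_eval h σ σ' hs
  simp only [RExp.eval_at, List.map_cons] at *
  rw [h1]
  exact hs.real _ (fun e _ => by simp [NExp.eval, hc]) (fun l => by simp [NExp.eval, hc])
    fun l => by simp [NExp.eval, hc]

theorem Stable.ofNatR {x : NExp} (hx : Stable d x.eval) : Stable d (RExp.ofNat x).eval :=
  fun σ σ' h => by
  have h1 := hx σ σ' h
  simp only [RExp.eval] at *
  rw [h1]

theorem stable_constR (c : ℚ) : Stable d (RExp.const c).eval := fun _ _ _ => rfl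

theorem Stable.addR {x y : RExp} (hx : Stable d x.eval) (hy : Stable d y.eval) :
    Stable d (RExp.add x y).eval := fun σ σ' h => by
  have h1 := hx σ σ' h
  have h2 := hy σ σ' h
  simp only [RExp.eval] at *
  rw [h1, h2]

theorem Stable.subR {x y : RExp} (hx : Stable d x.eval) (hy : Stable d y.eval) :
    Stable d (RExp.sub x y).eval := fun σ σ' h => by
  have h1 := hx σ σ' h
  have h2 := hy σ σ' h
  simp only [RExp.eval] at *
  rw [h1, h2]

theorem Stable.mulR {x y : RExp} (hx : Stable d x.eval) (hy : Stable d y.eval) :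
    Stable d (RExp.mul x y).eval := fun σ σ' h => by
  have h1 := hx σ σ' h
  have h2 := hy σ σ' h
  simp only [RExp.eval] at *
  rw [h1, h2]

theorem Stable.divR {x y : RExp} (hx : Stable d x.eval) (hy : Stable d y.eval) :
    Stable d (RExp.div x y).eval := fun σ σ' h => by
  have h1 := hx σ σ' h
  have h2 := hy σ σ' h
  simp only [RExp.eval] at *
  rw [h1, h2]

end Stability

/-- A constant multiple of an expression, by repeated addition. -/
def NExp.nsmul (x : NExp) : ℕ → NExp
  | 0 => .const 0
  | m + 1 => .add (x.nsmul m) x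

@[simp] theorem NExp.eval_nsmul (x : NExp) (σ : State) (m : ℕ) :
    (x.nsmul m).eval σ = m * x.eval σ := by
  induction m with
  | zero => simp [NExp.nsmul, NExp.eval]
  | succ m ih => rw [NExp.nsmul, NExp.eval, ih]; ring

/-- A constant power of an expression, by repeated multiplication. -/
def RExp.pow (x : RExp) : ℕ → RExp
  | 0 => .const 1
  | m + 1 => .mul (x.pow m) x

@[simp] theorem RExp.eval_pow (x : RExp) (σ : State) (m : ℕ) :
    (x.pow m).eval σ = x.eval σ ^ m := by
  induction m with
  | zero => simp [RExp.pow, RExp.eval]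
  | succ m ih => rw [RExp.pow, RExp.eval, ih]; ring

theorem Stable.nsmul {d : ℕ} {x : NExp} (hx : Stable d x.eval) (m : ℕ) :
    Stable d (x.nsmul m).eval := fun σ σ' h => by
  have h1 := hx σ σ' h
  simp only [NExp.eval_nsmul] at *
  rw [h1]

theorem Stable.pow {d : ℕ} {x : RExp} (hx : Stable d x.eval) (m : ℕ) :
    Stable d (x.pow m).eval := fun σ σ' h => by
  have h1 := hx σ σ' h
  simp only [RExp.eval_pow] at *
  rw [h1]

/-- The dimension. -/
def dimE : NExp := .at [.const 0]

/-- The number of components. -/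
def cardE : NExp := .at [.const 1]

/-- The number of samples. -/
def samplesE : NExp := .at [.const 2]

/-- The number of values of a digit. -/
def baseE : NExp := .at [.const 11]

@[simp] theorem eval_dimE (σ : State) : dimE.eval σ = σ.nat [0] := by simp [dimE, NExp.eval]

@[simp] theorem eval_cardE (σ : State) : cardE.eval σ = σ.nat [1] := by simp [cardE, NExp.eval]

@[simp] theorem eval_samplesE (σ : State) : samplesE.eval σ = σ.nat [2] := by
  simp [samplesE, NExp.eval]

@[simp] theorem eval_baseE (σ : State) : baseE.eval σ = σ.nat [11] := by
  simp [baseE, NExp.eval]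

theorem stable_dimE {d : ℕ} : Stable d dimE.eval := stable_atN (by norm_num) (by simp)

theorem stable_cardE {d : ℕ} : Stable d cardE.eval := stable_atN (by norm_num) (by simp)

theorem stable_samplesE {d : ℕ} : Stable d samplesE.eval := stable_atN (by norm_num) (by simp)

theorem stable_baseE {d : ℕ} : Stable d baseE.eval := stable_atN (by norm_num) (by simp)

namespace Computable

variable {d F g : ℕ}

theorem prod {ι : Type*} {f : ι → State → ℝ} (s : Finset ι)
    (h : ∀ j, Computable d F g (f j)) : Computable d F g fun σ => ∏ j ∈ s, f j σ := by
  classical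
  induction s using Finset.induction_on with
  | empty => exact (const 1).congr fun σ => by simp
  | insert j s hj ih => exact ((h j).mul ih).congr fun σ => by rw [Finset.prod_insert hj]

theorem sum_samples {f : ℕ → State → ℝ}
    (h : ∀ d', d ≤ d' → ∀ x : NExp, Stable d' x.eval →
      Computable d' F g fun σ => f (x.eval σ) σ) :
    Computable d F (g + 1) fun σ => ∑ i ∈ Finset.range (σ.nat [2]), f i σ := by
  refine (sum samplesE stable_samplesE ⟨1, 0, fun σ _ e' => ?_⟩ h).congr fun σ => by simp
  rw [eval_samplesE, costUnit, costUnit, pow_succ]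
  exact le_of_eq (by ring)

theorem sum_card {f : ℕ → State → ℝ}
    (h : ∀ d', d ≤ d' → ∀ x : NExp, Stable d' x.eval →
      Computable d' F g fun σ => f (x.eval σ) σ) :
    Computable d (F + 1) g fun σ => ∑ i ∈ Finset.range (σ.nat [1]), f i σ := by
  refine (sum cardE stable_cardE ⟨1, 0, fun σ _ e' => ?_⟩ h).congr fun σ => by simp
  rw [eval_cardE, costUnit, costUnit, pow_succ]
  exact le_of_eq (by ring)

theorem sum_dim {f : ℕ → State → ℝ}
    (h : ∀ d', d ≤ d' → ∀ x : NExp, Stable d' x.eval →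
      Computable d' F g fun σ => f (x.eval σ) σ) :
    Computable d F g fun σ => ∑ i ∈ Finset.range (σ.nat [0] + 1), f i σ := by
  refine (sum (.add dimE (.const 1)) (stable_dimE.addN (stable_constN 1))
    ⟨1, 1, fun σ _ e' => ?_⟩ h).congr fun σ => by simp [NExp.eval]
  simp only [NExp.eval, eval_dimE, costUnit]
  exact le_of_eq (by ring)

theorem of_leN {f₁ f₂ : State → ℝ} {x y : NExp} (hx : Stable d x.eval) (hy : Stable d y.eval)
    (h₁ : Computable d F g f₁) (h₂ : Computable d F g f₂) :
    Computable d F g fun σ => if x.eval σ ≤ y.eval σ then f₁ σ else f₂ σ := by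
  classical
  refine (ite_test (.leN x y) (fun σ σ' h => ?_) h₁ h₂).congr fun σ => by
    by_cases hσ : x.eval σ ≤ y.eval σ
    · simp only [if_pos hσ, if_pos (show Test.Holds σ (.leN x y) from hσ)]
    · simp only [if_neg hσ, if_neg (show ¬ Test.Holds σ (.leN x y) from hσ)]
  have h1 := hx σ σ' h
  have h2 := hy σ σ' h
  simp only [Test.Holds] at *
  rw [h1, h2]

theorem clampUnit {f : State → ℝ} (h : Computable d F g f) :
    Computable d F g fun σ => clampUnit (f σ) := by
  refine (ite_le (const 1) h (const 1) (ite_le h (const (-1)) (const (-1)) h)).congr fun σ => ?_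
  rw [_root_.clampUnit]
  push_cast
  split_ifs with h1 h2
  · rw [min_eq_left h1, max_eq_right (by norm_num)]
  · rw [min_eq_right (by linarith), max_eq_left h2]
  · rw [min_eq_right (by linarith), max_eq_right (by linarith)]

theorem abs {f : State → ℝ} (h : Computable d F g f) : Computable d F g fun σ => |f σ| := by
  refine (ite_le (const 0) h h ((const 0).sub h)).congr fun σ => ?_
  push_cast
  split_ifs with h1
  · rw [abs_of_nonneg h1]
  · rw [abs_of_neg (by linarith), zero_sub]

end Computable

/-- Summation over all tuples of indices that are at most the dimension. -/
def sumTuples : (m : ℕ) → ((Fin m → ℕ) → State → ℝ) → State → ℝ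
  | 0, f, σ => f Fin.elim0 σ
  | m + 1, f, σ => ∑ i ∈ Finset.range (σ.nat [0] + 1), sumTuples m (fun I => f (Fin.cons i I)) σ

theorem sumTuples_congr {σ : State} {m : ℕ} : ∀ {f f' : (Fin m → ℕ) → State → ℝ},
    (∀ I, f I σ = f' I σ) → sumTuples m f σ = sumTuples m f' σ := by
  induction m with
  | zero => intro f f' h; exact h _
  | succ m ih => intro f f' h; exact Finset.sum_congr rfl fun i _ => ih fun I => h _

/-- One nested loop for each index. Every loop has `n + 1` rounds, which affects only the
unspecified exponent of the dimension. -/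
theorem Computable.sumTuples {F g : ℕ} {m : ℕ} : ∀ {d : ℕ} {f : (Fin m → ℕ) → State → ℝ},
    (∀ d', d ≤ d' → ∀ X : Fin m → NExp, (∀ j, Stable d' (X j).eval) →
      Computable d' F g fun σ => f (fun j => (X j).eval σ) σ) →
    Computable d F g (RealRAM.sumTuples m f) := by
  induction m with
  | zero =>
    intro d f h
    refine (h d le_rfl Fin.elim0 fun j => j.elim0).congr fun σ => ?_
    rw [RealRAM.sumTuples]
    congr 1
    exact Subsingleton.elim _ _
  | succ m ih =>
    intro d f h
    refine (sum_dim (f := fun i => RealRAM.sumTuples m fun I => f (Fin.cons i I))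
      fun d' hd x hx => ?_).congr fun σ => rfl
    have := ih (d := d') (f := fun I σ => f (Fin.cons (x.eval σ) I) σ) fun d'' hd' X hX => by
      refine (h d'' (hd.trans hd') (Fin.cons x X) fun j => ?_).congr fun σ => ?_
      · refine Fin.cases ?_ (fun j => ?_) j
        · exact hx.mono hd'
        · exact hX j
      · congr 1
        funext j
        refine Fin.cases ?_ (fun j => ?_) j <;> simp
    exact this.congr fun σ => sumTuples_congr fun I => rfl

/-- A condition on all index tuples thus becomes the vanishing of a single computed number. -/
theorem sumTuples_eq_zero_iff {σ : State} {m : ℕ} : ∀ {f : (Fin m → ℕ) → State → ℝ},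
    (∀ I, 0 ≤ f I σ) → (0 ≤ sumTuples m f σ ∧
      (sumTuples m f σ = 0 ↔ ∀ I : Fin m → ℕ, (∀ j, I j ≤ σ.nat [0]) → f I σ = 0)) := by
  induction m with
  | zero =>
    intro f h
    refine ⟨h _, fun h0 I _ => ?_, fun h0 => h0 _ fun j => j.elim0⟩
    rw [Subsingleton.elim I Fin.elim0]; exact h0
  | succ m ih =>
    intro f h
    have hi := fun i => ih (f := fun I => f (Fin.cons i I)) fun I => h _
    refine ⟨Finset.sum_nonneg fun i _ => (hi i).1, ?_⟩
    rw [sumTuples, Finset.sum_eq_zero_iff_of_nonneg fun i _ => (hi i).1]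
    constructor
    · intro h0 I hI
      have := (hi (I 0)).2.1 (h0 _ (by have := hI 0; simp; omega)) (Fin.tail I) fun j => hI _
      rwa [Fin.cons_self_tail] at this
    · intro h0 i hir
      rw [Finset.mem_range] at hir
      refine (hi i).2.2 fun I hI => h0 _ fun j => ?_
      refine Fin.cases ?_ (fun j => ?_) j
      · simp; omega
      · simpa using hI j

/-! ### The candidate decomposition as a computation -/

section Decoding

/-- The quantity `4 ℓ R (1 + 1 / η) (n τ cmax / γ) ^ 2` that controls all the thresholds. -/
def gaugeE (ℓ : ℕ) : RExp :=
  .mul (.mul (.mul (.const (4 * ℓ)) (.ofNat cardE))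
    (.add (.const 1) (.div (.const 1) (.at [.const 0]))))
    (RExp.pow (.div (.mul (.mul (.ofNat dimE) (.at [.const 1])) (.at [.const 3]))
      (.at [.const 2])) 2)

theorem eval_gaugeE (ℓ : ℕ) (σ : State) : (gaugeE ℓ).eval σ = 4 * ℓ * σ.nat [1] *
    (1 + 1 / σ.real [0]) * (σ.nat [0] * σ.real [1] * σ.real [3] / σ.real [2]) ^ 2 := by
  simp [gaugeE, RExp.eval, NExp.eval]

theorem stable_gaugeE {d : ℕ} (ℓ : ℕ) : Stable d (gaugeE ℓ).eval := by
  refine Stable.mulR (Stable.mulR (Stable.mulR (stable_constR _) stable_cardE.ofNatR)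
    ((stable_constR _).addR ((stable_constR _).divR ?_))) (Stable.pow (Stable.divR (Stable.mulR
      (Stable.mulR stable_dimE.ofNatR ?_) ?_) ?_) 2) <;>
  exact stable_atR (by norm_num) (by simp)

/-- The position of a digit. -/
def posE (A : ℕ) (t r : NExp) : NExp :=
  .add (.add (NExp.nsmul (.at [.const 10, cardE]) A) (.at [.const 10, t])) r

/-- The position of a digit, computed from the table of multiples. -/
def posV (σ : State) (A t r : ℕ) : ℕ := A * σ.nat [10, σ.nat [1]] + σ.nat [10, t] + r

@[simp] theorem eval_posE (A : ℕ) (t r : NExp) (σ : State) :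
    (posE A t r).eval σ = posV σ A (t.eval σ) (r.eval σ) := by
  simp [posE, NExp.eval, posV]

theorem stable_posE {d A : ℕ} {t r : NExp} (ht : Stable d t.eval) (hr : Stable d r.eval) :
    Stable d (posE A t r).eval := by
  refine Stable.addN (Stable.addN (Stable.nsmul (stable_atN (by norm_num) ?_) _)
    (stable_atN (by norm_num) ?_)) hr
  · simpa using stable_cardE
  · simpa using ht

/-- A digit. -/
def digitE (A : ℕ) (t r : NExp) : NExp := .at [.const 7, posE A t r]

@[simp] theorem eval_digitE (A : ℕ) (t r : NExp) (σ : State) :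
    (digitE A t r).eval σ = σ.nat [7, posV σ A (t.eval σ) (r.eval σ)] := by
  simp [digitE, NExp.eval]

theorem stable_digitE {d A : ℕ} {t r : NExp} (ht : Stable d t.eval) (hr : Stable d r.eval) :
    Stable d (digitE A t r).eval :=
  stable_atN (by norm_num) (by simpa using stable_posE ht hr)

variable (ℓ : ℕ)

/-- Entry `i` of view `j` of sample `t`, scaled and augmented. -/
def obsV (σ : State) (t j i : ℕ) : ℝ :=
  if i ≤ 0 then 1 else σ.real [4, t, j, i - 1] / σ.real [3]

/-- The empirical moment. -/
def momentV (I : Fin ℓ → ℕ) (σ : State) : ℝ :=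
  (∑ t ∈ Finset.range (σ.nat [2]), ∏ j : Fin ℓ, obsV σ t j (I j)) / σ.nat [2]

theorem computable_momentV {d : ℕ} (X : Fin ℓ → NExp) (hX : ∀ j, Stable d (X j).eval) :
    Computable d 0 1 fun σ => momentV ℓ (fun j => (X j).eval σ) σ := by
  refine Computable.div (Computable.sum_samples (F := 0) (g := 0)
    (f := fun t σ => ∏ j : Fin ℓ, obsV σ t j ((X j).eval σ)) fun d' hd x hx =>
      Computable.prod _ fun j => ?_)
    ((Computable.of_exp (.ofNat samplesE) stable_samplesE.ofNatR).congr fun σ => by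
      simp [RExp.eval])
  have hXj := (hX j).mono hd
  refine (Computable.of_leN hXj (stable_constN 0) (Computable.const 1)
    (Computable.of_exp (.div (.at [.const 4, x, .const j, .sub (X j) (.const 1)])
      (.at [.const 3])) (Stable.divR (stable_atR (by norm_num) ?_)
        (stable_atR (by norm_num) (by simp))))).congr fun σ => ?_
  · simp only [List.mem_cons, List.not_mem_nil, or_false, forall_eq_or_imp, forall_eq]
    exact ⟨hx, stable_constN _, hXj.subN (stable_constN 1)⟩
  · simp [obsV, RExp.eval, NExp.eval]

/-- The bound for the coefficients. -/
def boundV (σ : State) : ℝ := (gaugeE ℓ).eval σ ^ (2 * ℓ + 1)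

/-- A coefficient of the candidate. -/
def coefV (σ : State) (j t r : ℕ) : ℝ :=
  (2 * (σ.nat [7, posV σ j t r] / σ.nat [11]) - 1) * boundV ℓ σ

/-- An index of the candidate. -/
def indexV (σ : State) (j t m : ℕ) : ℕ := min (σ.nat [7, posV σ (ℓ + j * ℓ + m) t 0]) (σ.nat [0])

/-- A weight of the candidate. -/
def weightV (σ : State) (r : ℕ) : ℝ := σ.nat [7, posV σ (ℓ + ℓ * ℓ) 0 r] / σ.nat [11]

/-- An entry of a factor of the candidate. -/
def factorV (j : Fin ℓ) (r i : ℕ) (σ : State) : ℝ :=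
  if i ≤ 0 then 1 else clampUnit (∑ t ∈ Finset.range (σ.nat [1]), coefV ℓ σ j t r *
    momentV ℓ (Function.update (fun m : Fin ℓ => indexV ℓ σ j t m) j i) σ)

theorem computable_factorV {d : ℕ} (j : Fin ℓ) (r i : NExp) (hr : Stable d r.eval)
    (hi : Stable d i.eval) :
    Computable d 1 1 fun σ => factorV ℓ j (r.eval σ) (i.eval σ) σ := by
  refine (Computable.of_leN hi (stable_constN 0) (Computable.const 1)
    (Computable.clampUnit (Computable.sum_card (F := 0) (g := 1)
      (f := fun t σ => coefV ℓ σ j t (r.eval σ) *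
    momentV ℓ (Function.update (fun m : Fin ℓ => indexV ℓ σ j t m) j (i.eval σ)) σ)
      fun d' hd x hx => Computable.mul ?_ ?_))).congr fun σ => ?_
  · refine (Computable.of_exp (.mul (.sub (.mul (.const 2) (.div (.ofNat (digitE j x r))
      (.ofNat baseE))) (.const 1)) ((gaugeE ℓ).pow (2 * ℓ + 1))) ?_).congr fun σ => ?_
    · exact Stable.mulR (Stable.subR (Stable.mulR (stable_constR _) (Stable.divR
        (stable_digitE hx (hr.mono hd)).ofNatR stable_baseE.ofNatR)) (stable_constR _))
        (Stable.pow (stable_gaugeE ℓ) _)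
    · simp [RExp.eval, coefV, boundV]
  · let D : Fin ℓ → NExp := fun m => digitE (ℓ + j * ℓ + m) x (.const 0)
    have hD : ∀ m, Stable d' (D m).eval := fun m => stable_digitE hx (stable_constN 0)
    -- With truncated subtraction, `D - (D - n)` is the minimum of `D` and `n`.
    let X : Fin ℓ → NExp := Function.update (fun m => .sub (D m) (.sub (D m) dimE)) j i
    refine (computable_momentV ℓ X fun m => ?_).congr fun σ => ?_
    · rcases eq_or_ne m j with rfl | hm
      · simpa [X] using hi.mono hd
      · simpa [X, hm] using (hD m).subN ((hD m).subN stable_dimE)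
    · congr 1
      funext m
      rcases eq_or_ne m j with rfl | hm
      · simp [X]
      · simp only [X, ne_eq, hm, not_false_eq_true, Function.update_of_ne, NExp.eval, D,
          eval_digitE, eval_dimE, indexV]
        omega
  · simp [factorV, NExp.eval]

theorem computable_weightV {d F g : ℕ} (r : NExp) (hr : Stable d r.eval) :
    Computable d F g fun σ => weightV ℓ σ (r.eval σ) := by
  refine (Computable.of_exp (.div (.ofNat (digitE (ℓ + ℓ * ℓ) (.const 0) r)) (.ofNat baseE))
    (Stable.divR (stable_digitE (stable_constN 0) hr).ofNatR stable_baseE.ofNatR)).congr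
    fun σ => ?_
  simp [RExp.eval, weightV, NExp.eval]

/-- The tolerance of the test. -/
def toleranceV (σ : State) : ℝ := 1 / (gaugeE ℓ).eval σ ^ (9 * ℓ + 41)

/-- The indicator of a violated constraint. -/
def violationV (I : Fin ℓ → ℕ) (σ : State) : ℝ :=
  if |momentV ℓ I σ - ∑ r ∈ Finset.range (σ.nat [1]), weightV ℓ σ r *
    ∏ j, factorV ℓ j r (I j) σ| ≤ toleranceV ℓ σ then 0 else 1

/-- The number of violated constraints. -/
def testV : State → ℝ := sumTuples ℓ (violationV ℓ)

/-- Moments are not stored. Each entry of a factor averages the `N` samples anew for `R` columns,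
and the sum over components brings the cost to order `R ^ 2 * N`. -/
theorem computable_testV : Computable 0 2 1 (testV ℓ) := by
  refine Computable.sumTuples fun d _ X hX => ?_
  refine (Computable.ite_le (Computable.abs (Computable.sub
    ((computable_momentV ℓ X hX).mono (by norm_num) le_rfl)
    (Computable.sum_card (F := 1) (g := 1)
      (f := fun r σ => weightV ℓ σ r * ∏ j, factorV ℓ j r ((X j).eval σ) σ)
      fun d' hd x hx => Computable.mul (computable_weightV ℓ x hx)
      (Computable.prod _ fun j => computable_factorV ℓ j x (X j) hx ((hX j).mono hd)))))
    (Computable.of_exp (.div (.const 1) ((gaugeE ℓ).pow (9 * ℓ + 41)))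
      ((stable_constR 1).divR ((stable_gaugeE ℓ).pow _)))
    (Computable.const 0) (Computable.const 1)).congr fun σ => ?_
  simp [violationV, toleranceV, RExp.eval]

end Decoding

/-- The state `σ` holds the input of `σ₀`, the base `L` and the table of multiples of the number of
components. -/
structure Prepared (σ₀ : State) (L : ℕ) (σ : State) : Prop where
  real : ∀ ad : List ℕ, (∀ e, ad ≠ [9, e]) → (∀ l, ad ≠ 5 :: l) → (∀ l, ad ≠ 6 :: l) →
    σ.real ad = σ₀.real ad
  dim : σ.nat [0] = σ₀.nat [0]
  card : σ.nat [1] = σ₀.nat [1]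
  samples : σ.nat [2] = σ₀.nat [2]
  base : σ.nat [11] = L
  table : ∀ t ≤ σ₀.nat [1], σ.nat [10, t] = t * σ₀.nat [1]

namespace Prepared

variable {σ₀ σ σ' : State} {L : ℕ}

theorem of_sim (h : Prepared σ₀ L σ) (hs : Sim 0 σ σ') : Prepared σ₀ L σ' where
  real ad h1 h2 h3 := (hs.real ad (fun e _ => h1 e) h2 h3).trans (h.real ad h1 h2 h3)
  dim := (hs.nat_singleton 0).trans h.dim
  card := (hs.nat_singleton 1).trans h.card
  samples := (hs.nat_singleton 2).trans h.samples
  base := (hs.nat_singleton 11).trans h.base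
  table t ht := (hs.nat _ fun e _ => by simp).trans (h.table t ht)

theorem setN (h : Prepared σ₀ L σ) {ad : List ℕ} (v : ℕ)
    (had : ad = [12] ∨ ad = [13] ∨ ∃ p, ad = [7, p]) : Prepared σ₀ L (σ.setN ad v) := by
  have key : ∀ ad', (ad' = [0] ∨ ad' = [1] ∨ ad' = [2] ∨ ad' = [11] ∨ ∃ t, ad' = [10, t]) →
      (σ.setN ad v).nat ad' = σ.nat ad' := by
    intro ad' h'
    rw [State.setN_nat, Function.update_of_ne]
    rintro rfl
    rcases had with rfl | rfl | ⟨p, rfl⟩ <;> simp at h'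
  exact ⟨h.real, (key _ (by simp)).trans h.dim, (key _ (by simp)).trans h.card,
    (key _ (by simp)).trans h.samples, (key _ (by simp)).trans h.base,
    fun t ht => (key _ (by simp)).trans (h.table t ht)⟩

theorem posV_eq (h : Prepared σ₀ L σ) (A : ℕ) {t : ℕ} (ht : t ≤ σ₀.nat [1]) (r : ℕ) :
    posV σ A t r = blockPos (σ₀.nat [1]) A t r := by
  rw [posV, blockPos, h.card, h.table _ le_rfl, h.table _ ht]

theorem gauge (h : Prepared σ₀ L σ) (ℓ : ℕ) : (gaugeE ℓ).eval σ = (gaugeE ℓ).eval σ₀ := by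
  have key : ∀ i, i ≤ 3 → σ.real [i] = σ₀.real [i] := fun i hi =>
    h.real _ (by simp) (by simp; omega) (by simp; omega)
  rw [eval_gaugeE, eval_gaugeE, h.card, h.dim, key 0 (by norm_num), key 1 (by norm_num),
    key 2 (by norm_num), key 3 (by norm_num)]

theorem momentV_eq (h : Prepared σ₀ L σ) {ℓ : ℕ} (I : Fin ℓ → ℕ) :
    momentV ℓ I σ = momentV ℓ I σ₀ := by
  have key : ∀ t j i, obsV σ t j i = obsV σ₀ t j i := fun t j i => by
    rw [obsV, obsV, h.real _ (by simp) (by simp) (by simp),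
      h.real _ (by simp) (by simp) (by simp)]
  simp only [momentV, h.samples, key]

theorem factorV_eq (h : Prepared σ₀ L σ) {ℓ : ℕ} (j : Fin ℓ) (r i : ℕ) :
    factorV ℓ j r i σ = codeFactor (σ₀.nat [0]) (σ₀.nat [1]) L
      ((gaugeE ℓ).eval σ₀ ^ (2 * ℓ + 1)) (fun I => momentV ℓ I σ₀) (fun p => σ.nat [7, p]) j r i := by
  rw [factorV, codeFactor]
  simp only [Nat.le_zero_eq]
  refine if_congr Iff.rfl rfl (congrArg _ ?_)
  rw [h.card]
  refine Finset.sum_congr rfl fun t ht => ?_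
  have ht' : t ≤ σ₀.nat [1] := (Finset.mem_range.1 ht).le
  rw [h.momentV_eq, coefV, codeCoef, boundV, h.gauge, h.base, h.posV_eq _ ht']
  congr 2
  simp only [indexV, codeIndex, h.posV_eq _ ht', h.dim]

theorem weightV_eq (h : Prepared σ₀ L σ) (ℓ r : ℕ) :
    weightV ℓ σ r = codeWeight ℓ (σ₀.nat [1]) L (fun p => σ.nat [7, p]) r := by
  rw [weightV, codeWeight, h.posV_eq _ (Nat.zero_le _), h.base]

theorem testV_nonneg (ℓ : ℕ) (σ : State) : 0 ≤ testV ℓ σ :=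
  (sumTuples_eq_zero_iff fun I => by rw [violationV]; split_ifs <;> norm_num).1

theorem testV_le_zero_iff (h : Prepared σ₀ L σ) (ℓ : ℕ) : testV ℓ σ ≤ 0 ↔
    CodePasses (σ₀.nat [0]) (σ₀.nat [1]) L ((gaugeE ℓ).eval σ₀ ^ (2 * ℓ + 1))
      ((gaugeE ℓ).eval σ₀ ^ (9 * ℓ + 41))⁻¹ (fun I => momentV ℓ I σ₀)
      (fun p => σ.nat [7, p]) := by
  rw [(testV_nonneg ℓ σ).ge_iff_eq', testV,
    (sumTuples_eq_zero_iff fun I => by rw [violationV]; split_ifs <;> norm_num).2, CodePasses]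
  rw [h.dim]
  refine forall_congr' fun I => imp_congr_right fun _ => ?_
  rw [violationV, toleranceV, h.gauge, one_div, h.momentV_eq, h.card]
  simp only [h.factorV_eq, h.weightV_eq]
  split_ifs with h1 <;> simp [h1]

end Prepared

end RealRAM

namespace RealRAM

/-! ### Preparation -/

/-- The number of values of a digit. -/
def baseV (ℓ : ℕ) (σ : State) : ℕ := ⌈(gaugeE ℓ).eval σ ^ (12 * ℓ + 50)⌉₊

/-- Computing the base of the digits by counting. -/
theorem exists_computes_base (ℓ : ℕ) : ∃ (p : Program) (K : ℕ), ∀ σ : State, σ.nat [11] = 0 →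
    Runs p σ (σ.setN [11] (baseV ℓ σ)) (K * (baseV ℓ σ + 1)) := by
  obtain ⟨k, hk⟩ := runs_assignN [.const 11] (.add baseE (.const 1))
  -- The machine cannot round, so the ceiling is found by counting up to the first natural number
  -- that is large enough.
  set b : Test := .neg (.leR ((gaugeE ℓ).pow (12 * ℓ + 50)) (.ofNat baseE)) with hb
  refine ⟨.while b (assignN [.const 11] (.add baseE (.const 1))), 1 + b.cost + k, fun σ hσ => ?_⟩
  have hgauge : ∀ v, (gaugeE ℓ).eval (σ.setN [11] v) = (gaugeE ℓ).eval σ := fun v => by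
    simp [eval_gaugeE]
  obtain ⟨m, σ', hr, ⟨v, hle, rfl, hm⟩, hb'⟩ := Runs.while_counter (b := b)
    (p := assignN [.const 11] (.add baseE (.const 1)))
    (fun m σ₁ => ∃ v, v ≤ baseV ℓ σ ∧ σ₁ = σ.setN [11] v ∧ m = baseV ℓ σ - v) k
    (by
      rintro m σ₁ ⟨v, hle, rfl, rfl⟩ ht
      have hlt : v < baseV ℓ σ := by
        simp only [hb, Test.Holds, RExp.eval_pow, hgauge, RExp.eval, eval_baseE, State.setN_nat,
          Function.update_self, not_le] at ht
        exact Nat.lt_ceil.2 ht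
      refine ⟨_, _, ?_, hk _, v + 1, hlt, ?_, rfl⟩
      · omega
      · simp [NExp.eval, State.setN]) (baseV ℓ σ) σ
    ⟨0, Nat.zero_le _, by
      rw [State.setN, ← hσ, Function.update_eq_self], rfl⟩
  have hv : v = baseV ℓ σ := by
    refine le_antisymm hle (Nat.ceil_le.2 ?_)
    simpa only [hb, Test.Holds, RExp.eval_pow, hgauge, RExp.eval, eval_baseE, State.setN_nat,
      Function.update_self, not_not] using hb'
  rw [hv] at hr
  refine hr.mono ?_
  nlinarith [Nat.zero_le (baseV ℓ σ * k)]

/-- Computing the table of multiples of the number of components. -/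
theorem exists_computes_table : ∃ (p : Program) (K : ℕ), ∀ σ : State, σ.nat [10, 0] = 0 →
    ∃ σ', Runs p σ σ' (K * (σ.nat [1] + 1)) ∧ σ'.real = σ.real ∧
      (∀ ad, ad ≠ [12] → (∀ t, ad ≠ [10, t]) → σ'.nat ad = σ.nat ad) ∧
      ∀ t ≤ σ.nat [1], σ'.nat [10, t] = t * σ.nat [1] := by
  set v : NExp := .at [.const 12] with hv
  obtain ⟨k₀, hk₀⟩ := runs_assignN [.const 12] (.const 0)
  -- The machine does not multiply naturals: entry `t + 1` is entry `t` plus `R`.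
  obtain ⟨k₁, hk₁⟩ := runs_assignN [.const 10, .add v (.const 1)]
    (.add (.at [.const 10, v]) cardE)
  obtain ⟨k₂, hk₂⟩ := runs_assignN [.const 12] (.add v (.const 1))
  set b : Test := .neg (.leN cardE v) with hb
  set body : Program := .seq (assignN [.const 10, .add v (.const 1)]
    (.add (.at [.const 10, v]) cardE)) (assignN [.const 12] (.add v (.const 1))) with hbody
  have hve : ∀ σ : State, v.eval σ = σ.nat [12] := fun σ => by simp [hv, NExp.eval]
  refine ⟨.seq (assignN [.const 12] (.const 0)) (.while b body),
    k₀ + (1 + b.cost + (k₁ + k₂)), fun σ hσ => ?_⟩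
  let Inv : ℕ → State → Prop := fun m σ₁ => σ₁.real = σ.real ∧
    (∀ ad, ad ≠ [12] → (∀ t, ad ≠ [10, t]) → σ₁.nat ad = σ.nat ad) ∧
    σ₁.nat [12] ≤ σ.nat [1] ∧ m = σ.nat [1] - σ₁.nat [12] ∧
    ∀ t ≤ σ₁.nat [12], σ₁.nat [10, t] = t * σ.nat [1]
  obtain ⟨m, σ', hr, ⟨h1, h2, h3, -, h5⟩, hnb⟩ := Runs.while_counter (b := b) (p := body) Inv
    (k₁ + k₂) (by
      rintro m σ₁ ⟨h1, h2, h3, rfl, h5⟩ ht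
      have hcard : σ₁.nat [1] = σ.nat [1] := h2 _ (by simp) (by simp)
      have hlt : σ₁.nat [12] < σ.nat [1] := by
        simpa [hb, Test.Holds, hve, hcard] using ht
      refine ⟨_, _, ?_, (hk₁ σ₁).seq (hk₂ _), ?_, ?_, ?_, rfl, ?_⟩
      · simp [NExp.eval, hve]; omega
      · simp [h1]
      · intro ad ha hb
        simp [NExp.eval, hve, ha, hb, h2 ad ha hb]
      · simp [NExp.eval, hve]; omega
      · intro t ht
        simp only [List.map_cons, List.map_nil, NExp.eval, hve, NExp.eval_at, eval_cardE,
          State.setN_nat, Function.update_apply] at ht ⊢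
        simp at ht ⊢
        rcases eq_or_ne t (σ₁.nat [12] + 1) with rfl | hne
        · rw [if_pos rfl, h5 _ le_rfl, hcard]; ring
        · rw [if_neg hne, h5 t (by omega)])
    (σ.nat [1]) (σ.setN [12] 0) (by
      refine ⟨rfl, fun ad ha _ => by simp [ha], by simp, by simp, ?_⟩
      intro t ht
      have : t = 0 := by simpa using ht
      subst this
      simp [hσ])
  have hge : σ.nat [1] ≤ σ'.nat [12] := by
    simpa [hb, Test.Holds, hve, h2 [1] (by simp) (by simp)] using hnb
  have hr₀ := (hk₀ σ).seq (by simpa [NExp.eval] using hr)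
  refine ⟨σ', hr₀.mono ?_, h1, h2, fun t ht => h5 t (ht.trans hge)⟩
  nlinarith [Nat.zero_le (σ.nat [1] * k₀)]

/-- The first phase of the program. -/
theorem exists_prepares (ℓ : ℕ) : ∃ (p : Program) (K : ℕ), ∀ σ : State,
    (∀ ad, ad ≠ [0] → ad ≠ [1] → ad ≠ [2] → σ.nat ad = 0) →
    ∃ σ', Runs p σ σ' (K * (baseV ℓ σ + σ.nat [1] + 1)) ∧ Prepared σ (baseV ℓ σ) σ' ∧
      (∀ i, σ'.nat [7, i] = 0) ∧ σ'.nat [13] = 0 := by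
  obtain ⟨p₁, K₁, h₁⟩ := exists_computes_base ℓ
  obtain ⟨p₂, K₂, h₂⟩ := exists_computes_table
  refine ⟨.seq p₁ p₂, K₁ + K₂, fun σ hσ => ?_⟩
  obtain ⟨σ', hr, hreal, hnat, htab⟩ := h₂ (σ.setN [11] (baseV ℓ σ)) (by
    simp [hσ])
  refine ⟨σ', ((h₁ σ (hσ _ (by simp) (by simp) (by simp))).seq hr).mono ?_,
    ⟨fun ad _ _ _ => by rw [hreal]; rfl, ?_, ?_, ?_, ?_, ?_⟩, fun i => ?_, ?_⟩
  · simp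
    nlinarith [Nat.zero_le (K₁ * σ.nat [1]), Nat.zero_le (K₂ * baseV ℓ σ)]
  · rw [hnat _ (by simp) (by simp)]; simp
  · rw [hnat _ (by simp) (by simp)]; simp
  · rw [hnat _ (by simp) (by simp)]; simp
  · rw [hnat _ (by simp) (by simp)]; simp
  · intro t ht
    simpa using htab t (by simpa using ht)
  · rw [hnat _ (by simp) (by simp)]; simp [hσ]
  · rw [hnat _ (by simp) (by simp)]; simp [hσ]

/-! ### The search -/

/-- The digits of a successor: the carry stops at position `v`. -/
theorem digit_succ {L m v : ℕ} (hL : 1 ≤ L) (hdvd : L ^ v ∣ m + 1) (hv : m / L ^ v % L + 1 < L)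
    (p : ℕ) : (m + 1) / L ^ p % L =
      if p < v then 0 else if p = v then m / L ^ v % L + 1 else m / L ^ p % L := by
  obtain ⟨c, hc⟩ := hdvd
  have hpos : 0 < L ^ v := Nat.pow_pos hL
  have hdiv : (m + 1) / L ^ v = m / L ^ v + 1 := by
    rw [Nat.succ_div, if_pos ⟨c, hc⟩]
  split_ifs with h1 h2
  · obtain ⟨u, rfl⟩ := Nat.exists_eq_add_of_lt h1
    rw [hc, show L ^ (p + u + 1) * c = L ^ p * (L * (L ^ u * c)) by ring,
      Nat.mul_div_cancel_left _ (Nat.pow_pos hL), Nat.mul_mod_right]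
  · subst h2
    rw [hdiv, Nat.add_mod, Nat.mod_eq_of_lt (show 1 < L by omega), Nat.mod_eq_of_lt hv]
  · rw [Nat.succ_div, if_neg, add_zero]
    intro hdvd'
    have h3 : L ^ (v + 1) ∣ m + 1 := (pow_dvd_pow L (by omega)).trans hdvd'
    have h4 : L ∣ (m + 1) / L ^ v := by
      rw [pow_succ] at h3
      exact Nat.dvd_div_of_mul_dvd h3
    rw [hdiv] at h4
    have h5 := Nat.mod_eq_zero_of_dvd h4
    rw [Nat.add_mod, Nat.mod_eq_of_lt (show 1 < L by omega), Nat.mod_eq_of_lt hv] at h5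
    omega

/-- A carry. -/
theorem pow_succ_dvd_succ {L m v : ℕ} (hL : 1 ≤ L) (hdvd : L ^ v ∣ m + 1)
    (hv : L ≤ m / L ^ v % L + 1) : L ^ (v + 1) ∣ m + 1 := by
  have hdiv : (m + 1) / L ^ v = m / L ^ v + 1 := by
    rw [Nat.succ_div, if_pos hdvd]
  have h1 : m / L ^ v % L + 1 = L := by
    have := Nat.mod_lt (m / L ^ v) hL
    omega
  have h2 : L ∣ (m + 1) / L ^ v := by
    rw [hdiv, ← Nat.mod_add_div (m / L ^ v) L]
    exact ⟨1 + m / L ^ v / L, by nlinarith⟩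
  rw [pow_succ]
  obtain ⟨c, hc⟩ := h2
  exact ⟨c, by rw [mul_assoc, ← hc, Nat.mul_div_cancel' hdvd]⟩

/-- The number of digits. -/
def digitsCount (ℓ R : ℕ) : ℕ := (ℓ + ℓ * ℓ + 1) * (R * R)

/-- The number of digits, as an expression. -/
def digitsE (ℓ : ℕ) : NExp := NExp.nsmul (.at [.const 10, cardE]) (ℓ + ℓ * ℓ + 1)

theorem Prepared.eval_digitsE {σ₀ σ : State} {L : ℕ} (h : Prepared σ₀ L σ) (ℓ : ℕ) :
    (digitsE ℓ).eval σ = digitsCount ℓ (σ₀.nat [1]) := by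
  simp [digitsE, digitsCount, NExp.eval, h.card, h.table _ le_rfl]

/-- Passing to the next code. -/
theorem exists_increments (ℓ : ℕ) : ∃ (p : Program) (K : ℕ), ∀ (σ₀ : State) (L m : ℕ) (σ : State),
    1 ≤ L → Prepared σ₀ L σ → (∀ i, σ.nat [7, i] = m / L ^ i % L) → σ.nat [13] = 0 →
    m < L ^ digitsCount ℓ (σ₀.nat [1]) →
    ∃ σ', Runs p σ σ' (K * (digitsCount ℓ (σ₀.nat [1]) + 1)) ∧ Prepared σ₀ L σ' ∧
      ((m + 1 < L ^ digitsCount ℓ (σ₀.nat [1]) ∧ (∀ i, σ'.nat [7, i] = (m + 1) / L ^ i % L) ∧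
        σ'.nat [13] = 0) ∨ (m + 1 = L ^ digitsCount ℓ (σ₀.nat [1]) ∧ σ'.nat [13] = 1)) := by
  set v : NExp := .at [.const 12] with hv
  have hve : ∀ σ : State, v.eval σ = σ.nat [12] := fun σ => by simp [hv, NExp.eval]
  obtain ⟨k₀, hk₀⟩ := runs_assignN [.const 12] (.const 0)
  obtain ⟨k₁, hk₁⟩ := runs_assignN [.const 7, v] (.const 0)
  obtain ⟨k₂, hk₂⟩ := runs_assignN [.const 12] (.add v (.const 1))
  obtain ⟨k₃, hk₃⟩ := runs_assignN [.const 13] (.const 1)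
  obtain ⟨k₄, hk₄⟩ := runs_assignN [.const 7, v] (.add (.at [.const 7, v]) (.const 1))
  -- An odometer: digits equal to `L - 1` are reset to 0 until one can be raised. If the position
  -- runs past the last digit, all codes are exhausted and the flag in cell `(13)` is set.
  set b : Test := .conj (.neg (.leN (digitsE ℓ) v))
    (.leN baseE (.add (.at [.const 7, v]) (.const 1))) with hb
  set body : Program := .seq (assignN [.const 7, v] (.const 0))
    (assignN [.const 12] (.add v (.const 1))) with hbody
  set b' : Test := .leN (digitsE ℓ) v with hb'
  refine ⟨.seq (assignN [.const 12] (.const 0)) (.seq (.while b body)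
    (.ite b' (assignN [.const 13] (.const 1))
      (assignN [.const 7, v] (.add (.at [.const 7, v]) (.const 1))))),
    k₀ + (1 + b.cost + (k₁ + k₂) + (1 + b'.cost + (k₃ + k₄))), ?_⟩
  intro σ₀ L m σ hL hP hdg hflag hm
  set D := digitsCount ℓ (σ₀.nat [1]) with hD
  let Inv : ℕ → State → Prop := fun c σ₁ => Prepared σ₀ L σ₁ ∧ σ₁.nat [13] = 0 ∧
    σ₁.nat [12] ≤ D ∧ c = D - σ₁.nat [12] ∧ L ^ σ₁.nat [12] ∣ m + 1 ∧
    ∀ i, σ₁.nat [7, i] = if i < σ₁.nat [12] then 0 else m / L ^ i % L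
  obtain ⟨c, σ₁, hr, ⟨h1, h2, h3, -, h5, h6⟩, hnb⟩ := Runs.while_counter (b := b) (p := body) Inv
    (k₁ + k₂) (by
      rintro c σ₁ ⟨h1, h2, h3, rfl, h5, h6⟩ ht
      simp only [hb, hb', Test.Holds, hve, h1.eval_digitsE, NExp.eval, eval_baseE, h1.base,
        NExp.eval_at, List.map_cons, List.map_nil, h6, lt_irrefl, if_false] at ht
      obtain ⟨ht1, ht2⟩ := ht
      refine ⟨_, _, ?_, (hk₁ σ₁).seq (hk₂ _),
        (h1.setN _ (.inr (.inr ⟨σ₁.nat [12], ?_⟩))).setN _ (.inl ?_), ?_, ?_, rfl, ?_, ?_⟩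
      · simp [NExp.eval, hve]; omega
      · simp [NExp.eval, hve]
      · simp [NExp.eval]
      · simp [NExp.eval, hve, h2]
      · simp [NExp.eval, hve]; omega
      · simpa [NExp.eval, hve] using pow_succ_dvd_succ hL h5 ht2
      · intro i
        simp only [List.map_cons, List.map_nil, NExp.eval, hve, State.setN_nat,
          Function.update_apply]
        simp only [List.cons.injEq, and_true, true_and, reduceCtorEq, and_false, if_false,
          if_true, h6, Nat.reduceEqDiff]
        simp
        rcases lt_trichotomy i (σ₁.nat [12]) with hi | hi | hi
        · rw [if_neg hi.ne, if_pos hi, if_pos (by omega)]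
        · rw [if_pos hi, if_pos (by omega)]
        · rw [if_neg hi.ne', if_neg (by omega), if_neg (by omega)])
    D (σ.setN [12] 0) ⟨hP.setN _ (.inl rfl), by simp [hflag], by simp,
      by simp, by simp, fun i => by simp [hdg]⟩
  have hbound : D * (1 + b.cost + (k₁ + k₂)) + (1 + b.cost) ≤
      (1 + b.cost + (k₁ + k₂)) * (D + 1) := by nlinarith
  simp only [hb, hb', Test.Holds, hve, h1.eval_digitsE, NExp.eval, eval_baseE, h1.base,
    NExp.eval_at, List.map_cons, List.map_nil, h6, lt_irrefl, if_false] at hnb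
  by_cases hfin : D ≤ σ₁.nat [12]
  · have hite : b'.Holds σ₁ := by simpa [hb', Test.Holds, hve, h1.eval_digitsE] using hfin
    refine ⟨_, ((hk₀ σ).seq ((show Runs _ _ σ₁ _ by simpa [NExp.eval] using hr).seq
      (Runs.ite_true hite (hk₃ σ₁)))).mono ?_, h1.setN _ (.inr (.inl ?_)), .inr ⟨?_, ?_⟩⟩
    · nlinarith [Nat.zero_le (k₀ * D), Nat.zero_le ((1 + b'.cost + (k₃ + k₄)) * D)]
    · simp [NExp.eval]
    · have : σ₁.nat [12] = D := le_antisymm h3 hfin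
      rw [this] at h5
      exact le_antisymm hm (Nat.le_of_dvd (by omega) h5)
    · simp [NExp.eval]
  · have hite : ¬ b'.Holds σ₁ := by simpa [hb', Test.Holds, hve, h1.eval_digitsE] using hfin
    have hcarry : m / L ^ σ₁.nat [12] % L + 1 < L := by
      by_contra hcon
      exact hnb ⟨hfin, not_lt.1 hcon⟩
    refine ⟨_, ((hk₀ σ).seq ((show Runs _ _ σ₁ _ by simpa [NExp.eval] using hr).seq
      (Runs.ite_false hite (hk₄ σ₁)))).mono ?_, h1.setN _ (.inr (.inr ⟨σ₁.nat [12], ?_⟩)),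
      .inl ⟨?_, fun i => ?_, ?_⟩⟩
    · nlinarith [Nat.zero_le (k₀ * D), Nat.zero_le ((1 + b'.cost + (k₃ + k₄)) * D)]
    · simp [NExp.eval, hve]
    · refine lt_of_le_of_ne hm fun heq => ?_
      have hd : L ^ (σ₁.nat [12] + 1) ∣ m + 1 := by
        rw [heq]; exact pow_dvd_pow L (by omega)
      have := digit_succ hL h5 hcarry (σ₁.nat [12])
      simp only [lt_irrefl, if_false, if_true] at this
      have h7 : L ∣ (m + 1) / L ^ σ₁.nat [12] := by
        rw [pow_succ] at hd
        exact Nat.dvd_div_of_mul_dvd hd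
      rw [Nat.mod_eq_zero_of_dvd h7] at this
      omega
    · rw [digit_succ hL h5 hcarry]
      simp only [List.map_cons, List.map_nil, NExp.eval, hve, NExp.eval_at,
        State.setN_nat, Function.update_apply]
      simp
      rcases lt_trichotomy i (σ₁.nat [12]) with hi | hi | hi
      · rw [if_neg hi.ne, if_pos hi, h6, if_pos hi]
      · rw [if_pos hi, if_neg (by omega), if_pos hi, h6]; simp
      · rw [if_neg hi.ne', if_neg (by omega), if_neg hi.ne', h6, if_neg (by omega)]
    · simp [NExp.eval, hve, h2]

/-- The digits in the state `σ` encode a decomposition that passes the test for the input in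
`σ₀`. -/
def Passing (ℓ : ℕ) (σ₀ : State) (L : ℕ) (dg : ℕ → ℕ) : Prop :=
  CodePasses (σ₀.nat [0]) (σ₀.nat [1]) L ((gaugeE ℓ).eval σ₀ ^ (2 * ℓ + 1))
    ((gaugeE ℓ).eval σ₀ ^ (9 * ℓ + 41))⁻¹ (fun I => momentV ℓ I σ₀) dg

theorem digitsCount_add_one_le (ℓ : ℕ) {σ : State} (hv : Valid σ) :
    digitsCount ℓ (σ.nat [1]) + 1 ≤ (ℓ + ℓ * ℓ + 2) * costUnit 0 2 1 σ := by
  have h1 : (1 : ℕ) ≤ costUnit 0 2 1 σ := one_le_costUnit hv _ _ _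
  have h2 : σ.nat [1] * σ.nat [1] ≤ costUnit 0 2 1 σ := by
    simp only [costUnit, pow_zero, one_mul, pow_one, ← pow_two]
    exact Nat.le_mul_of_pos_right _ hv.2
  rw [digitsCount]
  nlinarith [Nat.mul_le_mul_left (ℓ + ℓ * ℓ + 1) h2]

/-- The exhaustive search. -/
theorem exists_searches (ℓ : ℕ) : ∃ (p : Program) (K e : ℕ), ∀ (σ₀ : State) (L : ℕ) (σ : State),
    Valid σ₀ → 1 ≤ L → Prepared σ₀ L σ → (∀ i, σ.nat [7, i] = 0) → σ.nat [13] = 0 →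
    ∃ σ', Runs p σ σ' (K * costUnit e 2 1 σ₀ * (L ^ digitsCount ℓ (σ₀.nat [1]) + 1)) ∧
      Prepared σ₀ L σ' ∧
      ((∃ m < L ^ digitsCount ℓ (σ₀.nat [1]), Passing ℓ σ₀ L fun i => m / L ^ i % L) →
        ∃ m < L ^ digitsCount ℓ (σ₀.nat [1]), (Passing ℓ σ₀ L fun i => m / L ^ i % L) ∧
          ∀ i, σ'.nat [7, i] = m / L ^ i % L) := by
  obtain ⟨pt, Kt, et, hpt⟩ := (computable_testV ℓ).2 0 le_rfl
  obtain ⟨pi, Ki, hpi⟩ := exists_increments ℓ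
  obtain ⟨k, hk⟩ := runs_assignN [.const 13] (.const 1)
  set b : Test := .leN (.at [.const 13]) (.const 0) with hb
  have hbe : ∀ σ : State, b.Holds σ ↔ σ.nat [13] = 0 := fun σ => by
    simp [hb, Test.Holds, NExp.eval]
  set bt : Test := .leR (.at [.const 9, .const 0]) (.const 0) with hbt
  have hbte : ∀ σ : State, bt.Holds σ ↔ σ.real [9, 0] ≤ 0 := fun σ => by
    simp [hbt, Test.Holds, NExp.eval, RExp.eval]
  set body : Program := .seq pt (.ite bt (assignN [.const 13] (.const 1)) pi) with hbody
  refine ⟨.while b body, 1 + b.cost + (Kt + (1 + bt.cost + (k + Ki * (ℓ + ℓ * ℓ + 2)))), et, ?_⟩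
  intro σ₀ L σ hv hL hP hdg hflag
  set D := digitsCount ℓ (σ₀.nat [1]) with hD
  set u := costUnit et 2 1 σ₀ with hu
  have hu1 : 1 ≤ u := one_le_costUnit hv _ _ _
  have huD : D + 1 ≤ (ℓ + ℓ * ℓ + 2) * u := (digitsCount_add_one_le ℓ hv).trans
    (Nat.mul_le_mul_left _ (costUnit_mono hv (Nat.zero_le _) le_rfl le_rfl))
  -- While the flag is 0, all codes below the current one have failed. Once it is 1, either the
  -- digits hold a passing code or none exists and the conclusion is vacuous; the search halts in
  -- both cases.
  let Inv : ℕ → State → Prop := fun c σ₁ => Prepared σ₀ L σ₁ ∧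
    ((σ₁.nat [13] = 0 ∧ ∃ m < L ^ D, c = L ^ D - m ∧ (∀ i, σ₁.nat [7, i] = m / L ^ i % L) ∧
      ∀ m' < m, ¬ Passing ℓ σ₀ L fun i => m' / L ^ i % L) ∨
    (σ₁.nat [13] = 1 ∧ ((∃ m < L ^ D, Passing ℓ σ₀ L fun i => m / L ^ i % L) →
        ∃ m < L ^ D, (Passing ℓ σ₀ L fun i => m / L ^ i % L) ∧
          ∀ i, σ₁.nat [7, i] = m / L ^ i % L)))
  obtain ⟨c, σ', hr, ⟨h1, h2⟩, hnb⟩ := Runs.while_counter (b := b) (p := body) Inv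
    ((Kt + (1 + bt.cost + (k + Ki * (ℓ + ℓ * ℓ + 2)))) * u) (by
      rintro c σ₁ ⟨h1, h2⟩ ht
      rw [hbe] at ht
      rcases h2 with ⟨-, m, hm, rfl, hdg₁, hno⟩ | ⟨h2, -⟩
      swap
      · omega
      have hv₁ : Valid σ₁ := by rw [Valid, h1.card, h1.samples]; exact hv
      have hu' : costUnit et 2 1 σ₁ = u := by
        rw [hu, costUnit, costUnit, h1.dim, h1.card, h1.samples]
      obtain ⟨σ₂, hr₂, hf₂, hval⟩ := hpt σ₁ hv₁
      rw [hu'] at hr₂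
      have h1' := h1.of_sim hf₂.sim
      have hdg₂ : ∀ i, σ₂.nat [7, i] = m / L ^ i % L := fun i => by
        rw [hf₂.nat _ (by simp), hdg₁]
      have hflag₂ : σ₂.nat [13] = 0 := by rw [hf₂.nat _ (by simp), ht]
      have hpass : bt.Holds σ₂ ↔ Passing ℓ σ₀ L fun i => m / L ^ i % L := by
        rw [hbte, hval, h1.testV_le_zero_iff, Passing]
        simp only [hdg₁]
      by_cases hp : bt.Holds σ₂
      · refine ⟨0, _, by omega, (hr₂.seq (Runs.ite_true hp (hk σ₂))).mono ?_,
          h1'.setN _ (.inr (.inl (by simp [NExp.eval]))), .inr ⟨by simp [NExp.eval], fun _ =>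
            ⟨m, hm, hpass.1 hp, fun i => by simp [NExp.eval, hdg₂]⟩⟩⟩
        nlinarith [Nat.zero_le (bt.cost * u), Nat.le_mul_of_pos_right (1 + bt.cost + k) hu1,
          Nat.zero_le (Ki * (ℓ + ℓ * ℓ + 2) * u)]
      · obtain ⟨σ₃, hr₃, h1₃, hcase⟩ := hpi σ₀ L m σ₂ hL h1' hdg₂ hflag₂ hm
        have htime : Kt * u + (1 + bt.cost + Ki * (D + 1)) ≤
            (Kt + (1 + bt.cost + (k + Ki * (ℓ + ℓ * ℓ + 2)))) * u := by
          have e1 := Nat.mul_le_mul_left Ki huD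
          have e2 := Nat.le_mul_of_pos_right (1 + bt.cost) hu1
          calc _ ≤ Kt * u + ((1 + bt.cost) * u + Ki * ((ℓ + ℓ * ℓ + 2) * u)) := by omega
            _ ≤ Kt * u + ((1 + bt.cost) * u + Ki * ((ℓ + ℓ * ℓ + 2) * u)) + k * u :=
              Nat.le_add_right _ _
            _ = _ := by ring
        have hno' : ∀ m' < m + 1, ¬ Passing ℓ σ₀ L fun i => m' / L ^ i % L := by
          intro m' hm'
          rcases Nat.lt_succ_iff_lt_or_eq.1 hm' with h | rfl
          · exact hno m' h
          · exact fun h => hp (hpass.2 h)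
        rcases hcase with ⟨hlt, hdg₃, hflag₃⟩ | ⟨heq, hflag₃⟩
        · exact ⟨L ^ D - (m + 1), σ₃, by omega, (hr₂.seq (Runs.ite_false hp hr₃)).mono htime,
            h1₃, .inl ⟨hflag₃, m + 1, hlt, rfl, hdg₃, hno'⟩⟩
        · refine ⟨0, σ₃, by omega, (hr₂.seq (Runs.ite_false hp hr₃)).mono htime,
            h1₃, .inr ⟨hflag₃, ?_⟩⟩
          rintro ⟨m', hm', hp'⟩
          exact absurd hp' (hno' m' (hm'.trans_eq heq.symm)))
    (L ^ D) σ ⟨hP, .inl ⟨hflag, 0, Nat.pow_pos hL, by simp, fun i => by simp [hdg],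
      by simp⟩⟩
  refine ⟨σ', hr.mono ?_, h1, ?_⟩
  · have e1 := Nat.le_mul_of_pos_right (1 + b.cost) hu1
    set Q := (Kt + (1 + bt.cost + (k + Ki * (ℓ + ℓ * ℓ + 2)))) with hQ
    calc L ^ D * (1 + b.cost + Q * u) + (1 + b.cost)
        ≤ L ^ D * ((1 + b.cost) * u + Q * u) + ((1 + b.cost) * u + Q * u) := by
          refine Nat.add_le_add (Nat.mul_le_mul_left _ ?_) ?_ <;> omega
      _ = (1 + b.cost + Q) * u * (L ^ D + 1) := by ring
  · rw [hbe] at hnb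
    rcases h2 with ⟨h, -⟩ | ⟨-, h⟩
    · exact absurd h hnb
    · exact h

/-! ### The output -/

/-- A program that writes the values `val ad σ` to the output cells `ad ∈ W σ`. -/
def Emits (val : List ℕ → State → ℝ) (d F g : ℕ) (W : State → Set (List ℕ)) : Prop :=
  Stable d W ∧ ∃ (p : Program) (K e : ℕ), ∀ σ, Valid σ → ∃ σ', Runs p σ σ' (K * costUnit e F g σ) ∧
    Sim d σ σ' ∧ (∀ ad ∈ W σ, σ'.real ad = val ad σ) ∧
    ∀ ad, ad ∉ W σ → (∀ e, ad ≠ [9, e]) → σ'.real ad = σ.real ad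

namespace Emits

variable {val : List ℕ → State → ℝ} {d F g : ℕ}

theorem seq {W₁ W₂ : State → Set (List ℕ)} (hval : ∀ ad, Stable d (val ad))
    (hW : ∀ σ, ∀ ad ∈ W₁ σ, ∀ e, ad ≠ [9, e])
    (h₁ : Emits val d F g W₁) (h₂ : Emits val d F g W₂) :
    Emits val d F g fun σ => W₁ σ ∪ W₂ σ := by
  obtain ⟨hs₁, p₁, K₁, e₁, hp₁⟩ := h₁
  obtain ⟨hs₂, p₂, K₂, e₂, hp₂⟩ := h₂
  refine ⟨fun σ σ' h => by simp only [hs₁ σ σ' h, hs₂ σ σ' h], .seq p₁ p₂, K₁ + K₂, e₁ + e₂,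
    fun σ hv => ?_⟩
  obtain ⟨σ₁, hr₁, hS₁, hin₁, hout₁⟩ := hp₁ σ hv
  obtain ⟨σ₂, hr₂, hS₂, hin₂, hout₂⟩ := hp₂ σ₁ (hS₁.valid hv)
  rw [hs₂ σ σ₁ hS₁] at hin₂ hout₂
  refine ⟨σ₂, (hr₁.seq hr₂).mono ?_, hS₁.trans hS₂, fun ad had => ?_, fun ad had h9 => ?_⟩
  · rw [hS₁.costUnit, add_mul]
    exact Nat.add_le_add (Nat.mul_le_mul_left _ (costUnit_mono hv (by omega) le_rfl le_rfl))
      (Nat.mul_le_mul_left _ (costUnit_mono hv (by omega) le_rfl le_rfl))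
  · by_cases h2 : ad ∈ W₂ σ
    · rw [hin₂ ad h2, hval ad σ σ₁ hS₁]
    · have h1 := had.resolve_right h2
      rw [hout₂ ad h2 (hW σ ad h1), hin₁ ad h1]
  · rw [hout₂ ad (fun h => had (.inr h)) h9, hout₁ ad (fun h => had (.inl h)) h9]

theorem of_computable {f : State → ℝ} (hf : Computable d F g f) (c : ℕ) (hc : c = 5 ∨ c = 6)
    (idx : List NExp) (hidx : ∀ x ∈ idx, Stable d x.eval)
    (hval : ∀ σ, val (c :: idx.map (NExp.eval σ)) σ = f σ) :
    Emits val d F g fun σ => {c :: idx.map (NExp.eval σ)} := by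
  have hst := Stable.map_eval hidx
  obtain ⟨p, K, e, hp⟩ := hf.2 d le_rfl
  obtain ⟨k, hk⟩ := runs_assignR (.const c :: idx) (.at [.const 9, .const d])
  refine ⟨fun σ σ' h => by simp only [hst σ σ' h], .seq p (assignR (.const c :: idx)
    (.at [.const 9, .const d])), K + k, e, fun σ hv => ?_⟩
  obtain ⟨σ₁, hr, hF, hv₁⟩ := hp σ hv
  have had : (NExp.const c :: idx).map (NExp.eval σ₁) = c :: idx.map (NExp.eval σ) := by
    have := hst σ σ₁ hF.sim
    simp only at this
    simp [NExp.eval, this]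
  have hne : ∀ e, c :: idx.map (NExp.eval σ) ≠ [9, e] := by
    intro e h
    simp only [List.cons.injEq] at h
    omega
  have hval₁ : (RExp.at [.const 9, .const d]).eval σ₁ = f σ := by
    simp [NExp.eval, hv₁]
  refine ⟨_, (hr.seq (hk σ₁)).mono ?_, ?_, fun ad h => ?_, fun ad h h9 => ?_⟩
  · rw [add_mul]
    exact Nat.add_le_add_left (Nat.le_mul_of_pos_right _ (one_le_costUnit hv _ _ _)) _
  · refine hF.sim.trans ⟨fun _ _ => rfl, fun ad h1 h2 h3 => ?_⟩
    rw [State.setR_real, Function.update_of_ne]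
    rw [had]
    rcases hc with rfl | rfl
    · exact h2 _
    · exact h3 _
  · rw [Set.mem_singleton_iff.1 h, State.setR_real, had, Function.update_self, hval₁, hval]
  · rw [State.setR_real, had, Function.update_of_ne h, hF.real _ fun e _ => h9 e]

/-- A loop that emits. -/
theorem loop {F' g' : ℕ} {W : ℕ → State → Set (List ℕ)} (b : NExp) (hb : Stable d b.eval)
    (hbound : ∃ K e, ∀ σ, Valid σ → ∀ e', b.eval σ * costUnit e' F g σ ≤
      K * costUnit (e + e') F' g' σ)
    (hval : ∀ ad, Stable d (val ad)) (hW : ∀ i σ, ∀ ad ∈ W i σ, ∀ e, ad ≠ [9, e])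
    (hs : ∀ i, Stable d (W i))
    (h : ∀ x : NExp, Stable (d + 1) x.eval → Emits val (d + 1) F g fun σ => W (x.eval σ) σ) :
    Emits val d F' g' fun σ => {ad | ∃ i < b.eval σ, ad ∈ W i σ} := by
  have hx : Stable (d + 1) (NExp.at [.const 8, .const d]).eval := fun σ σ' hs => by
    simp only [NExp.eval_at]
    exact hs.nat _ fun e he => by simp [NExp.eval]; omega
  obtain ⟨-, p, K, e, hp⟩ := h _ hx
  obtain ⟨Kb, eb, hKb⟩ := hbound
  set x : NExp := .at [.const 8, .const d] with hxdef
  have hxe : ∀ σ : State, x.eval σ = σ.nat [8, d] := fun σ => by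
    simp [hxdef, NExp.eval]
  obtain ⟨k₁, hk₁⟩ := runs_assignN [.const 8, .const d] (.const 0)
  obtain ⟨k₂, hk₂⟩ := runs_assignN [.const 8, .const d] (.add x (.const 1))
  set t : Test := .neg (.leN b x) with ht
  set body : Program := .seq p (assignN [.const 8, .const d] (.add x (.const 1))) with hbody
  refine ⟨fun σ σ' h => by
    have := hb σ σ' h
    simp only at this
    simp only [this, hs _ σ σ' h], .seq (assignN [.const 8, .const d] (.const 0))
    (.while t body), k₁ + ((1 + t.cost + (K + k₂)) * Kb + (1 + t.cost)), eb + e, fun σ hv => ?_⟩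
  have hone := one_le_costUnit hv (eb + e) F' g'
  let Inv : ℕ → State → Prop := fun c σ₁ => Sim d σ σ₁ ∧ σ₁.nat [8, d] ≤ b.eval σ ∧
    c = b.eval σ - σ₁.nat [8, d] ∧
    (∀ ad, (∃ i < σ₁.nat [8, d], ad ∈ W i σ) → σ₁.real ad = val ad σ) ∧
    ∀ ad, (¬ ∃ i < σ₁.nat [8, d], ad ∈ W i σ) → (∀ e, ad ≠ [9, e]) → σ₁.real ad = σ.real ad
  obtain ⟨c, σ', hr, ⟨h1, h2, -, h4, h5⟩, hnt⟩ := Runs.while_counter (b := t) (p := body) Inv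
    ((K + k₂) * costUnit e F g σ) (by
    rintro c σ₁ ⟨h1, h2, rfl, h4, h5⟩ htt
    have hlt : σ₁.nat [8, d] < b.eval σ := by
      simp only [ht, Test.Holds, hxe] at htt
      have := hb σ σ₁ h1
      simp only at this
      rw [this] at htt
      omega
    obtain ⟨σ₂, hr₂, hS₂, hin, hout⟩ := hp σ₁ (h1.valid hv)
    have e1 : σ₂.nat [8, d] = σ₁.nat [8, d] := hS₂.nat _ fun e he => by simp; omega
    simp only [hxe] at hin hout
    rw [hs _ σ σ₁ h1] at hin hout
    refine ⟨_, _, ?_, (hr₂.seq (hk₂ σ₂)).mono ?_,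
      (h1.trans (hS₂.mono (by omega))).trans (frame_setN le_rfl _ _).sim, ?_, rfl, ?_, ?_⟩
    · simp [NExp.eval, hxe, e1]; omega
    · rw [h1.costUnit, add_mul]
      exact Nat.add_le_add_left (Nat.le_mul_of_pos_right _ (one_le_costUnit hv _ _ _)) _
    · simp [NExp.eval, hxe, e1]; omega
    · rintro ad ⟨i, hi, hiW⟩
      simp only [State.setN_real]
      by_cases hcur : ad ∈ W (σ₁.nat [8, d]) σ
      · rw [hin ad hcur, hval ad σ σ₁ h1]
      · rw [hout ad hcur (hW i σ ad hiW)]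
        refine h4 ad ⟨i, ?_, hiW⟩
        have hi' : i < σ₁.nat [8, d] + 1 := by simpa [NExp.eval, hxe, e1] using hi
        rcases Nat.lt_succ_iff_lt_or_eq.1 hi' with h | rfl
        · exact h
        · exact absurd hiW hcur
    · intro ad had h9
      have had' : ¬ ∃ i < σ₁.nat [8, d] + 1, ad ∈ W i σ := by
        simpa [NExp.eval, hxe, e1] using had
      simp only [State.setN_real]
      rw [hout ad (fun h => had' ⟨_, Nat.lt_succ_self _, h⟩) h9]
      exact h5 ad (fun ⟨i, hi, hiW⟩ => had' ⟨i, by omega, hiW⟩) h9)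
    (b.eval σ) (σ.setN [8, d] 0) ⟨(frame_setN le_rfl _ _).sim, by simp, by simp, by simp,
      fun _ _ _ => rfl⟩
  have hend : σ'.nat [8, d] = b.eval σ := by
    simp only [ht, Test.Holds, hxe, not_not] at hnt
    have := hb σ σ' h1
    simp only at this
    rw [this] at hnt
    omega
  rw [hend] at h4 h5
  refine ⟨σ', ((hk₁ σ).seq (show Runs _ _ σ' _ by simpa [NExp.eval] using hr)).mono ?_, h1, h4, h5⟩
  have e1 := hKb σ hv e
  set Q := 1 + t.cost + (K + k₂) with hQ
  have e2 : 1 + t.cost + (K + k₂) * costUnit e F g σ ≤ Q * costUnit e F g σ := by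
    rw [hQ, add_mul (1 + t.cost)]
    have := Nat.le_mul_of_pos_right (1 + t.cost) (one_le_costUnit hv e F g)
    omega
  have e3 : b.eval σ * (Q * costUnit e F g σ) ≤ Q * Kb * costUnit (eb + e) F' g' σ := by
    calc b.eval σ * (Q * costUnit e F g σ) = Q * (b.eval σ * costUnit e F g σ) := by ring
      _ ≤ Q * (Kb * costUnit (eb + e) F' g' σ) := Nat.mul_le_mul_left _ e1
      _ = _ := by ring
  have e4 := Nat.mul_le_mul_left (b.eval σ) e2
  have e5 := Nat.le_mul_of_pos_right (k₁ + (1 + t.cost)) hone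
  calc _ ≤ k₁ + (Q * Kb * costUnit (eb + e) F' g' σ + (1 + t.cost)) := by omega
    _ ≤ Q * Kb * costUnit (eb + e) F' g' σ + (k₁ + (1 + t.cost)) * costUnit (eb + e) F' g' σ := by
      omega
    _ = _ := by ring

end Emits

end RealRAM

/-! ### The output cells and the complete program -/

namespace RealRAM

/-- The value of an output cell. -/
def outputV (ℓ : ℕ) (ad : List ℕ) (σ : State) : ℝ :=
  match ad with
  | [_, j, i, r] => if hj : j < ℓ then σ.real [3] * factorV ℓ ⟨j, hj⟩ r (i + 1) σ else 0
  | [_, r] => weightV ℓ σ r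
  | _ => 0

theorem computable_scaled_factorV (ℓ : ℕ) {d : ℕ} (j : Fin ℓ) (r i : NExp)
    (hr : Stable d r.eval) (hi : Stable d i.eval) :
    Computable d 1 1 fun σ => σ.real [3] * factorV ℓ j (r.eval σ) (i.eval σ + 1) σ := by
  refine (Computable.mul (Computable.of_exp (.at [.const 3]) (stable_atR (by norm_num) (by simp)))
    (computable_factorV ℓ j r (.add i (.const 1)) hr (hi.addN (stable_constN 1)))).congr
    fun σ => ?_
  simp [NExp.eval]

theorem stable_outputV (ℓ : ℕ) (ad : List ℕ) {d : ℕ} : Stable d (outputV ℓ ad) := by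
  intro σ σ' h
  unfold outputV
  split
  · split_ifs with hj
    · exact (computable_scaled_factorV ℓ ⟨_, hj⟩ (.const _) (.const _) (stable_constN _)
        (stable_constN _)).1 σ σ' h
    · rfl
  · exact (computable_weightV (F := 0) (g := 0) ℓ (.const _) (stable_constN _)).1 σ σ' h
  · rfl

theorem emits_mean (ℓ : ℕ) (j : Fin ℓ) : Emits (outputV ℓ) 0 2 1
    fun σ => {ad | ∃ i < dimE.eval σ, ad ∈ {ad | ∃ r < cardE.eval σ, ad ∈ ({[5, (j : ℕ), i, r]} :
      Set (List ℕ))}} := by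
  refine Emits.loop (F := 2) (g := 1)
    (W := fun i σ => {ad | ∃ r < cardE.eval σ, ad ∈ ({[5, (j : ℕ), i, r]} : Set (List ℕ))})
    dimE stable_dimE ⟨1, 1, fun σ hv e' => ?_⟩ (fun ad => stable_outputV ℓ ad)
    ?_ ?_ fun x hx => ?_
  · have : σ.nat [0] * costUnit e' 2 1 σ ≤ (σ.nat [0] + 1) * costUnit e' 2 1 σ :=
      Nat.mul_le_mul_right _ (Nat.le_succ _)
    rw [eval_dimE]
    refine this.trans (le_of_eq ?_)
    simp only [costUnit]; ring
  · rintro i σ ad ⟨r, -, rfl⟩ e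
    simp
  · intro i σ σ' h
    have := stable_cardE (d := 0) σ σ' h
    simp only at this
    simp only [this]
  · refine Emits.loop (F := 1) (g := 1)
      (W := fun r σ => ({[5, (j : ℕ), x.eval σ, r]} : Set (List ℕ)))
      cardE stable_cardE ⟨1, 0, fun σ hv e' => ?_⟩ (fun ad => stable_outputV ℓ ad) ?_ ?_
      fun y hy => ?_
    · rw [eval_cardE, costUnit, costUnit]
      exact le_of_eq (by ring)
    · rintro i σ ad rfl e
      simp
    · intro r σ σ' h
      have := hx σ σ' h
      simp only at this
      simp only [this]
    · have hx' := hx.mono (show 0 + 1 ≤ 0 + 1 + 1 by omega)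
      have := Emits.of_computable (val := outputV ℓ)
        (computable_scaled_factorV ℓ j y x hy hx') 5 (.inl rfl)
        [.const j, x, y] (by
          simp only [List.mem_cons, List.not_mem_nil, or_false, forall_eq_or_imp, forall_eq]
          exact ⟨stable_constN _, hx', hy⟩) (fun σ => by
          simp [outputV, NExp.eval])
      simpa [NExp.eval] using this

theorem emits_weight (ℓ : ℕ) : Emits (outputV ℓ) 0 2 1
    fun σ => {ad | ∃ r < cardE.eval σ, ad ∈ ({[6, r]} : Set (List ℕ))} := by
  refine Emits.loop (F := 1) (g := 1) (W := fun r _ => ({[6, r]} : Set (List ℕ)))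
      cardE stable_cardE ⟨1, 0, fun σ hv e' => ?_⟩ (fun ad => stable_outputV ℓ ad) ?_ ?_
      fun y hy => ?_
  · rw [eval_cardE, costUnit, costUnit]
    exact le_of_eq (by ring)
  · rintro i σ ad rfl e
    simp
  · intro r σ σ' h
    rfl
  · have := Emits.of_computable (val := outputV ℓ)
      (computable_weightV (F := 1) (g := 1) ℓ y hy) 6 (.inr rfl)
      [y] (by simpa using hy) (fun σ => by simp [outputV])
    simpa [NExp.eval] using this

/-- As `ℓ` is fixed, the loop over the views is unrolled in the text of the program, one block for
each `j`. -/
theorem emits_means (ℓ : ℕ) (s : Finset (Fin ℓ)) : Emits (outputV ℓ) 0 2 1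
    fun σ => {ad | ∃ j ∈ s, ∃ i < dimE.eval σ, ∃ r < cardE.eval σ, ad = [5, (j : ℕ), i, r]} ∪
      {ad | ∃ r < cardE.eval σ, ad ∈ ({[6, r]} : Set (List ℕ))} := by
  induction s using Finset.induction_on with
  | empty => simpa using emits_weight ℓ
  | insert j s hj ih =>
    have := Emits.seq (fun ad => stable_outputV ℓ ad) (by
      rintro σ ad ⟨i, -, r, -, rfl⟩ e
      simp) (emits_mean ℓ j) ih
    refine (congrArg _ (funext fun σ => ?_)).mp this
    ext ad
    simp only [Set.mem_union, Set.mem_ofPred_eq, Set.mem_singleton_iff, Finset.mem_insert,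
      or_and_right, exists_or, exists_eq_left, or_assoc]

/-- The output phase. -/
theorem exists_outputs (ℓ : ℕ) : ∃ (p : Program) (K e : ℕ), ∀ σ, Valid σ →
    ∃ σ', Runs p σ σ' (K * costUnit e 2 1 σ) ∧
      (∀ (j : Fin ℓ), ∀ i < σ.nat [0], ∀ r < σ.nat [1],
        σ'.real [5, j, i, r] = σ.real [3] * factorV ℓ j r (i + 1) σ) ∧
      ∀ r < σ.nat [1], σ'.real [6, r] = weightV ℓ σ r := by
  obtain ⟨-, p, K, e, hp⟩ := emits_means ℓ Finset.univ
  refine ⟨p, K, e, fun σ hv => ?_⟩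
  obtain ⟨σ', hr, -, hin, -⟩ := hp σ hv
  refine ⟨σ', hr, fun j i hi r hr' => ?_, fun r hr' => ?_⟩
  · rw [hin _ (.inl ⟨j, Finset.mem_univ _, i, by simpa using hi, r, by simpa using hr', rfl⟩)]
    simp [outputV]
  · rw [hin _ (.inr ⟨r, by simpa using hr', rfl⟩)]
    simp [outputV]

/-- The learning program: it searches for a decomposition of the empirical moment tensor. -/
theorem exists_learning_program (ℓ : ℕ) : ∃ (p : Program) (K e : ℕ), ∀ σ₀ : State, Valid σ₀ →
    (∀ ad, ad ≠ [0] → ad ≠ [1] → ad ≠ [2] → σ₀.nat ad = 0) → 1 ≤ baseV ℓ σ₀ →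
    ∃ σ, Runs p σ₀ σ
        (K * costUnit e 2 1 σ₀ * baseV ℓ σ₀ ^ digitsCount ℓ (σ₀.nat [1])) ∧
      ((∃ m < baseV ℓ σ₀ ^ digitsCount ℓ (σ₀.nat [1]),
          Passing ℓ σ₀ (baseV ℓ σ₀) fun i => m / baseV ℓ σ₀ ^ i % baseV ℓ σ₀) →
        ∃ m, (Passing ℓ σ₀ (baseV ℓ σ₀) fun i => m / baseV ℓ σ₀ ^ i % baseV ℓ σ₀) ∧
          (∀ (j : Fin ℓ), ∀ i < σ₀.nat [0], ∀ r < σ₀.nat [1],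
            σ.real [5, j, i, r] = σ₀.real [3] * codeFactor (σ₀.nat [0]) (σ₀.nat [1])
              (baseV ℓ σ₀) ((gaugeE ℓ).eval σ₀ ^ (2 * ℓ + 1)) (fun I => momentV ℓ I σ₀)
              (fun i => m / baseV ℓ σ₀ ^ i % baseV ℓ σ₀) j r (i + 1)) ∧
          ∀ r < σ₀.nat [1], σ.real [6, r] = codeWeight ℓ (σ₀.nat [1]) (baseV ℓ σ₀)
            (fun i => m / baseV ℓ σ₀ ^ i % baseV ℓ σ₀) r) := by
  obtain ⟨p₁, K₁, h₁⟩ := exists_prepares ℓ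
  obtain ⟨p₂, K₂, e₂, h₂⟩ := exists_searches ℓ
  obtain ⟨p₃, K₃, e₃, h₃⟩ := exists_outputs ℓ
  refine ⟨.seq p₁ (.seq p₂ p₃), 3 * K₁ + (2 * K₂ + K₃), e₂ + e₃, fun σ₀ hv hzero hL => ?_⟩
  obtain ⟨σ₁, hr₁, hP₁, hdg₁, hflag₁⟩ := h₁ σ₀ hzero
  obtain ⟨σ₂, hr₂, hP₂, hfound⟩ := h₂ σ₀ _ σ₁ hv hL hP₁ hdg₁ hflag₁
  have hv₂ : Valid σ₂ := by rw [Valid, hP₂.card, hP₂.samples]; exact hv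
  obtain ⟨σ₃, hr₃, hmean, hweight⟩ := h₃ σ₂ hv₂
  set L := baseV ℓ σ₀ with hLdef
  set D := digitsCount ℓ (σ₀.nat [1]) with hD
  refine ⟨σ₃, (hr₁.seq (hr₂.seq hr₃)).mono ?_, fun hex => ?_⟩
  · have hu₃ : costUnit e₃ 2 1 σ₂ = costUnit e₃ 2 1 σ₀ := by
      rw [costUnit, costUnit, hP₂.dim, hP₂.card, hP₂.samples]
    rw [hu₃]
    set u := costUnit (e₂ + e₃) 2 1 σ₀ with hu
    have hu1 : 1 ≤ u := one_le_costUnit hv _ _ _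
    have hu2 : costUnit e₂ 2 1 σ₀ ≤ u := costUnit_mono hv (by omega) le_rfl le_rfl
    have hu3 : costUnit e₃ 2 1 σ₀ ≤ u := costUnit_mono hv (by omega) le_rfl le_rfl
    have hR : σ₀.nat [1] ≤ u := calc
      σ₀.nat [1] = costUnit 0 1 0 σ₀ := by simp [costUnit]
      _ ≤ u := costUnit_mono hv (Nat.zero_le _) (by norm_num) (Nat.zero_le 1)
    have hD1 : D ≠ 0 := by
      have := hv.1
      rw [hD, digitsCount]
      positivity
    have hLD : L ≤ L ^ D := Nat.le_self_pow hD1 L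
    have hLD1 : 1 ≤ L ^ D := hL.trans hLD
    have a1 : L ≤ u * L ^ D := hLD.trans (Nat.le_mul_of_pos_left _ hu1)
    have a2 : σ₀.nat [1] ≤ u * L ^ D := hR.trans (Nat.le_mul_of_pos_right _ hLD1)
    have a3 : 1 ≤ u * L ^ D := hLD1.trans (Nat.le_mul_of_pos_left _ hu1)
    have a4 : u ≤ u * L ^ D := Nat.le_mul_of_pos_right _ hLD1
    calc K₁ * (L + σ₀.nat [1] + 1) + (K₂ * costUnit e₂ 2 1 σ₀ * (L ^ D + 1) +
          K₃ * costUnit e₃ 2 1 σ₀)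
        ≤ K₁ * (3 * (u * L ^ D)) + (K₂ * u * (L ^ D + L ^ D) + K₃ * (u * L ^ D)) := by
          refine Nat.add_le_add (Nat.mul_le_mul_left _ (by omega)) (Nat.add_le_add
            (Nat.mul_le_mul (Nat.mul_le_mul_left _ hu2) (by omega))
            (Nat.mul_le_mul_left _ (hu3.trans a4)))
      _ = _ := by ring
  · obtain ⟨m, -, hpass, hdg⟩ := hfound hex
    have hreal3 : σ₂.real [3] = σ₀.real [3] := hP₂.real _ (by simp) (by simp) (by simp)
    refine ⟨m, hpass, fun j i hi r hr => ?_, fun r hr => ?_⟩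
    · rw [hmean j i (by rwa [hP₂.dim]) r (by rwa [hP₂.card]), hreal3, hP₂.factorV_eq]
      simp only [hdg]
    · rw [hweight r (by rwa [hP₂.card]), hP₂.weightV_eq]
      simp only [hdg]

end RealRAM

/-! ### The parameters of the algorithm -/

/-- The quantity that bounds all the parameters of the model. -/
def modelGauge (ℓ : ℕ) (η : ℝ) (R n : ℕ) (τ γ c : ℝ) : ℝ :=
  4 * ℓ * R * (1 + 1 / η) * (n * τ * c / γ) ^ 2

theorem eval_gaugeE_inputState {ℓ n N R : ℕ} {η τ γ c : ℝ} (s : Fin N → Fin ℓ → Fin n → ℝ) :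
    (RealRAM.gaugeE ℓ).eval (inputState R η τ γ c s) = modelGauge ℓ η R n τ γ c := by
  rw [RealRAM.eval_gaugeE]
  rfl

/-- The size of the sample, as a polynomial. -/
def samplePolynomial (ℓ a : ℕ) : MvPolynomial (Fin 6) ℝ :=
  (MvPolynomial.C (4 * (ℓ : ℝ)) * .X 1 * (1 + .X 0) * (.X 2 * .X 3 * .X 5 * .X 4) ^ 2) ^
    (25 * ℓ + 100) * .X 2 ^ a

theorem sampleSize_samplePolynomial (ℓ a : ℕ) (η : ℝ) (R n : ℕ) (τ γ c : ℝ) :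
    sampleSize (samplePolynomial ℓ a) η R n τ γ c =
      ⌈modelGauge ℓ η R n τ γ c ^ (25 * ℓ + 100) * (n : ℝ) ^ a⌉₊ := by
  simp [sampleSize, samplePolynomial, modelGauge, div_eq_mul_inv]

theorem momentV_inputState {ℓ n N R : ℕ} {η τ γ c : ℝ} (s : Fin N → Fin ℓ → Fin n → ℝ)
    (I : Fin ℓ → Fin (n + 1)) :
    RealRAM.momentV ℓ (fun j => I j) (inputState R η τ γ c s) = empiricalTensor c s I := by
  have key : ∀ (t : Fin N) (j : Fin ℓ),
      RealRAM.obsV (inputState R η τ γ c s) t j (I j) = augment c (s t j) (I j) := by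
    intro t j
    refine Fin.cases ?_ (fun i => ?_) (I j)
    · simp [RealRAM.obsV]
    · rw [augment_succ, RealRAM.obsV, if_neg (by simp)]
      simp [inputState]
  rw [RealRAM.momentV, empiricalTensor]
  change (∑ t ∈ Finset.range N, _) / (N : ℝ) = _
  rw [Finset.sum_range]
  simp only [key]

theorem frobeniusNorm_le {n R : ℕ} {A : Matrix (Fin n) (Fin R) ℝ} {δ : ℝ} (hδ : 0 ≤ δ)
    (h : ∀ i r, |A i r| ≤ δ) : frobeniusNorm A ≤ n * R * δ := by
  rw [frobeniusNorm, Matrix.frobenius_norm_def, ← Real.sqrt_eq_rpow]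
  refine Real.sqrt_le_iff.2 ⟨by positivity, ?_⟩
  have h1 : ∑ i, ∑ r, ‖A i r‖ ^ (2 : ℝ) ≤ ∑ _i : Fin n, ∑ _r : Fin R, δ ^ 2 := by
    refine Finset.sum_le_sum fun i _ => Finset.sum_le_sum fun r _ => ?_
    rw [Real.rpow_two, Real.norm_eq_abs]
    exact pow_le_pow_left₀ (abs_nonneg _) (h i r) 2
  refine h1.trans ?_
  simp only [Finset.sum_const, Finset.card_univ, Fintype.card_fin, nsmul_eq_mul]
  have h2 : (n : ℝ) * R ≤ (n * R) ^ 2 := by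
    have : n * R ≤ (n * R) ^ 2 := Nat.le_self_pow (by norm_num) _
    exact_mod_cast this
  calc (n : ℝ) * (R * δ ^ 2) = n * R * δ ^ 2 := by ring
    _ ≤ (n * R) ^ 2 * δ ^ 2 := mul_le_mul_of_nonneg_right h2 (sq_nonneg _)
    _ = _ := by ring

/-- The numerical consequences of the hypotheses on the model. -/
structure ParameterBounds (ℓ : ℕ) (η : ℝ) (R n : ℕ) (τ γ c : ℝ) : Prop where
  one_le_order : 1 ≤ ℓ
  accuracy_pos : 0 < η
  two_le_card : 2 ≤ R
  one_le_dim : 1 ≤ n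
  bound_pos : 0 < c
  one_le_mul : 1 ≤ n * τ * c
  one_le_rank : 1 ≤ τ
  gap_pos : 0 < γ
  gap_le : γ ≤ 1
  card_le : (R : ℝ) ≤ 1 / γ
  dim_le : (n : ℝ) ≤ (n * τ * c) ^ 2

namespace ParameterBounds

variable {ℓ R n : ℕ} {η τ γ c : ℝ}

theorem mul_le_ratio (h : ParameterBounds ℓ η R n τ γ c) : n * τ * c ≤ n * τ * c / γ :=
  le_div_self (zero_le_one.trans h.one_le_mul) h.gap_pos h.gap_le

theorem one_le_ratio (h : ParameterBounds ℓ η R n τ γ c) : 1 ≤ n * τ * c / γ :=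
  h.one_le_mul.trans h.mul_le_ratio

theorem ratio_le_sq (h : ParameterBounds ℓ η R n τ γ c) :
    n * τ * c / γ ≤ (n * τ * c / γ) ^ 2 := le_self_pow₀ h.one_le_ratio (by norm_num)

theorem le_gauge (h : ParameterBounds ℓ η R n τ γ c) :
    4 * ℓ * (1 + 1 / η) * (n * τ * c / γ) ^ 2 ≤ modelGauge ℓ η R n τ γ c := by
  have hη : 0 < 1 / η := one_div_pos.2 h.accuracy_pos
  have hR : (1 : ℝ) ≤ R := by exact_mod_cast (by have := h.two_le_card; omega : 1 ≤ R)
  have h0 : 0 ≤ 4 * (ℓ : ℝ) * (1 + 1 / η) * (n * τ * c / γ) ^ 2 := by positivity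
  calc _ ≤ 4 * ℓ * (1 + 1 / η) * (n * τ * c / γ) ^ 2 * R := le_mul_of_one_le_right h0 hR
    _ = _ := by rw [modelGauge]; ring

theorem four_mul_order_le (h : ParameterBounds ℓ η R n τ γ c) :
    4 * (ℓ : ℝ) * (n * τ * c / γ) ^ 2 ≤ modelGauge ℓ η R n τ γ c := by
  have hη : 0 < 1 / η := one_div_pos.2 h.accuracy_pos
  refine le_trans ?_ h.le_gauge
  have h0 : 0 ≤ 4 * (ℓ : ℝ) * (n * τ * c / γ) ^ 2 := by positivity
  nlinarith

theorem four_mul_sq_le (h : ParameterBounds ℓ η R n τ γ c) :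
    4 * (n * τ * c / γ) ^ 2 ≤ modelGauge ℓ η R n τ γ c := by
  refine le_trans ?_ h.four_mul_order_le
  have hℓ : (1 : ℝ) ≤ ℓ := by exact_mod_cast h.one_le_order
  have := mul_le_mul_of_nonneg_right hℓ (sq_nonneg (n * τ * c / γ))
  linarith

theorem four_le (h : ParameterBounds ℓ η R n τ γ c) : 4 ≤ modelGauge ℓ η R n τ γ c := by
  have := h.four_mul_sq_le
  have := h.ratio_le_sq
  have := h.one_le_ratio
  linarith

theorem order_le (h : ParameterBounds ℓ η R n τ γ c) : (ℓ : ℝ) ≤ modelGauge ℓ η R n τ γ c := by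
  refine le_trans ?_ h.four_mul_order_le
  have h1 : (1 : ℝ) ≤ (n * τ * c / γ) ^ 2 := h.one_le_ratio.trans h.ratio_le_sq
  have h2 : (0 : ℝ) ≤ ℓ := Nat.cast_nonneg _
  nlinarith

theorem inv_accuracy_lt (h : ParameterBounds ℓ η R n τ γ c) :
    1 / η < modelGauge ℓ η R n τ γ c := by
  refine lt_of_lt_of_le ?_ h.le_gauge
  have hη : 0 < 1 / η := one_div_pos.2 h.accuracy_pos
  have hℓ : (1 : ℝ) ≤ ℓ := by exact_mod_cast h.one_le_order
  have h1 : (1 : ℝ) ≤ (n * τ * c / γ) ^ 2 := h.one_le_ratio.trans h.ratio_le_sq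
  have h2 : 1 ≤ 4 * (ℓ : ℝ) := by linarith
  have h3 : 1 ≤ 4 * (ℓ : ℝ) * (n * τ * c / γ) ^ 2 := by nlinarith
  calc 1 / η < 1 + 1 / η := by linarith
    _ ≤ (1 + 1 / η) * (4 * (ℓ : ℝ) * (n * τ * c / γ) ^ 2) :=
      le_mul_of_one_le_right (by positivity) h3
    _ = _ := by ring

theorem ratio_le (h : ParameterBounds ℓ η R n τ γ c) :
    n * τ * c / γ ≤ modelGauge ℓ η R n τ γ c := by
  have := h.four_mul_sq_le
  have := h.ratio_le_sq
  have := h.one_le_ratio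
  linarith

theorem inv_gap_le (h : ParameterBounds ℓ η R n τ γ c) : 1 / γ ≤ modelGauge ℓ η R n τ γ c :=
  (div_le_div_of_nonneg_right h.one_le_mul h.gap_pos.le).trans h.ratio_le

theorem dim_add_one_le (h : ParameterBounds ℓ η R n τ γ c) :
    (n : ℝ) + 1 ≤ modelGauge ℓ η R n τ γ c := by
  have h1 := h.four_mul_sq_le
  have h2 := h.ratio_le_sq
  have h3 := h.one_le_ratio
  have h4 : (n * τ * c) ^ 2 ≤ (n * τ * c / γ) ^ 2 :=
    pow_le_pow_left₀ (zero_le_one.trans h.one_le_mul) h.mul_le_ratio 2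
  have h5 := h.dim_le
  linarith

theorem bound_le (h : ParameterBounds ℓ η R n τ γ c) : c ≤ modelGauge ℓ η R n τ γ c := by
  refine le_trans ?_ (h.mul_le_ratio.trans h.ratio_le)
  have hn : (1 : ℝ) ≤ n := by exact_mod_cast h.one_le_dim
  exact le_mul_of_one_le_left h.bound_pos.le (by nlinarith [h.one_le_rank])

/-- With `X = R * ℓ / min η 1`, which is at least 2, the prefactor is at most `8 * X ≤ X ^ 4`. In
this form `log G` splits into the two logarithms of the running time. -/
theorem gauge_le (h : ParameterBounds ℓ η R n τ γ c) :
    modelGauge ℓ η R n τ γ c ≤ (R * ℓ / min η 1) ^ 4 * (n * (τ * c / γ)) ^ 2 := by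
  have hη := h.accuracy_pos
  have hm : 0 < min η 1 := lt_min hη one_pos
  have hm1 : min η 1 ≤ 1 := min_le_right _ _
  have hR : (2 : ℝ) ≤ R := by exact_mod_cast h.two_le_card
  have hℓ : (1 : ℝ) ≤ ℓ := by exact_mod_cast h.one_le_order
  set X := R * ℓ / min η 1 with hX
  have hX2 : 2 ≤ X := by
    rw [hX, le_div_iff₀ hm]
    nlinarith
  have h1 : 1 + 1 / η ≤ 2 / min η 1 := by
    have e1 : 1 ≤ 1 / min η 1 := one_le_one_div hm hm1
    have e2 : 1 / η ≤ 1 / min η 1 := one_div_le_one_div_of_le hm (min_le_left _ _)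
    calc 1 + 1 / η ≤ 1 / min η 1 + 1 / min η 1 := add_le_add e1 e2
      _ = 2 / min η 1 := by ring
  have h2 : 4 * (ℓ : ℝ) * R * (1 + 1 / η) ≤ X ^ 4 := by
    calc 4 * (ℓ : ℝ) * R * (1 + 1 / η) ≤ 4 * (ℓ : ℝ) * R * (2 / min η 1) :=
          mul_le_mul_of_nonneg_left h1 (by positivity)
      _ = 2 ^ 3 * X := by rw [hX]; ring
      _ ≤ X ^ 3 * X := by gcongr
      _ = X ^ 4 := by ring
  rw [modelGauge, show n * (τ * c / γ) = n * τ * c / γ by ring]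
  exact mul_le_mul_of_nonneg_right h2 (sq_nonneg _)

/-- The search is within the bound on the running time. -/
theorem gauge_pow_le (h : ParameterBounds ℓ η R n τ γ c) :
    modelGauge ℓ η R n τ γ c ^ (316 * ℓ ^ 3 * R ^ 2) ≤
      Real.exp (1264 * timeExponent ℓ η R n τ γ c) := by
  have hη := h.accuracy_pos
  have hm : 0 < min η 1 := lt_min hη one_pos
  have hm1 : min η 1 ≤ 1 := min_le_right _ _
  have hR : (2 : ℝ) ≤ R := by exact_mod_cast h.two_le_card
  have hℓ : (1 : ℝ) ≤ ℓ := by exact_mod_cast h.one_le_order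
  have hG : 0 < modelGauge ℓ η R n τ γ c := by linarith [h.four_le]
  have hX1 : 1 ≤ R * ℓ / min η 1 := by
    rw [le_div_iff₀ hm]
    nlinarith
  have hP1 : 1 ≤ n * (τ * c / γ) := by
    have := h.one_le_ratio
    rwa [show n * (τ * c / γ) = n * τ * c / γ by ring]
  rw [← Real.log_le_iff_le_exp (pow_pos hG _), Real.log_pow]
  have hlog := Real.log_le_log hG h.gauge_le
  rw [Real.log_mul (by positivity) (by positivity), Real.log_pow, Real.log_pow] at hlog
  have hΛ := Real.log_nonneg hX1
  have hΘ := Real.log_nonneg hP1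
  rw [timeExponent]
  set Λ := Real.log (R * ℓ / min η 1)
  set Θ := Real.log (n * (τ * c / γ))
  -- The search only needs the factor `ℓ` in front of the first logarithm.
  have h4 : (ℓ : ℝ) ≤ 2 ^ (2 * ℓ) := by
    have e1 : ℓ < 2 ^ ℓ := Nat.lt_two_pow_self
    have e2 : 2 ^ ℓ ≤ 2 ^ (2 * ℓ) := Nat.pow_le_pow_right (by norm_num) (by omega)
    exact_mod_cast (e1.le.trans e2)
  push_cast at hlog ⊢
  calc 316 * (ℓ : ℝ) ^ 3 * R ^ 2 * Real.log (modelGauge ℓ η R n τ γ c)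
      ≤ 316 * (ℓ : ℝ) ^ 3 * R ^ 2 * (4 * Λ + 2 * Θ) :=
        mul_le_mul_of_nonneg_left hlog (by positivity)
    _ = 1264 * ((R : ℝ) ^ 2 * ℓ ^ 2) * (ℓ * Λ) + 632 * ((R : ℝ) ^ 2 * ℓ ^ 2) * (ℓ * Θ) := by ring
    _ ≤ 1264 * ((R : ℝ) ^ 2 * ℓ ^ 2) * (2 ^ (2 * ℓ) * Λ)
        + 1264 * ((R : ℝ) ^ 2 * ℓ ^ 2) * (ℓ * Θ) := by
        refine add_le_add ?_ ?_
        · exact mul_le_mul_of_nonneg_left (mul_le_mul_of_nonneg_right h4 hΛ) (by positivity)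
        · refine mul_le_mul_of_nonneg_right (mul_le_mul_of_nonneg_right (by norm_num)
            (by positivity)) (by positivity)
    _ = _ := by ring

theorem card_le_gauge (h : ParameterBounds ℓ η R n τ γ c) : (R : ℝ) ≤ modelGauge ℓ η R n τ γ c :=
  h.card_le.trans h.inv_gap_le

/-- The running time of the search. -/
theorem time_le (h : ParameterBounds ℓ η R n τ γ c) {K e a N L : ℕ}
    (hN : N = ⌈modelGauge ℓ η R n τ γ c ^ (25 * ℓ + 100) * (n : ℝ) ^ a⌉₊)
    (hL : L = ⌈modelGauge ℓ η R n τ γ c ^ (12 * ℓ + 50)⌉₊) :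
    ((K * ((n + 1) ^ e * R ^ 2 * N) * L ^ RealRAM.digitsCount ℓ R : ℕ) : ℝ) ≤
      Real.exp (1264 * timeExponent ℓ η R n τ γ c) * (2 * K * (n + 1) ^ e * n ^ a) := by
  have hG4 := h.four_le
  set G := modelGauge ℓ η R n τ γ c with hG
  have hG1 : 1 ≤ G := by linarith
  have hG0 : 0 < G := by linarith
  have hn : (1 : ℝ) ≤ n := by exact_mod_cast h.one_le_dim
  have hceil : ∀ y : ℝ, 1 ≤ y → ((⌈y⌉₊ : ℕ) : ℝ) ≤ 2 * y := fun y hy => by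
    have := Nat.ceil_lt_add_one (zero_le_one.trans hy)
    linarith
  have hN' : (N : ℝ) ≤ 2 * (G ^ (25 * ℓ + 100) * (n : ℝ) ^ a) := by
    rw [hN]
    exact hceil _ (one_le_mul_of_one_le_of_one_le (one_le_pow₀ hG1) (one_le_pow₀ hn))
  have hL' : (L : ℝ) ≤ G ^ (12 * ℓ + 51) := by
    rw [hL]
    refine (hceil _ (one_le_pow₀ hG1)).trans ?_
    rw [show 12 * ℓ + 51 = (12 * ℓ + 50) + 1 by ring, pow_succ, mul_comm]
    exact mul_le_mul_of_nonneg_left (by linarith) (by positivity)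
  have hR' : (R : ℝ) ^ 2 ≤ G ^ 2 := pow_le_pow_left₀ (Nat.cast_nonneg _) h.card_le_gauge 2
  -- The exponents come from `R ^ 2`, from the sample size and from the number of codes; the
  -- constant is `316 = 127 + 63 * 3`.
  have hexp : 2 + (25 * ℓ + 100) + (12 * ℓ + 51) * RealRAM.digitsCount ℓ R ≤
      316 * ℓ ^ 3 * R ^ 2 := by
    have hℓ := h.one_le_order
    have hR1 : 1 ≤ R ^ 2 := Nat.one_le_pow _ _ (by have := h.two_le_card; omega)
    have hℓ2 : ℓ ≤ ℓ ^ 2 := Nat.le_self_pow (by norm_num) _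
    have hℓ3 : ℓ ≤ ℓ ^ 3 := Nat.le_self_pow (by norm_num) _
    have e1 : RealRAM.digitsCount ℓ R ≤ 3 * ℓ ^ 2 * R ^ 2 := by
      rw [RealRAM.digitsCount, ← pow_two, ← pow_two]
      exact Nat.mul_le_mul_right _ (by omega)
    have e2 : (12 * ℓ + 51) * RealRAM.digitsCount ℓ R ≤ 63 * ℓ * (3 * ℓ ^ 2 * R ^ 2) :=
      Nat.mul_le_mul (by omega) e1
    have e3 : 2 + (25 * ℓ + 100) ≤ 127 * (ℓ ^ 3 * R ^ 2) := by
      have : ℓ ^ 3 * 1 ≤ ℓ ^ 3 * R ^ 2 := Nat.mul_le_mul_left _ hR1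
      omega
    calc _ ≤ 127 * (ℓ ^ 3 * R ^ 2) + 63 * ℓ * (3 * ℓ ^ 2 * R ^ 2) := Nat.add_le_add e3 e2
      _ = _ := by ring
  have hn0 : (0 : ℝ) ≤ n := Nat.cast_nonneg n
  push_cast
  calc (K : ℝ) * ((n + 1) ^ e * R ^ 2 * N) * L ^ RealRAM.digitsCount ℓ R
      ≤ K * ((n + 1) ^ e * G ^ 2 * (2 * (G ^ (25 * ℓ + 100) * (n : ℝ) ^ a))) *
          (G ^ (12 * ℓ + 51)) ^ RealRAM.digitsCount ℓ R := by
        gcongr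
    _ = G ^ (2 + (25 * ℓ + 100) + (12 * ℓ + 51) * RealRAM.digitsCount ℓ R) *
          (2 * K * (n + 1) ^ e * n ^ a) := by
        rw [pow_add, pow_add, pow_mul]; ring
    _ ≤ G ^ (316 * ℓ ^ 3 * R ^ 2) * (2 * K * (n + 1) ^ e * n ^ a) :=
        mul_le_mul_of_nonneg_right (pow_le_pow_right₀ hG1 hexp) (by positivity)
    _ ≤ _ := mul_le_mul_of_nonneg_right h.gauge_pow_le (by positivity)

end ParameterBounds

/-! ### From the hypotheses on the model to the numerical bounds -/

namespace IsMultiViewMixture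

variable {Ω : Type*} [MeasurableSpace Ω] {P : Measure Ω} {ℓ n R k : ℕ} {h : Ω → Fin R}
  {x : Fin ℓ → Ω → (Fin n → ℝ)} {w : Fin R → ℝ} {M : Fin ℓ → Matrix (Fin n) (Fin R) ℝ}
  {η τ γ c : ℝ}

/-- The latent variable takes a value, so `R ≥ 1` and therefore `k ≥ 2`. The robust rank then
excludes zero columns, which makes `n` and `c` positive. Weights that sum to 1 and exceed `γ` give
`γ ≤ 1` and `R ≤ 1 / γ`. The independence constant `τ * c` of the augmented factors is relaxed to `n
* τ * c`, which is at least 1. -/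
theorem parameterBounds (hm : IsMultiViewMixture P h x w M c) (hℓ : 1 ≤ ℓ) (hη : 0 < η)
    (hτ : 1 ≤ τ) (hγ : 0 < γ) (hw : ∀ r, γ < w r) (hk : 2 * (R : ℝ) / ℓ + 1 ≤ k)
    (hrank : ∀ j, k ≤ robustKruskalRank τ (M j)) :
    ParameterBounds ℓ η R n τ γ c ∧ IsBoundedMixture n R k (n * τ * c) γ (modelGauge ℓ η R n τ γ c) w
      fun j r => augment c fun i => M j i r := by
  have := hm.isProbabilityMeasure
  obtain ⟨ω⟩ := nonempty_of_isProbabilityMeasure P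
  have hR1 : 1 ≤ R := Fin.pos (h ω)
  have hℓ' : (1 : ℝ) ≤ ℓ := by exact_mod_cast hℓ
  have hℓ0 : (0 : ℝ) < ℓ := by linarith
  have hR' : (1 : ℝ) ≤ R := by exact_mod_cast hR1
  have hk2 : 2 ≤ k := by
    have h1 : 0 < 2 * (R : ℝ) / ℓ := by positivity
    have h2 : (1 : ℝ) < k := by linarith
    exact_mod_cast h2
  have hw0 : ∀ r, 0 < w r := fun r => hγ.trans (hw r)
  have hτ0 : 0 < τ := by linarith
  have hrob := fun j => robustIndep_of_le_robustKruskalRank hτ0 (by omega) (hrank j)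
  have hkR : k ≤ R := (hrob ⟨0, hℓ⟩).1
  have hbound : ∀ j r i, |M j i r| ≤ c := fun j r i => hm.abs_mean_le (hw0 r) j i
  have hone := RobustIndep.one_le (by omega) (fun r i => hbound ⟨0, hℓ⟩ r i) (h ω)
    (hrob ⟨0, hℓ⟩).2
  have hn1 : 1 ≤ n := by
    by_contra hn
    have : n = 0 := by omega
    subst this
    norm_num at hone
  have hn' : (1 : ℝ) ≤ n := by exact_mod_cast hn1
  have hc0 : 0 ≤ c := (abs_nonneg _).trans (hbound ⟨0, hℓ⟩ (h ω) ⟨0, hn1⟩)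
  have hc : 0 < c := by
    refine lt_of_le_of_ne hc0 fun hc => ?_
    rw [← hc] at hone
    norm_num at hone
  have hdim : (n : ℝ) ≤ (n * τ * c) ^ 2 := by
    calc (n : ℝ) = n * 1 := (mul_one _).symm
      _ ≤ n * (τ ^ 2 * (n * c ^ 2)) := mul_le_mul_of_nonneg_left hone (by linarith)
      _ = _ := by ring
  have hmul0 : 0 ≤ n * τ * c := by positivity
  have hmul : 1 ≤ n * τ * c := by
    by_contra hlt
    push Not at hlt
    have := pow_lt_one₀ hmul0 hlt (two_ne_zero)
    linarith
  have hsum := hm.sum_weight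
  have hw1 : ∀ r, w r ≤ 1 := fun r => by
    rw [← hsum]
    exact Finset.single_le_sum (fun i _ => (hw0 i).le) (Finset.mem_univ r)
  have hcard : (R : ℝ) ≤ 1 / γ := by
    rw [le_div_iff₀ hγ, ← hsum]
    have := Finset.card_nsmul_le_sum Finset.univ w γ fun r _ => (hw r).le
    simpa using this
  have hb : ParameterBounds ℓ η R n τ γ c :=
    ⟨hℓ, hη, hk2.trans hkR, hn1, hc, hmul, hτ, hγ, (hw (h ω)).le.trans (hw1 _), hcard, hdim⟩
  refine ⟨hb, ⟨fun j => ?_, hk2, hkR, ?_, hmul, hb.mul_le_ratio.trans hb.ratio_le, hγ,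
    hb.inv_gap_le, fun r => (hw r).le, hw1, hsum,
    fun j r i => abs_augment_le hc (fun i => hbound j r i) i, fun j r => rfl, hb.four_le,
    hb.dim_add_one_le, hb.card_le_gauge, hb.order_le⟩⟩
  · refine ((hrob j).2.augment hc hτ0.le).mono ?_
    rw [mul_assoc]
    exact le_mul_of_one_le_left (by positivity) hn'
  · have h1 : 2 * (R : ℝ) ≤ ℓ * (k - 1) := by
      rw [← le_sub_iff_add_le, div_le_iff₀ hℓ0] at hk
      linarith
    have h2 : ((k - 1 : ℕ) : ℝ) = k - 1 := by
      rw [Nat.cast_sub (by omega), Nat.cast_one]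
    rw [← h2] at h1
    exact_mod_cast h1

end IsMultiViewMixture

theorem valid_inputState {ℓ n N R : ℕ} {η τ γ c : ℝ} (s : Fin N → Fin ℓ → Fin n → ℝ)
    (hR : 1 ≤ R) (hN : 1 ≤ N) : RealRAM.Valid (inputState R η τ γ c s) := ⟨hR, hN⟩

theorem inputState_nat_eq_zero {ℓ n N R : ℕ} {η τ γ c : ℝ} (s : Fin N → Fin ℓ → Fin n → ℝ)
    (ad : List ℕ) (h0 : ad ≠ [0]) (h1 : ad ≠ [1]) (h2 : ad ≠ [2]) :
    (inputState R η τ γ c s).nat ad = 0 := by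
  simp only [inputState]

/-- A decomposition with small entrywise errors recovers the model. -/
theorem recovers_of_close {ℓ n R : ℕ} {η τ γ c : ℝ} {w : Fin R → ℝ}
    {M : Fin ℓ → Matrix (Fin n) (Fin R) ℝ} {σ : RealRAM.State}
    (hb : ParameterBounds ℓ η R n τ γ c) {b : Fin ℓ → ℕ → ℕ → ℝ} {v : ℕ → ℝ}
    (hmean : ∀ (j : Fin ℓ), ∀ i < n, ∀ r < R, σ.real [5, j, i, r] = c * b j r (i + 1))
    (hweight : ∀ r < R, σ.real [6, r] = v r) (π : Equiv.Perm (Fin R))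
    (hπ : ∀ r, (∀ j (i : Fin (n + 1)), |augment c (fun i => M j i r) i - b j (π r) i| ≤
      (modelGauge ℓ η R n τ γ c ^ 10)⁻¹) ∧ |w r - v (π r)| ≤ (modelGauge ℓ η R n τ γ c ^ 10)⁻¹) :
    Recovers M w η σ := by
  have hη := hb.accuracy_pos
  have hG4 := hb.four_le
  have hGη := hb.inv_accuracy_lt
  have hGn := hb.dim_add_one_le
  have hGR := hb.card_le_gauge
  have hGc := hb.bound_le
  have hc := hb.bound_pos
  set G := modelGauge ℓ η R n τ γ c with hG
  have hG0 : 0 < G := by linarith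
  have hG1 : 1 ≤ G := by linarith
  have hinv : G⁻¹ < η := by
    rw [one_div] at hGη
    exact inv_lt_of_inv_lt₀ hη hGη
  refine ⟨π, fun j => ?_, fun r => ?_⟩
  · refine (frobeniusNorm_le (δ := c * (G ^ 10)⁻¹) (by positivity) fun i r => ?_).trans ?_
    -- The shift by 1 skips the augmented coordinate, and the factor `c` undoes the scaling. The
    -- Frobenius error is then at most `n * R * c` times the entrywise error, with each of `n`, `R`,
    -- `c` at most `G`.
    · have h1 := (hπ r).1 j i.succ
      rw [augment_succ, Fin.val_succ] at h1
      rw [Matrix.sub_apply, Matrix.submatrix_apply, outputMean, Matrix.of_apply, id,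
        hmean j i i.2 (π r) (π r).2,
        show M j i r - c * b j (π r) (i + 1) = c * (M j i r / c - b j (π r) (i + 1)) by
          field_simp, abs_mul, abs_of_pos hc]
      exact mul_le_mul_of_nonneg_left h1 hc.le
    · calc (n : ℝ) * R * (c * (G ^ 10)⁻¹) ≤ G * G * (G * (G ^ 10)⁻¹) := by
            gcongr
            linarith
        _ = (G ^ 7)⁻¹ := by field_simp
        _ ≤ G⁻¹ := inv_anti₀ hG0 (le_self_pow₀ hG1 (by norm_num))
        _ ≤ η := hinv.le
  · rw [outputWeight, hweight _ (π r).2]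
    exact ((hπ r).2.trans (inv_anti₀ hG0 (le_self_pow₀ hG1 (by norm_num)))).trans_lt hinv

theorem theorem2p4 :
    ∃ C : ℝ, ∀ ℓ : ℕ, 1 ≤ ℓ → ∀ a : ℕ,
      ∃ (prog : RealRAM.Program) (ϑ : MvPolynomial (Fin 6) ℝ) (q : Polynomial ℝ),
        ∀ (n R k : ℕ) (η τ γ cmax : ℝ), 0 < η → 1 ≤ τ → 0 < γ →
        ∀ (Ω : Type*) [MeasurableSpace Ω] (P : Measure Ω)
          (h : Ω → Fin R) (x : Fin ℓ → Ω → (Fin n → ℝ)) (w : Fin R → ℝ)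
          (M : Fin ℓ → Matrix (Fin n) (Fin R) ℝ),
          IsMultiViewMixture P h x w M cmax →
          (∀ r, γ < w r) →
          2 * (R : ℝ) / (ℓ : ℝ) + 1 ≤ (k : ℝ) →
          (∀ j, k ≤ robustKruskalRank τ (M j)) →
          (∀ s : Fin (sampleSize ϑ η R n τ γ cmax) → Fin ℓ → Fin n → ℝ,
            ∃ (σ : RealRAM.State) (t : ℕ),
              RealRAM.Exec prog (inputState R η τ γ cmax s) σ t ∧
              (t : ℝ) ≤ Real.exp (C * timeExponent ℓ η R n τ γ cmax) * q.eval (n : ℝ)) ∧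
          sampleLaw P x (sampleSize ϑ η R n τ γ cmax)
            {s | ¬ ∃ (σ : RealRAM.State) (t : ℕ),
              RealRAM.Exec prog (inputState R η τ γ cmax s) σ t ∧ Recovers M w η σ} ≤
            ENNReal.ofReal (1 / (n : ℝ) ^ a) := by
  refine ⟨1264, fun ℓ hℓ a => ?_⟩
  obtain ⟨prog, K, e, hprog⟩ := RealRAM.exists_learning_program ℓ
  refine ⟨prog, samplePolynomial ℓ a, .C (2 * K) * (.X + 1) ^ e * .X ^ a, ?_⟩
  intro n R k η τ γ c hη hτ hγ Ω _ P h x w M hm hw hk hrank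
  obtain ⟨hb, hmix⟩ := hm.parameterBounds hℓ hη hτ hγ hw hk hrank
  have hN := sampleSize_samplePolynomial ℓ a η R n τ γ c
  set N := sampleSize (samplePolynomial ℓ a) η R n τ γ c with hNdef
  have hG4 := hb.four_le
  have hGdim := hb.dim_add_one_le
  set G := modelGauge ℓ η R n τ γ c with hG
  have hG0 : 0 < G := by linarith
  have hG1 : 1 ≤ G := by linarith
  have hn0 : (0 : ℝ) < n := by exact_mod_cast hb.one_le_dim
  have hNpos : 1 ≤ N := by
    rw [hN, Nat.one_le_ceil_iff]
    positivity
  have hNge : G ^ (25 * ℓ + 100) * (n : ℝ) ^ a ≤ N := by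
    rw [hN]; exact Nat.le_ceil _
  have hbase : ∀ s : Fin N → Fin ℓ → Fin n → ℝ,
      RealRAM.baseV ℓ (inputState R η τ γ c s) = ⌈G ^ (12 * ℓ + 50)⌉₊ := fun s => by
    rw [RealRAM.baseV, eval_gaugeE_inputState]
  set L := ⌈G ^ (12 * ℓ + 50)⌉₊ with hL
  have hLge : G ^ (12 * ℓ + 50) ≤ L := Nat.le_ceil _
  have hLpos : 1 ≤ L := by
    rw [hL, Nat.one_le_ceil_iff]
    positivity
  have hrun := fun s : Fin N → Fin ℓ → Fin n → ℝ => hprog (inputState R η τ γ c s)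
    (valid_inputState s (by have := hb.two_le_card; omega) hNpos) (inputState_nat_eq_zero s)
    (by rw [hbase]; exact hLpos)
  refine ⟨fun s => ?_, ?_⟩
  -- Halting within the time bound does not depend on the samples being typical.
  · obtain ⟨σ, ⟨t, ht, hexec⟩, -⟩ := hrun s
    refine ⟨σ, t, hexec, ?_⟩
    rw [hbase] at ht
    refine (Nat.cast_le.2 ht).trans ((hb.time_le (K := K) (e := e) hN hL).trans_eq' ?_ |>.trans ?_)
    · simp [RealRAM.costUnit, inputState]
    · simp
  -- Failure is contained in the event that some entry of the empirical tensor is off. Monotonicity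
  -- holds for arbitrary sets, so measurability of the failure set is not needed.
  · refine (measure_mono fun s hs => ?_).trans
      ((hm.sampleLaw_exists_deviation_le hb.bound_pos (fun r => hγ.trans (hw r)) hNpos
        (ε := (G ^ (12 * ℓ + 50))⁻¹) (by positivity)).trans (ENNReal.ofReal_le_ofReal ?_))
    · by_contra hgood
      refine hs ?_
      simp only [Set.mem_ofPred_eq, not_exists, not_le] at hgood
      obtain ⟨σ, ⟨t, -, hexec⟩, hout⟩ := hrun s
      rw [hbase] at hout
      have hT : ∀ I : Fin ℓ → Fin (n + 1),
          |RealRAM.momentV ℓ (fun j => I j) (inputState R η τ γ c s) -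
            mixtureTensor w (fun j r => augment c fun i => M j i r) I| ≤
            (G ^ (12 * ℓ + 50))⁻¹ := fun I => by
        rw [momentV_inputState]; exact (hgood I).le
      have hex := hmix.exists_codePasses
        (That := fun I => RealRAM.momentV ℓ I (inputState R η τ γ c s)) hT le_rfl hLge
      obtain ⟨m, hpass, hmean, hweight⟩ := hout (by
        simp only [RealRAM.Passing, eval_gaugeE_inputState]
        exact hex)
      simp only [RealRAM.Passing, eval_gaugeE_inputState] at hpass hmean
      -- The code found need not be the one shown to exist; robust uniqueness covers every passing
      -- code.
      obtain ⟨π, hπ⟩ := hmix.exists_perm_of_codePasses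
        (fun p => (Nat.mod_lt _ hLpos).le)
        (fun I => (hT I).trans (inv_anti₀ (by positivity) (pow_le_pow_right₀ hG1 (by omega))))
        hpass le_rfl
      exact ⟨σ, t, hexec, recovers_of_close hb hmean hweight π hπ⟩
    -- The union bound contributes `G ^ ℓ` and the squared accuracy `G ^ (24 * ℓ + 100)`; together
    -- this is the power of `G` in the sample size, and `n ^ a` remains.
    · have h1 : ((n : ℝ) + 1) ^ ℓ ≤ G ^ ℓ := pow_le_pow_left₀ (by positivity) hGdim ℓ
      have hN0 : (0 : ℝ) < N := by exact_mod_cast hNpos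
      rw [inv_pow, ← pow_mul, one_div (_ * _), mul_inv, inv_inv, mul_comm (N : ℝ)⁻¹, ← mul_assoc,
        ← div_eq_mul_inv, div_le_div_iff₀ hN0 (by positivity), one_mul]
      refine le_trans ?_ hNge
      refine mul_le_mul_of_nonneg_right ?_ (by positivity)
      calc ((n : ℝ) + 1) ^ ℓ * G ^ ((12 * ℓ + 50) * 2) ≤ G ^ ℓ * G ^ ((12 * ℓ + 50) * 2) :=
            mul_le_mul_of_nonneg_right h1 (by positivity)
        _ = G ^ (25 * ℓ + 100) := by rw [← pow_add]; congr 1; ring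

end
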